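/- **Model.** Read requests $0,1,2,\dots$ arrive at times $T_A^0\le T_A^1\le\cdots$ at a dispatcher with at most $L\ge 1$ simultaneously active threads. Every requested file is stored as $n$ replicas ($k=1$). A thread can be started, at any time after the arrival of a request and before its departure, on a replica of its file that has not been started before; downloading replica $j$ of request $i$ takes time $X_{i,j}$. Request $i$ departs at the time $T_F^i$ when the first of its downloads finishes, and its other downloads are then terminated; apart from this, started downloads are not interrupted. The $X_{i,j}$ are i.i.d. exponential with rate $\mu>0$, independent of the arrivals. A scheduling scheme chooses the starting times. It is *on-line* if its decisions up to any time $t$ depend only on the arrivals up to $t$, the downloads completed up to $t$ with their completion times, and an independent random seed. It is *work-conserving* if all $L$ threads are active whenever there is a request in the system (arrived and not departed). Write $D_i=T_F^i-T_A^i$, let $N_T$ be the number of arrivals in $[0,T]$, and let $$\mathbb E_\pi[D]=\limsup_{T\to\infty}\ \mathbb E_\pi\Big[\frac1{N_T}\sum_{i\le N_T}D_i\Big],$$ the sum being over the first $N_T$ requests. The queue is *stable* under $\pi$ if $\mathbb E_\pi[D]<\infty$. Let an arrival process of long-run rate $1$ be given (arrival times $0\le a_0\le a_1\le\cdots$ with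 $a_i/i\to1$ almost surely); at rate $\lambda>0$ the arrival times are $a_i/\lambda$. The *capacity region* $\Lambda$ is the set of rates $\lambda>0$ at which some on-line scheme makes the queue stable. A scheme is *throughput optimal* if it makes the queue stable at every rate $\lambda>0$ such that $\lambda+\epsilon\in\Lambda$ for some $\epsilon>0$; it is *delay optimal* if at every such rate it attains the smallest $\mathbb E_\pi[D]$ among all on-line schemes. **Theorem 1.** Let $k=1$ and $n\ge L\ge 1$, and let the downloading times be i.i.d. exponential. Let $\pi$ be any work-conserving on-line scheme, and let any arrival process of long-run rate $1$ be given. 1. Conditionally on the arrival process, $\pi$ is throughput optimal and delay optimal among all on-line schemes: for almost every realization $(a_i)$, this holds when the arrival times are the fixed sequences $(a_i/\lambda)$. In particular it holds for every fixed nondecreasing sequence with $a_i/i\to1$. 2. If moreover, for each $\eta>0$, the last index $i$ with $|a_i-i|>\eta i$ has a finite mean, as is the case for Poisson arrivals, then $\pi$ is also throughput optimal and delay optimal among all on-line schemes when the expectations are taken over the arrivals as well. -/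

import Mathlib

open MeasureTheory ProbabilityTheory Filter Topology
open scoped NNReal ENNReal

namespace ReplicationQueue

/-- The primitive data that drive the system when every file has `n` replicas (the case `k = 1`):
* the arrival times of the read requests `0, 1, 2, …`;
* the downloading time of each of the `n` replicas of each request;
* a random seed, available to the dispatcher for randomized decisions. -/
abbrev Sample (n : ℕ) : Type :=
  (ℕ → ℝ≥0) × (ℕ × Fin n → ℝ≥0) × unitInterval

/-- Arrival time `T_A^i` of request `i`. -/
def Sample.arrival {n : ℕ} (ω : Sample n) (i : ℕ) : ℝ≥0 := ω.1 i

/-- Downloading time `X_{i,j}` of replica `j` of request `i`. -/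
def Sample.download {n : ℕ} (ω : Sample n) (i : ℕ) (j : Fin n) : ℝ≥0 := ω.2.1 (i, j)

/-- The seed of the dispatcher. -/
def Sample.seed {n : ℕ} (ω : Sample n) : unitInterval := ω.2.2

/-- The requests are numbered in the order of their arrivals, only finitely many of them arrive in
a bounded time, and downloads take a positive time. -/
structure Sample.Regular {n : ℕ} (ω : Sample n) : Prop where
  arrival_mono : Monotone ω.arrival
  arrival_tendsto : Tendsto ω.arrival atTop atTop
  download_pos : ∀ i j, 0 < ω.download i j

/-- A rule that gives, for each realization, the time at which a thread starts to download
replica `j` of request `i`; the value `∞` means that this download never starts. -/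
abbrev StartRule (n : ℕ) : Type := Sample n → ℕ → Fin n → ℝ≥0∞

namespace StartRule

variable {n : ℕ} (S : StartRule n)

/-- The time `T_F^{i,j} = T_S^{i,j} + X_{i,j}` at which the download of replica `j` of request `i`
finishes, unless it is terminated before. -/
noncomputable def finish (ω : Sample n) (i : ℕ) (j : Fin n) : ℝ≥0∞ :=
  S ω i j + (ω.download i j : ℝ≥0∞)

/-- The departure time `T_F^i` of request `i`: as `k = 1`, the time at which the first of its
downloads finishes. All its other downloads are then terminated. -/
noncomputable def departure (ω : Sample n) (i : ℕ) : ℝ≥0∞ := ⨅ j, S.finish ω i j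

/-- The delay `D_i = T_F^i - T_A^i` of request `i`. -/
noncomputable def delay (ω : Sample n) (i : ℕ) : ℝ≥0∞ :=
  S.departure ω i - (ω.arrival i : ℝ≥0∞)

/-- The downloads in progress at time `t`; each of them occupies one thread. -/
def activeAt (ω : Sample n) (t : ℝ≥0) : Set (ℕ × Fin n) :=
  {p | S ω p.1 p.2 ≤ t ∧ t < S.departure ω p.1}

/-- At time `t` replica `j` of request `i` is completely downloaded (so the download has not been
terminated before, and request `i` departs). -/
def CompletesAt (ω : Sample n) (i : ℕ) (j : Fin n) (t : ℝ≥0) : Prop :=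
  S.finish ω i j = t ∧ S.departure ω i = t

/-- The dispatcher cannot distinguish `ω` from `ω'` up to and including time `t`: the seed, the
arrivals until `t`, and the completed downloads until `t` with their completion times agree. -/
def SameHistory (ω ω' : Sample n) (t : ℝ≥0) : Prop :=
  ω.seed = ω'.seed ∧
  (∀ τ ≤ t, ∀ i, ω.arrival i = τ ↔ ω'.arrival i = τ) ∧
  (∀ τ ≤ t, ∀ i j, S.CompletesAt ω i j τ ↔ S.CompletesAt ω' i j τ)

end StartRule

/-- An on-line scheduling scheme for a dispatcher with at most `L` simultaneously active threads
and `n` replicas of each file. The scheme may be randomized, may let threads idle, and may start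
downloads at any time; a started download runs until it finishes or its request departs. -/
structure Scheme (L n : ℕ) where
  /-- The starting time of each download. -/
  start : StartRule n
  measurable_start : ∀ i j, Measurable fun ω => start ω i j
  /-- A request is not served before it arrives. -/
  arrival_le_start : ∀ ω : Sample n, ω.Regular → ∀ i j, (ω.arrival i : ℝ≥0∞) ≤ start ω i j
  /-- No download starts for a request that has departed. -/
  start_lt_departure : ∀ ω : Sample n, ω.Regular → ∀ i j,
    start ω i j < ⊤ → start ω i j < start.departure ω i
  /-- At most `L` threads are active at any time. -/
  capacity : ∀ ω : Sample n, ω.Regular → ∀ t : ℝ≥0, (start.activeAt ω t).encard ≤ L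
  /-- The scheme is on-line: which downloads start until time `t`, and when, depends only on what
  the dispatcher has seen until time `t`. -/
  online : ∀ ω ω' : Sample n, ω.Regular → ω'.Regular → ∀ t : ℝ≥0, start.SameHistory ω ω' t →
    ∀ τ ≤ t, ∀ i j, start ω i j = τ ↔ start ω' i j = τ

/-- A scheme is work-conserving if all `L` threads are active whenever there is a request in the
system, that is, one which has arrived and has not departed. -/
def Scheme.WorkConserving {L n : ℕ} (s : Scheme L n) : Prop :=
  ∀ ω : Sample n, ω.Regular → ∀ t : ℝ≥0,
    (∃ i, ω.arrival i ≤ t ∧ (t : ℝ≥0∞) < s.start.departure ω i) →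
      (s.start.activeAt ω t).encard = L

/-- A normalized arrival process, given by the law `ν` of its arrival times: the requests are
numbered in the order of their arrivals, and the long-run arrival rate is one. -/
structure IsArrivalProcess (ν : Measure (ℕ → ℝ≥0)) : Prop where
  isProbabilityMeasure : IsProbabilityMeasure ν
  monotone : ∀ᵐ a ∂ν, Monotone a
  rate_one : ∀ᵐ a ∂ν, Tendsto (fun i : ℕ => (a i : ℝ) / i) atTop (𝓝 1)

/-- For each `η > 0`, the last index `i` at which `a i / i` is at distance more than `η` from its
limit `1` has a finite mean ("quick" convergence, of order one, to the arrival rate). -/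
def HasQuickRate (ν : Measure (ℕ → ℝ≥0)) : Prop :=
  ∀ η : ℝ, 0 < η →
    ∫⁻ a, (⨆ (i : ℕ) (_ : η * i < |(a i : ℝ) - i|), (i : ℝ≥0∞)) ∂ν < ⊤

/-- The arrival process of rate `lam` with the same pattern: time is rescaled by `lam`. -/
noncomputable def atRate (lam : ℝ≥0) (ν : Measure (ℕ → ℝ≥0)) : Measure (ℕ → ℝ≥0) :=
  ν.map fun a i => a i / lam

/-- The law of the primitive data: the arrivals have law `ν`, the downloading times are i.i.d.
exponential with rate `mu`, the seed is uniform on `[0, 1]`, and these three are independent. -/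
noncomputable def sampleLaw (n : ℕ) (mu : ℝ) (ν : Measure (ℕ → ℝ≥0)) : Measure (Sample n) :=
  ν.prod ((Measure.infinitePi fun _ : ℕ × Fin n => (expMeasure mu).map Real.toNNReal).prod
    (volume : Measure unitInterval))

/-- The number `N_T` of the requests that arrive in `[0, T]`. -/
noncomputable def Sample.numArrivals {n : ℕ} (ω : Sample n) (T : ℝ≥0) : ℕ :=
  {i | ω.arrival i ≤ T}.ncard

/-- The expected delay `E[D]` under the scheme `s`: the upper limit, as `T → ∞`, of the expected
average delay `E[(1 / N_T) ∑_{i ≤ N_T} D_i]` of the requests that arrive in `[0, T]`. -/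
noncomputable def expectedDelay {L n : ℕ} (mu : ℝ) (ν : Measure (ℕ → ℝ≥0)) (s : Scheme L n) :
    ℝ≥0∞ :=
  limsup (fun T : ℝ≥0 => ∫⁻ ω, (∑ i ∈ Finset.range (ω.numArrivals T), s.start.delay ω i) /
    (ω.numArrivals T : ℝ≥0∞) ∂(sampleLaw n mu ν)) atTop

/-- The queue is stable under a scheme if the expected delay is finite. -/
def Stable {L n : ℕ} (mu : ℝ) (ν : Measure (ℕ → ℝ≥0)) (s : Scheme L n) : Prop :=
  expectedDelay mu ν s < ⊤

/-- The capacity region `Λ`: the arrival rates at which some on-line scheme stabilizes the queue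
with arrivals of the pattern `ν`. -/
def capacityRegion (L n : ℕ) (mu : ℝ) (ν : Measure (ℕ → ℝ≥0)) : Set ℝ≥0 :=
  {lam | 0 < lam ∧ ∃ s : Scheme L n, Stable mu (atRate lam ν) s}

/-- The scheme stabilizes the queue at each rate `lam` such that `lam + ε ∈ Λ` for some
`ε > 0`. -/
def ThroughputOptimal {L n : ℕ} (mu : ℝ) (ν : Measure (ℕ → ℝ≥0)) (s : Scheme L n) : Prop :=
  ∀ lam : ℝ≥0, 0 < lam → (∃ ε : ℝ≥0, 0 < ε ∧ lam + ε ∈ capacityRegion L n mu ν) →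
    Stable mu (atRate lam ν) s

/-- The scheme has the smallest expected delay among all on-line schemes at each rate `lam` such
that `lam + ε ∈ Λ` for some `ε > 0`. -/
def DelayOptimal {L n : ℕ} (mu : ℝ) (ν : Measure (ℕ → ℝ≥0)) (s : Scheme L n) : Prop :=
  ∀ lam : ℝ≥0, 0 < lam → (∃ ε : ℝ≥0, 0 < ε ∧ lam + ε ∈ capacityRegion L n mu ν) →
    ∀ s' : Scheme L n, expectedDelay mu (atRate lam ν) s ≤ expectedDelay mu (atRate lam ν) s'

end ReplicationQueue

/-!
Write `c = L * mu` for the total service rate of the threads. Since the downloading times are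
exponential, the downloads in progress finish at the total rate `mu` times their number, whatever
the dispatcher does: at most `c` under any on-line scheme, and exactly `c`, as long as a request is
in the system, under a work-conserving one. It does not matter which requests are served, nor by how
many threads each. So the departure process of a work-conserving scheme is that of a queue with one
exponential server of rate `c` (the *canonical queue*), and departures of all other schemes come
later. The sum of the delays of the first requests depends, up to boundary effects, on the departure
process alone, so work-conserving schemes are optimal.

**Intensity of the departures.** An on-line scheme cannot foresee a duration: two realizations that
differ only in the duration of one download look the same until this download finishes
(`Scheme.completesAt_iff_of_agree`). Resampling one exponential duration turns this into a
compensator formula for one download (`lintegral_completion_eq`), and the sum over all downloads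
into one for the departures (`Scheme.lintegral_departures_eq`). With the integrand
`exp (-c * (t - r))`, between the departures number `d` and `d + 1`, it compares the law of the
departure time number `d + 1` with that of number `d` by one step of Lindley's recursion. By
induction, the `d`-th departure time of any scheme is stochastically at least the one of the
canonical queue (`Scheme.canonicalLaw_le_epoch`), with the converse for work-conserving schemes
(`Scheme.WorkConserving.epoch_le`). All this is for fixed arrival times and a fixed seed.

**Delays.** The total delay of the first `K` requests is at least the sum of the first `K` departure
times minus that of the first `K` arrival times, with equality if the first `K` departures are those
of the first `K` requests. Hence the mean of the total delay is at least the sum of the mean delays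
in the canonical queue (`Scheme.sum_canonicalDelay_le`). Conversely, for a work-conserving scheme
and the requests that arrive until `T`, the sum of the canonical delays has to be extended to
arrivals until `(1 + δ) * T`, and there are additional terms for the requests still present at that
time (`Scheme.WorkConserving.lintegral_sum_delay_le`). A request that came until `T` keeps the
threads busy as long as it is present, so an arrival rate `lam < c` and a Chernoff bound for the
canonical queue make these terms exponentially small (`canonicalLaw_min_le`), once the arrivals have
settled at their rate. The finite mean of the time at which they settle controls the remaining
realizations (`Scheme.WorkConserving.limsup_lintegral_meanDelay_le`). Then `δ → 0` gives the
delay optimality.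

**Throughput.** At rates above `c` the canonical delays grow without bound, so the capacity region
contains no such rate (`le_of_mem_capacityRegion`). At a rate below a rate of the capacity region,
the canonical delays are compared by a change of the time scale
(`meanCanonicalDelay_le_of_scale`), which gives stability.

A fixed sequence of arrival times is an arrival process with a deterministic law, for which the
arrivals settle at a finite deterministic time. So the conditional statement is a special case of
the averaged one.
-/

namespace ReplicationQueue

/-! ### Causality of on-line schemes -/

namespace StartRule

variable {n : ℕ} (S : StartRule n)

lemma departure_le_finish (ω : Sample n) (i : ℕ) (j : Fin n) :
    S.departure ω i ≤ S.finish ω i j := iInf_le _ j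

lemma start_le_finish (ω : Sample n) (i : ℕ) (j : Fin n) :
    S ω i j ≤ S.finish ω i j := le_self_add

lemma exists_finish_eq_departure {ω : Sample n} {i : ℕ} (h : S.departure ω i < ⊤) :
    ∃ j, S.finish ω i j = S.departure ω i := by
  have : Nonempty (Fin n) := by
    by_contra hn
    rw [not_nonempty_iff] at hn
    simp [departure] at h
  obtain ⟨j, hj⟩ := exists_eq_ciInf_of_finite (f := fun j => S.finish ω i j)
  exact ⟨j, hj⟩

lemma start_lt_finish {ω : Sample n} (hω : ω.Regular) {i : ℕ} {j : Fin n}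
    (h : S ω i j < ⊤) : S ω i j < S.finish ω i j := by
  unfold finish
  exact ENNReal.lt_add_right h.ne (by simpa using (hω.download_pos i j).ne')

end StartRule

/-- Only finitely many requests arrive in a bounded time. -/
lemma Sample.Regular.finite_arrival_le {n : ℕ} {ω : Sample n} (hω : ω.Regular) (T : ℝ≥0) :
    {i | ω.arrival i ≤ T}.Finite := by
  obtain ⟨N, hN⟩ := (hω.arrival_tendsto.eventually (eventually_gt_atTop T)).exists_forall_of_atTop
  refine (Set.finite_lt_nat N).subset fun i hi => ?_
  by_contra h
  exact absurd (hN i (not_lt.1 h)) (not_lt.2 hi)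

namespace Scheme

variable {L n : ℕ} (s : Scheme L n)

lemma arrival_le_departure {ω : Sample n} (hω : ω.Regular) (i : ℕ) :
    (ω.arrival i : ℝ≥0∞) ≤ s.start.departure ω i :=
  le_iInf fun j => (s.arrival_le_start ω hω i j).trans (s.start.start_le_finish ω i j)

lemma arrival_lt_departure {ω : Sample n} (hω : ω.Regular) (i : ℕ) :
    (ω.arrival i : ℝ≥0∞) < s.start.departure ω i := by
  rcases eq_top_or_lt_top (s.start.departure ω i) with h | h
  · rw [h]; exact ENNReal.coe_lt_top
  · obtain ⟨j, hj⟩ := s.start.exists_finish_eq_departure h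
    rw [← hj]
    refine (s.arrival_le_start ω hω i j).trans_lt (s.start.start_lt_finish hω ?_)
    exact (s.start.start_le_finish ω i j).trans_lt (hj ▸ h)

/-- If two realizations with the same arrivals and the same seed differ only in the downloading
time of one replica, and that download would finish at time `r` or later in both, then the
dispatcher observes the same completions, before time `r`, in the two realizations. The reason is
that a first discrepancy would have to be the completion of a download which was started at the
same time in both. -/
lemma completesAt_iff_of_agree {ω ω' : Sample n} (hω : ω.Regular) (hω' : ω'.Regular)
    (harr : ω.arrival = ω'.arrival) (hseed : ω.seed = ω'.seed) {p : ℕ × Fin n}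
    (hdl : ∀ q, q ≠ p → ω.download q.1 q.2 = ω'.download q.1 q.2) {r : ℝ≥0∞}
    (hr : r ≤ s.start.finish ω p.1 p.2) (hr' : r ≤ s.start.finish ω' p.1 p.2) :
    ∀ τ : ℝ≥0, (τ : ℝ≥0∞) < r → ∀ i j,
      s.start.CompletesAt ω i j τ ↔ s.start.CompletesAt ω' i j τ := by
  -- one implication at a time suffices, provided that the histories agree before `τ`
  have key : ∀ (ω ω' : Sample n), ω.Regular → ω'.Regular → ω.arrival = ω'.arrival →
      ω.seed = ω'.seed → (∀ q, q ≠ p → ω.download q.1 q.2 = ω'.download q.1 q.2) →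
      r ≤ s.start.finish ω p.1 p.2 → ∀ τ : ℝ≥0, (τ : ℝ≥0∞) < r →
      (∀ τ' < τ, ∀ i j, s.start.CompletesAt ω i j τ' ↔ s.start.CompletesAt ω' i j τ') →
      ∀ i j, s.start.CompletesAt ω i j τ → s.start.CompletesAt ω' i j τ := by
    intro ω ω' hω hω' harr hseed hdl hr τ hτ hist i j hc
    have hfin : s.start ω i j < ⊤ :=
      (s.start.start_le_finish ω i j).trans_lt (hc.1 ▸ ENNReal.coe_lt_top)
    obtain ⟨σ, hσ⟩ : ∃ σ : ℝ≥0, (σ : ℝ≥0∞) = _ := ⟨_, ENNReal.coe_toNNReal hfin.ne⟩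
    have hστ : σ < τ := by
      have := s.start.start_lt_finish hω hfin
      rw [hc.1, ← hσ] at this
      exact_mod_cast this
    have hstart : s.start ω' i j = σ := by
      refine (s.online ω ω' hω hω' σ ⟨hseed, fun τ _ i => by rw [harr],
        fun τ' hτ' i j => hist τ' (hτ'.trans_lt hστ) i j⟩ σ le_rfl i j).1 hσ.symm
    have hne : (i, j) ≠ p := by
      rintro rfl
      exact absurd (hr.trans_eq hc.1) (not_le.2 hτ)
    have hfin' : s.start.finish ω' i j = τ := by
      rw [← hc.1]
      unfold StartRule.finish
      rw [hstart, ← hσ, hdl (i, j) hne]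
    refine ⟨hfin', le_antisymm ((s.start.departure_le_finish ω' i j).trans_eq hfin') ?_⟩
    by_contra hlt
    rw [not_le] at hlt
    obtain ⟨j', hj'⟩ := s.start.exists_finish_eq_departure (hlt.trans ENNReal.coe_lt_top)
    obtain ⟨τ₁, hτ₁⟩ : ∃ σ : ℝ≥0, (σ : ℝ≥0∞) = _ :=
      ⟨_, ENNReal.coe_toNNReal (hlt.trans ENNReal.coe_lt_top).ne⟩
    have h1 : τ₁ < τ := by rw [← hτ₁] at hlt; exact_mod_cast hlt
    have := (hist τ₁ h1 i j').2 ⟨hj'.trans hτ₁.symm, hτ₁.symm⟩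
    have h2 := this.2.symm.trans hc.2
    exact h1.ne (by exact_mod_cast h2)
  by_contra hcon
  push Not at hcon
  -- the set of the times at which the two realizations differ is finite
  set B : Set ℝ≥0 := {τ | (τ : ℝ≥0∞) < r ∧ ∃ i j,
    ¬ (s.start.CompletesAt ω i j τ ↔ s.start.CompletesAt ω' i j τ)} with hB
  obtain ⟨τ₀, hτ₀r, i₀, j₀, h₀⟩ := hcon
  have hBfin : (B ∩ Set.Iic τ₀).Finite := by
    refine (((hω.finite_arrival_le τ₀).image fun i => (s.start.departure ω i).toNNReal).union
      ((hω.finite_arrival_le τ₀).image fun i => (s.start.departure ω' i).toNNReal)).subset ?_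
    rintro τ ⟨⟨-, i, j, h⟩, hτ⟩
    have : s.start.CompletesAt ω i j τ ∨ s.start.CompletesAt ω' i j τ := by tauto
    rcases this with h | h
    · refine Or.inl ⟨i, ?_, by simp [h.2]⟩
      have := s.arrival_le_departure hω i
      rw [h.2] at this
      exact (ENNReal.coe_le_coe.1 this).trans hτ
    · refine Or.inr ⟨i, ?_, by simp [h.2]⟩
      have := s.arrival_le_departure hω' i
      rw [h.2, ← harr] at this
      exact (ENNReal.coe_le_coe.1 this).trans hτ
  have hBne : (B ∩ Set.Iic τ₀).Nonempty := ⟨τ₀, ⟨hτ₀r, i₀, j₀, by tauto⟩, Set.self_mem_Iic⟩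
  obtain ⟨τ, ⟨⟨hτr, i, j, hij⟩, hτ₀⟩, hmin⟩ := Set.exists_min_image _ id hBfin hBne
  have hist : ∀ τ' < τ, ∀ i j,
      s.start.CompletesAt ω i j τ' ↔ s.start.CompletesAt ω' i j τ' := by
    intro τ' hτ' i j
    by_contra h
    refine absurd (hmin τ' ⟨⟨(ENNReal.coe_lt_coe.2 hτ').trans hτr, i, j, h⟩, ?_⟩) (not_le.2 hτ')
    exact hτ'.le.trans hτ₀
  exact hij ⟨key ω ω' hω hω' harr hseed hdl hr τ hτr hist i j,
    key ω' ω hω' hω harr.symm hseed.symm (fun q hq => (hdl q hq).symm) hr' τ hτr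
      (fun τ' h i j => (hist τ' h i j).symm) i j⟩

variable {s} in
/-- What the dispatcher does and what it observes before time `r` coincide in two realizations
that differ only in the duration of one download, not finished before `r` in either. -/
lemma start_eq_iff_of_agree {ω ω' : Sample n} (hω : ω.Regular) (hω' : ω'.Regular)
    (harr : ω.arrival = ω'.arrival) (hseed : ω.seed = ω'.seed) {p : ℕ × Fin n}
    (hdl : ∀ q, q ≠ p → ω.download q.1 q.2 = ω'.download q.1 q.2) {r : ℝ≥0∞}
    (hr : r ≤ s.start.finish ω p.1 p.2) (hr' : r ≤ s.start.finish ω' p.1 p.2)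
    {τ : ℝ≥0∞} (hτ : τ < r) (i : ℕ) (j : Fin n) :
    s.start ω i j = τ ↔ s.start ω' i j = τ := by
  lift τ to ℝ≥0 using (hτ.trans_le le_top).ne
  refine s.online ω ω' hω hω' τ ⟨hseed, fun τ _ i => by rw [harr], fun τ' hτ' i j =>
    s.completesAt_iff_of_agree hω hω' harr hseed hdl hr hr' τ' ?_ i j⟩ τ le_rfl i j
  exact (ENNReal.coe_le_coe.2 hτ').trans_lt hτ

variable {s} in
lemma departure_eq_of_agree {ω ω' : Sample n} (hω : ω.Regular) (hω' : ω'.Regular)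
    (harr : ω.arrival = ω'.arrival) (hseed : ω.seed = ω'.seed) {p : ℕ × Fin n}
    (hdl : ∀ q, q ≠ p → ω.download q.1 q.2 = ω'.download q.1 q.2) {r : ℝ≥0∞}
    (hr : r ≤ s.start.finish ω p.1 p.2) (hr' : r ≤ s.start.finish ω' p.1 p.2)
    {i : ℕ} (hi : s.start.departure ω i < r) :
    s.start.departure ω' i = s.start.departure ω i := by
  have htop := (hi.trans_le le_top)
  obtain ⟨j, hj⟩ := s.start.exists_finish_eq_departure htop
  obtain ⟨τ, hτ⟩ : ∃ σ : ℝ≥0, (σ : ℝ≥0∞) = _ := ⟨_, ENNReal.coe_toNNReal htop.ne⟩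
  rw [← hτ] at hj hi ⊢
  exact ((s.completesAt_iff_of_agree hω hω' harr hseed hdl hr hr' τ hi i j).1 ⟨hj, hτ.symm⟩).2

variable {s} in
lemma departure_lt_iff_of_agree {ω ω' : Sample n} (hω : ω.Regular) (hω' : ω'.Regular)
    (harr : ω.arrival = ω'.arrival) (hseed : ω.seed = ω'.seed) {p : ℕ × Fin n}
    (hdl : ∀ q, q ≠ p → ω.download q.1 q.2 = ω'.download q.1 q.2) {r : ℝ≥0∞}
    (hr : r ≤ s.start.finish ω p.1 p.2) (hr' : r ≤ s.start.finish ω' p.1 p.2) (i : ℕ) :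
    s.start.departure ω i < r ↔ s.start.departure ω' i < r := by
  constructor <;> intro h
  · rwa [departure_eq_of_agree hω hω' harr hseed hdl hr hr' h]
  · rwa [departure_eq_of_agree hω' hω harr.symm hseed.symm (fun q hq => (hdl q hq).symm) hr' hr h]

variable {s} in
/-- The time at which a download starts does not depend on its own duration. -/
lemma start_eq_of_agree {ω ω' : Sample n} (hω : ω.Regular) (hω' : ω'.Regular)
    (harr : ω.arrival = ω'.arrival) (hseed : ω.seed = ω'.seed) {p : ℕ × Fin n}
    (hdl : ∀ q, q ≠ p → ω.download q.1 q.2 = ω'.download q.1 q.2) :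
    s.start ω p.1 p.2 = s.start ω' p.1 p.2 := by
  wlog h : s.start.finish ω p.1 p.2 ≤ s.start.finish ω' p.1 p.2 generalizing ω ω'
  · exact (this hω' hω harr.symm hseed.symm (fun q hq => (hdl q hq).symm) (not_le.1 h).le).symm
  rcases eq_top_or_lt_top (s.start ω p.1 p.2) with h1 | h1
  · have h2 : s.start.finish ω' p.1 p.2 = ⊤ := by
      refine top_le_iff.1 (le_trans ?_ h)
      rw [← h1]; exact s.start.start_le_finish _ _ _
    rw [StartRule.finish, ENNReal.add_eq_top, or_iff_left ENNReal.coe_ne_top] at h2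
    rw [h1, h2]
  · exact ((start_eq_iff_of_agree hω hω' harr hseed hdl le_rfl h
      (s.start.start_lt_finish hω h1) p.1 p.2).1 rfl).symm

end Scheme

/-! ### The exponential law and resampling of one coordinate -/

lemma lintegral_expMeasure {c : ℝ} (f : ℝ → ℝ≥0∞) (hf : Measurable f) :
    ∫⁻ x, f x ∂(expMeasure c) =
      ∫⁻ x in Set.Ioi 0, ENNReal.ofReal (c * Real.exp (-(c * x))) * f x := by
  have hm : Measurable (exponentialPDF c) := (measurable_exponentialPDFReal c).ennreal_ofReal
  have h1 : expMeasure c = volume.withDensity (exponentialPDF c) := rfl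
  rw [h1, lintegral_withDensity_eq_lintegral_mul _ hm hf, ← lintegral_indicator measurableSet_Ioi]
  refine lintegral_congr_ae ?_
  filter_upwards [Measure.ae_ne volume (0 : ℝ)] with x hx
  by_cases h : 0 < x
  · rw [Set.indicator_of_mem (Set.mem_Ioi.2 h), Pi.mul_apply, exponentialPDF_of_nonneg h.le]
  · rw [Set.indicator_of_notMem (by simpa using h), Pi.mul_apply,
      exponentialPDF_of_neg (lt_of_le_of_ne (not_lt.1 h) hx), zero_mul]

lemma expMeasure_Ioi {c : ℝ} (hc : 0 < c) {x : ℝ} (hx : 0 ≤ x) :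
    expMeasure c (Set.Ioi x) = ENNReal.ofReal (Real.exp (-(c * x))) := by
  have := isProbabilityMeasure_expMeasure hc
  have h := cdf_expMeasure_eq hc x
  rw [if_pos hx, cdf_eq_real] at h
  rw [← Set.compl_Iic, prob_compl_eq_one_sub measurableSet_Iic, ← ofReal_measureReal (μ := expMeasure c),
    h, ← ENNReal.ofReal_one, ← ENNReal.ofReal_sub _ (by
      simp only [sub_nonneg, Real.exp_le_one_iff, Left.neg_nonpos_iff]; positivity)]
  congr 1; ring

lemma expMeasure_Iic_zero {c : ℝ} (hc : 0 < c) : expMeasure c (Set.Iic 0) = 0 := by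
  have := isProbabilityMeasure_expMeasure hc
  rw [← Set.compl_Ioi, prob_compl_eq_zero_iff measurableSet_Ioi, expMeasure_Ioi hc le_rfl]
  simp

lemma ae_pos_expMeasure {c : ℝ} (hc : 0 < c) : ∀ᵐ x ∂(expMeasure c), 0 < x := by
  rw [ae_iff]
  simp only [not_lt]
  exact expMeasure_Iic_zero hc

/-- The exponential law with rate `c` has hazard rate `c`. -/
lemma lintegral_expMeasure_eq_hazard {c : ℝ} (hc : 0 < c) {K : ℝ → ℝ≥0∞} (hK : Measurable K) :
    ∫⁻ y, K y ∂(expMeasure c) =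
      ENNReal.ofReal c * ∫⁻ y, (∫⁻ v, (Set.Ioc 0 y).indicator K v) ∂(expMeasure c) := by
  have := isProbabilityMeasure_expMeasure hc
  have hm : Measurable fun q : ℝ × ℝ => (Set.Ioc 0 q.1).indicator K q.2 := by
    have : (fun q : ℝ × ℝ => (Set.Ioc 0 q.1).indicator K q.2) =
        {q : ℝ × ℝ | 0 < q.2 ∧ q.2 ≤ q.1}.indicator fun q => K q.2 := by
      ext q; simp [Set.indicator]
    rw [this]
    refine (hK.comp measurable_snd).indicator ?_
    exact (measurableSet_lt measurable_const measurable_snd).inter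
      (measurableSet_le measurable_snd measurable_fst)
  rw [lintegral_lintegral_swap hm.aemeasurable, lintegral_expMeasure K hK,
    ← lintegral_const_mul _ (by exact hm.lintegral_prod_left'), ← lintegral_indicator measurableSet_Ioi]
  refine lintegral_congr fun v => ?_
  by_cases hv : 0 < v
  · rw [Set.indicator_of_mem (Set.mem_Ioi.2 hv)]
    have h1 : (fun y => (Set.Ioc 0 y).indicator K v) = (Set.Ici v).indicator fun _ => K v := by
      ext y
      by_cases h : v ≤ y <;> simp [hv, h]
    have h2 : expMeasure c (Set.Ici v) = expMeasure c (Set.Ioi v) := by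
      refine measure_congr ?_
      have : expMeasure c ≪ volume := withDensity_absolutelyContinuous _ _
      exact this.ae_eq Ioi_ae_eq_Ici.symm
    rw [h1, lintegral_indicator_const measurableSet_Ici, h2, expMeasure_Ioi hc hv.le,
      ENNReal.ofReal_mul hc.le]
    ring
  · rw [Set.indicator_of_notMem (by simpa using hv)]
    simp [hv]

variable {ι : Type*}

lemma measurable_update_pair [DecidableEq ι] (p : ι) :
    Measurable fun z : (ι → ℝ≥0) × ℝ≥0 => Function.update z.1 p z.2 := by
  rw [measurable_pi_iff]
  intro q
  by_cases h : q = p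
  · subst h; simpa using measurable_snd
  · simp only [Function.update_of_ne h]; exact (measurable_pi_apply q).comp measurable_fst

/-- Replacing one coordinate by an independent copy does not change a product measure. -/
lemma infinitePi_map_update [DecidableEq ι] (ρ : Measure ℝ≥0) [IsProbabilityMeasure ρ] (p : ι) :
    ((Measure.infinitePi fun _ : ι => ρ).prod ρ).map
      (fun z => Function.update z.1 p z.2) = Measure.infinitePi fun _ : ι => ρ := by
  refine Measure.eq_infinitePi _ fun I t ht => ?_
  rw [Measure.map_apply (measurable_update_pair p) (MeasurableSet.pi I.countable_toSet fun i _ => ht i)]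
  by_cases hp : p ∈ I
  · have : (fun z : (ι → ℝ≥0) × ℝ≥0 => Function.update z.1 p z.2) ⁻¹' (Set.pi I t) =
        (Set.pi (I.erase p : Finset ι) t) ×ˢ t p := by
      ext ⟨X, y⟩
      simp only [Set.mem_preimage, Set.mem_pi, Finset.mem_coe, Set.mem_prod, Finset.mem_erase]
      constructor
      · intro h
        refine ⟨fun i hi => ?_, by simpa using h p hp⟩
        simpa [hi.1] using h i hi.2
      · rintro ⟨h1, h2⟩ i hi
        by_cases hip : i = p
        · subst hip; simpa using h2
        · simpa [hip] using h1 i ⟨hip, hi⟩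
    rw [this, Measure.prod_prod, Measure.infinitePi_pi _ fun i _ => ht i, Finset.prod_erase_mul _ _ hp]
  · have : (fun z : (ι → ℝ≥0) × ℝ≥0 => Function.update z.1 p z.2) ⁻¹' (Set.pi I t) =
        (Set.pi I t) ×ˢ Set.univ := by
      ext ⟨X, y⟩
      simp only [Set.mem_preimage, Set.mem_pi, Finset.mem_coe, Set.mem_prod, Set.mem_univ, and_true]
      refine forall₂_congr fun i hi => ?_
      have : i ≠ p := fun h => hp (h ▸ hi)
      simp [this]
    rw [this, Measure.prod_prod, Measure.infinitePi_pi _ fun i _ => ht i, measure_univ, mul_one]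

/-- The law of independent downloading times, exponential with rate `mu`. -/
noncomputable def downloadLaw (ι : Type*) (mu : ℝ) : Measure (ι → ℝ≥0) :=
  Measure.infinitePi fun _ : ι => (expMeasure mu).map Real.toNNReal

lemma isProbabilityMeasure_map_toNNReal {mu : ℝ} (hmu : 0 < mu) :
    IsProbabilityMeasure ((expMeasure mu).map Real.toNNReal) :=
  have := isProbabilityMeasure_expMeasure hmu
  Measure.isProbabilityMeasure_map measurable_real_toNNReal.aemeasurable

lemma isProbabilityMeasure_downloadLaw {mu : ℝ} (hmu : 0 < mu) :
    IsProbabilityMeasure (downloadLaw ι mu) := by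
  have := isProbabilityMeasure_map_toNNReal hmu
  unfold downloadLaw; infer_instance

lemma ae_pos_downloadLaw [Countable ι] {mu : ℝ} (hmu : 0 < mu) :
    ∀ᵐ X ∂(downloadLaw ι mu), ∀ p, 0 < X p := by
  have := isProbabilityMeasure_map_toNNReal hmu
  rw [ae_all_iff]
  intro p
  have h := (measurePreserving_eval_infinitePi
    (fun _ : ι => (expMeasure mu).map Real.toNNReal) p).quasiMeasurePreserving
  refine h.ae (p := fun x => 0 < x) ?_
  rw [ae_map_iff measurable_real_toNNReal.aemeasurable measurableSet_Ioi]
  filter_upwards [ae_pos_expMeasure hmu] with x hx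
  simpa using hx

lemma lintegral_downloadLaw_update [DecidableEq ι] {mu : ℝ} (hmu : 0 < mu) (p : ι)
    {f : (ι → ℝ≥0) → ℝ≥0∞} (hf : Measurable f) :
    ∫⁻ X, f X ∂(downloadLaw ι mu) =
      ∫⁻ X, ∫⁻ y, f (Function.update X p y.toNNReal) ∂(expMeasure mu) ∂(downloadLaw ι mu) := by
  have := isProbabilityMeasure_map_toNNReal hmu
  have := isProbabilityMeasure_downloadLaw (ι := ι) hmu
  conv_lhs => rw [downloadLaw, ← infinitePi_map_update _ p]
  rw [lintegral_map hf (measurable_update_pair p), lintegral_prod (fun z : (ι → ℝ≥0) × ℝ≥0 => f (Function.update z.1 p z.2))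
      (hf.comp (measurable_update_pair p)).aemeasurable]
  unfold downloadLaw
  refine lintegral_congr fun X => ?_
  exact lintegral_map (hf.comp ((measurable_update_pair p).comp measurable_prodMk_left))
    measurable_real_toNNReal

/-- The compensator of one download. Suppose that the download with duration `X p` starts at time
`σ`, which does not depend on its duration, and that at times `r` at which it is in progress the
quantity `H X r` does not depend on its duration either. Then the expectation of `H` at the time
of completion is `mu` times the expected integral of `H` over the time of download. -/
lemma lintegral_completion_eq [DecidableEq ι] [Countable ι] {mu : ℝ} (hmu : 0 < mu) (p : ι)
    {σ : (ι → ℝ≥0) → ℝ≥0∞} (hσ : Measurable σ) {H : (ι → ℝ≥0) → ℝ → ℝ≥0∞}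
    (hH : Measurable fun z : (ι → ℝ≥0) × ℝ => H z.1 z.2)
    (hσp : ∀ X : ι → ℝ≥0, (∀ q, 0 < X q) → ∀ y : ℝ≥0, 0 < y → σ (Function.update X p y) = σ X)
    (hHp : ∀ X : ι → ℝ≥0, (∀ q, 0 < X q) → ∀ y : ℝ≥0, 0 < y → ∀ r : ℝ, σ X < ENNReal.ofReal r →
      ENNReal.ofReal r ≤ σ X + X p → ENNReal.ofReal r ≤ σ X + y →
      H (Function.update X p y) r = H X r) :
    ∫⁻ X, (if σ X < ⊤ then H X (σ X + X p).toReal else 0) ∂(downloadLaw ι mu) =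
      ENNReal.ofReal mu * ∫⁻ X, (∫⁻ r : ℝ, if σ X < ENNReal.ofReal r ∧
        ENNReal.ofReal r ≤ σ X + X p then H X r else 0) ∂(downloadLaw ι mu) := by
  have hXp : Measurable fun X : ι → ℝ≥0 => (X p : ℝ≥0∞) :=
    measurable_coe_nnreal_ennreal.comp (measurable_pi_apply p)
  have hm1 : Measurable fun X : ι → ℝ≥0 =>
      (if σ X < ⊤ then H X (σ X + X p).toReal else 0) := by
    refine Measurable.ite (measurableSet_lt hσ measurable_const) ?_ measurable_const
    exact hH.comp (measurable_id.prodMk (hσ.add hXp).ennreal_toReal)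
  have hm2' : Measurable fun z : (ι → ℝ≥0) × ℝ => (if σ z.1 < ENNReal.ofReal z.2 ∧
      ENNReal.ofReal z.2 ≤ σ z.1 + z.1 p then H z.1 z.2 else 0) := by
    refine Measurable.ite ?_ hH measurable_const
    exact (measurableSet_lt (hσ.comp measurable_fst) measurable_snd.ennreal_ofReal).inter
      (measurableSet_le measurable_snd.ennreal_ofReal ((hσ.add hXp).comp measurable_fst))
  have hm2 : Measurable fun X : ι → ℝ≥0 => ∫⁻ r : ℝ, (if σ X < ENNReal.ofReal r ∧
      ENNReal.ofReal r ≤ σ X + X p then H X r else 0) := hm2'.lintegral_prod_right'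
  have := isProbabilityMeasure_expMeasure hmu
  have := isProbabilityMeasure_downloadLaw (ι := ι) hmu
  rw [lintegral_downloadLaw_update hmu p hm1, lintegral_downloadLaw_update hmu p hm2,
    ← lintegral_const_mul' _ _ ENNReal.ofReal_ne_top]
  refine lintegral_congr_ae ?_
  filter_upwards [ae_pos_downloadLaw hmu] with X hX
  rcases eq_top_or_lt_top (σ X) with hS | hS
  · rw [lintegral_congr_ae (g := fun _ => 0), lintegral_congr_ae (μ := expMeasure mu)
      (f := fun y => ∫⁻ r : ℝ, _) (g := fun _ => 0)]
    · simp
    · filter_upwards [ae_pos_expMeasure hmu] with y hy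
      simp [hσp X hX y.toNNReal (by simpa using hy), hS]
    · filter_upwards [ae_pos_expMeasure hmu] with y hy
      simp [hσp X hX y.toNNReal (by simpa using hy), hS]
  obtain ⟨S, hSX⟩ : ∃ S : ℝ≥0, (S : ℝ≥0∞) = σ X := ⟨_, ENNReal.coe_toNNReal hS.ne⟩
  -- the quantity `H`, as long as the download is in progress, as a function of its age
  set K : ℝ → ℝ≥0∞ := fun v => H (Function.update X p v.toNNReal) (S + v) with hK
  have hKm : Measurable K := by
    refine hH.comp (Measurable.prodMk ?_ (measurable_const.add measurable_id))
    exact (measurable_update_pair p).comp (measurable_const.prodMk measurable_real_toNNReal)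
  rw [lintegral_congr_ae (g := K), lintegral_congr_ae (μ := expMeasure mu)
      (f := fun y => ∫⁻ r : ℝ, _) (g := fun y => ∫⁻ v, (Set.Ioc 0 y).indicator K v)]
  · exact lintegral_expMeasure_eq_hazard hmu hKm
  · filter_upwards [ae_pos_expMeasure hmu] with y hy
    rw [← lintegral_add_left_eq_self _ (S : ℝ)]
    refine lintegral_congr fun v => ?_
    rw [hσp X hX y.toNNReal (by simpa using hy), ← hSX, Function.update_self]
    have e1 : ((S : ℝ≥0∞) < ENNReal.ofReal (S + v)) ↔ 0 < v := by
      rw [ENNReal.ofReal, ENNReal.coe_lt_coe, Real.lt_toNNReal_iff_coe_lt]; simp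
    have e2 : 0 < v → (ENNReal.ofReal (S + v) ≤ S + (y.toNNReal : ℝ≥0∞) ↔ v ≤ y) := by
      intro hv
      rw [← ENNReal.ofReal_coe_nnreal (p := S), ← ENNReal.ofReal_coe_nnreal (p := y.toNNReal),
        ← ENNReal.ofReal_add (by positivity) (by positivity), Real.coe_toNNReal y hy.le,
        ENNReal.ofReal_le_ofReal_iff (by positivity)]
      simp
    by_cases hv : 0 < v ∧ v ≤ y
    · rw [if_pos ⟨e1.2 hv.1, (e2 hv.1).2 hv.2⟩, Set.indicator_of_mem (Set.mem_Ioc.2 hv)]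
      have hpos : ∀ q, 0 < Function.update X p v.toNNReal q := by
        intro q
        by_cases h : q = p
        · subst h; simpa using hv.1
        · simpa [h] using hX q
      have := hHp (Function.update X p v.toNNReal) hpos y.toNNReal (by simpa using hy) (S + v)
      rw [hσp X hX v.toNNReal (by simpa using hv.1), ← hSX, Function.update_self,
        Function.update_idem] at this
      refine this (e1.2 hv.1) ?_ ((e2 hv.1).2 hv.2)
      rw [ENNReal.ofReal_add (by positivity) hv.1.le, ENNReal.ofReal_coe_nnreal]
      rfl
    · rw [if_neg, Set.indicator_of_notMem (mt Set.mem_Ioc.1 hv)]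
      rintro ⟨h1, h2⟩
      exact hv ⟨e1.1 h1, (e2 (e1.1 h1)).1 h2⟩
  · filter_upwards [ae_pos_expMeasure hmu] with y hy
    rw [hσp X hX y.toNNReal (by simpa using hy), if_pos hS, ← hSX, Function.update_self, hK]
    congr 1
    rw [← ENNReal.coe_add, ENNReal.coe_toReal, NNReal.coe_add, Real.coe_toNNReal y hy.le]

/-! ### The intensity of the departures -/

/-- The realization with arrival times `a`, seed `u` and downloading times `X`. -/
abbrev realization {n : ℕ} (a : ℕ → ℝ≥0) (u : unitInterval) (X : ℕ × Fin n → ℝ≥0) : Sample n :=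
  (a, X, u)

lemma regular_realization {n : ℕ} {a : ℕ → ℝ≥0} (ha : Monotone a) (ha' : Tendsto a atTop atTop)
    (u : unitInterval) {X : ℕ × Fin n → ℝ≥0} (hX : ∀ p, 0 < X p) :
    (realization a u X).Regular :=
  ⟨ha, ha', fun i j => hX (i, j)⟩

lemma measurable_realization {n : ℕ} (a : ℕ → ℝ≥0) (u : unitInterval) :
    Measurable (realization (n := n) a u) :=
  measurable_const.prodMk (measurable_id.prodMk measurable_const)

lemma pos_update {ι : Type*} [DecidableEq ι] {X : ι → ℝ≥0} (hX : ∀ q, 0 < X q) (p : ι) {y : ℝ≥0}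
    (hy : 0 < y) (q : ι) : 0 < Function.update X p y q := by
  by_cases h : q = p
  · subst h; simpa using hy
  · simpa [h] using hX q

namespace Scheme

variable {L n : ℕ} (s : Scheme L n)

lemma measurable_finish (i : ℕ) (j : Fin n) : Measurable fun ω => s.start.finish ω i j := by
  unfold StartRule.finish
  refine (s.measurable_start i j).add (measurable_coe_nnreal_ennreal.comp ?_)
  exact (measurable_pi_apply (i, j)).comp (measurable_fst.comp measurable_snd)

lemma measurable_departure (i : ℕ) : Measurable fun ω => s.start.departure ω i := by
  unfold StartRule.departure
  exact Measurable.iInf fun j => s.measurable_finish i j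

/-- The download `p` runs to its end, which is the time of departure of its request. -/
def Completes (ω : Sample n) (p : ℕ × Fin n) : Prop :=
  s.start.finish ω p.1 p.2 = s.start.departure ω p.1 ∧ s.start.departure ω p.1 < ⊤

/-- No two downloads are completed at the same time. -/
def NoTies (ω : Sample n) : Prop :=
  ∀ p q, s.Completes ω p → s.Completes ω q →
    s.start.departure ω p.1 = s.start.departure ω q.1 → p = q

section Compensator

variable {a : ℕ → ℝ≥0} (ha : Monotone a) (ha' : Tendsto a atTop atTop) (u : unitInterval)
  {mu : ℝ} (hmu : 0 < mu)
include ha ha' hmu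

open Classical in
lemma lintegral_completion_eq (p : ℕ × Fin n) {H : (ℕ × Fin n → ℝ≥0) → ℝ → ℝ≥0∞}
    (hH : Measurable fun z : (ℕ × Fin n → ℝ≥0) × ℝ => H z.1 z.2)
    (hHp : ∀ X X' : ℕ × Fin n → ℝ≥0, (∀ q, 0 < X q) → (∀ q, 0 < X' q) →
      (∀ q, q ≠ p → X q = X' q) → ∀ r : ℝ,
      ENNReal.ofReal r ≤ s.start.finish (realization a u X) p.1 p.2 →
      ENNReal.ofReal r ≤ s.start.finish (realization a u X') p.1 p.2 → H X' r = H X r) :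
    ∫⁻ X, (if s.start (realization a u X) p.1 p.2 < ⊤ then
        H X (s.start.finish (realization a u X) p.1 p.2).toReal else 0) ∂(downloadLaw _ mu) =
      ENNReal.ofReal mu * ∫⁻ X, (∫⁻ r : ℝ, if s.start (realization a u X) p.1 p.2 <
        ENNReal.ofReal r ∧ ENNReal.ofReal r ≤ s.start.finish (realization a u X) p.1 p.2
        then H X r else 0) ∂(downloadLaw _ mu) := by
  have hσp : ∀ X : ℕ × Fin n → ℝ≥0, (∀ q, 0 < X q) → ∀ y : ℝ≥0, 0 < y →
      s.start (realization a u (Function.update X p y)) p.1 p.2 =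
        s.start (realization a u X) p.1 p.2 := by
    intro X hX y hy
    refine start_eq_of_agree (regular_realization ha ha' u (pos_update hX p hy))
      (regular_realization ha ha' u hX) rfl rfl fun q hq => ?_
    simp [Sample.download, Function.update_of_ne hq]
  refine ReplicationQueue.lintegral_completion_eq hmu p
    ((s.measurable_start p.1 p.2).comp (measurable_realization a u)) hH hσp ?_
  intro X hX y hy r _ h1 h2
  refine hHp X _ hX (pos_update hX p hy) (fun q hq => by simp [hq]) r h1 ?_
  unfold StartRule.finish
  rw [hσp X hX y hy]
  simpa [Sample.download] using h2

lemma ae_noTies : ∀ᵐ X ∂(downloadLaw (ℕ × Fin n) mu), s.NoTies (realization a u X) := by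
  classical
  have key : ∀ p : ℕ × Fin n, ∀ᵐ X ∂(downloadLaw (ℕ × Fin n) mu),
      s.start (realization a u X) p.1 p.2 < ⊤ → ∀ q ≠ p,
        ¬ (s.start.finish (realization a u X) q.1 q.2 =
            ENNReal.ofReal (s.start.finish (realization a u X) p.1 p.2).toReal ∧
          ENNReal.ofReal (s.start.finish (realization a u X) p.1 p.2).toReal ≤
            s.start.departure (realization a u X) q.1) := by
    intro p
    set C : Set ((ℕ × Fin n → ℝ≥0) × ℝ) := ⋃ q ∈ {q | q ≠ p},
      {z | s.start.finish (realization a u z.1) q.1 q.2 = ENNReal.ofReal z.2 ∧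
        ENNReal.ofReal z.2 ≤ s.start.departure (realization a u z.1) q.1} with hC
    have hCm : MeasurableSet C := by
      refine MeasurableSet.biUnion (Set.to_countable _) fun q _ => ?_
      exact (measurableSet_eq_fun (((s.measurable_finish q.1 q.2).comp
        (measurable_realization a u)).comp measurable_fst) measurable_snd.ennreal_ofReal).inter
        (measurableSet_le measurable_snd.ennreal_ofReal (((s.measurable_departure q.1).comp
        (measurable_realization a u)).comp measurable_fst))
    set H : (ℕ × Fin n → ℝ≥0) → ℝ → ℝ≥0∞ := fun X r => C.indicator (fun _ => 1) (X, r) with hHd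
    have hHm : Measurable fun z : (ℕ × Fin n → ℝ≥0) × ℝ => H z.1 z.2 :=
      measurable_const.indicator hCm
    have h := s.lintegral_completion_eq ha ha' u hmu p hHm ?_
    · have hz : ∀ X : ℕ × Fin n → ℝ≥0, (∫⁻ r : ℝ, if s.start (realization a u X) p.1 p.2 <
          ENNReal.ofReal r ∧ ENNReal.ofReal r ≤ s.start.finish (realization a u X) p.1 p.2
          then H X r else 0) = 0 := by
        intro X
        refine (lintegral_congr_ae (g := fun _ => 0) ?_).trans lintegral_zero
        have hcount : (Set.range fun q : ℕ × Fin n =>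
            (s.start.finish (realization a u X) q.1 q.2).toReal).Countable :=
          Set.countable_range _
        filter_upwards [hcount.ae_notMem volume] with r hr
        split_ifs with hcond
        · refine Set.indicator_of_notMem ?_ _
          simp only [hC, Set.mem_iUnion, Set.mem_ofPred_eq, not_exists, not_and]
          intro q _ hq
          exfalso
          refine hr ⟨q, ?_⟩
          have hpos : 0 < r := by
            by_contra hneg
            rw [ENNReal.ofReal_of_nonpos (not_lt.1 hneg)] at hcond
            exact not_lt_zero hcond.1
          simp only [hq, ENNReal.toReal_ofReal hpos.le]
        · rfl
      simp only [hz, lintegral_zero, mul_zero] at h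
      rw [lintegral_eq_zero_iff] at h
      · filter_upwards [h] with X hX hfin q hq hcon
        simp only [hfin, if_true, Pi.zero_apply, hHd] at hX
        rw [Set.indicator_of_mem] at hX
        · exact one_ne_zero hX
        · simp only [hC, Set.mem_iUnion]
          exact ⟨q, hq, hcon⟩
      · refine Measurable.ite (measurableSet_lt ((s.measurable_start p.1 p.2).comp
          (measurable_realization a u)) measurable_const) ?_ measurable_const
        exact hHm.comp (measurable_id.prodMk (((s.measurable_finish p.1 p.2).comp
          (measurable_realization a u)).ennreal_toReal))
    · have hsub : ∀ X X' : ℕ × Fin n → ℝ≥0, (∀ q, 0 < X q) → (∀ q, 0 < X' q) →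
          (∀ q, q ≠ p → X q = X' q) → ∀ r : ℝ,
          ENNReal.ofReal r ≤ s.start.finish (realization a u X) p.1 p.2 →
          ENNReal.ofReal r ≤ s.start.finish (realization a u X') p.1 p.2 →
          (X, r) ∈ C → (X', r) ∈ C := by
        intro X X' hX hX' hXX r h1 h2 hr
        simp only [hC, Set.mem_iUnion] at hr ⊢
        obtain ⟨q, hq, hf, hd⟩ := hr
        have hω := regular_realization ha ha' u hX
        have hω' := regular_realization ha ha' u hX'
        have hfin : s.start (realization a u X) q.1 q.2 < ⊤ :=
          (s.start.start_le_finish _ _ _).trans_lt (by rw [hf]; exact ENNReal.ofReal_lt_top)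
        have hlt := s.start.start_lt_finish hω hfin
        simp only at hf
        rw [hf] at hlt
        have hst := (start_eq_iff_of_agree hω hω' rfl rfl (fun q hq => hXX q hq) h1 h2 hlt
          q.1 q.2).1 rfl
        refine ⟨q, hq, ?_, ?_⟩
        · rw [← hf]
          simp only [StartRule.finish, hst, Sample.download, hXX q hq]
        · rw [← not_lt] at hd ⊢
          exact mt (departure_lt_iff_of_agree hω hω' rfl rfl (fun q hq => hXX q hq) h1 h2 q.1).2 hd
      intro X X' hX hX' hXX r h1 h2
      by_cases hr : (X, r) ∈ C
      · simp only [hHd]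
        rw [Set.indicator_of_mem hr, Set.indicator_of_mem (hsub X X' hX hX' hXX r h1 h2 hr)]
      · simp only [hHd]
        rw [Set.indicator_of_notMem hr, Set.indicator_of_notMem fun h => hr
          (hsub X' X hX' hX (fun q hq => (hXX q hq).symm) r h2 h1 h)]
  filter_upwards [ae_all_iff.2 key] with X hX p q hp hq hpq
  by_contra hne
  have hfin : s.start (realization a u X) p.1 p.2 < ⊤ :=
    (s.start.start_le_finish _ _ _).trans_lt (hp.1 ▸ hp.2)
  refine hX p hfin q (Ne.symm hne) ?_
  rw [ENNReal.ofReal_toReal (hp.1 ▸ hp.2).ne, hq.1, hp.1]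
  exact ⟨hpq.symm, hpq.le⟩

open Classical in
/-- The compensator formula for the departures: the number of downloads that are in progress,
multiplied by `mu`, is the intensity of the departures, with respect to quantities `G` that depend,
at time `r`, only on the set of the requests which have departed before `r`. -/
lemma lintegral_departures_eq {G : (ℕ × Fin n → ℝ≥0) → ℝ → ℝ≥0∞}
    (hG : Measurable fun z : (ℕ × Fin n → ℝ≥0) × ℝ => G z.1 z.2)
    (hGp : ∀ X X' : ℕ × Fin n → ℝ≥0, (∀ q, 0 < X q) → (∀ q, 0 < X' q) → ∀ r : ℝ,
      (∀ i, s.start.departure (realization a u X) i < ENNReal.ofReal r ↔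
        s.start.departure (realization a u X') i < ENNReal.ofReal r) → G X r = G X' r) :
    ∫⁻ X, (∑' p, if s.Completes (realization a u X) p then
        G X (s.start.departure (realization a u X) p.1).toReal else 0) ∂(downloadLaw _ mu) =
      ENNReal.ofReal mu * ∫⁻ X, (∫⁻ r : ℝ, ∑' p : ℕ × Fin n,
        if s.start (realization a u X) p.1 p.2 < ENNReal.ofReal r ∧
          ENNReal.ofReal r ≤ s.start.departure (realization a u X) p.1 then G X r else 0)
        ∂(downloadLaw _ mu) := by
  have hst : ∀ p : ℕ × Fin n, Measurable fun X => s.start (realization a u X) p.1 p.2 :=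
    fun p => (s.measurable_start p.1 p.2).comp (measurable_realization a u)
  have hfi : ∀ p : ℕ × Fin n, Measurable fun X => s.start.finish (realization a u X) p.1 p.2 :=
    fun p => (s.measurable_finish p.1 p.2).comp (measurable_realization a u)
  have hde : ∀ p : ℕ × Fin n, Measurable fun X => s.start.departure (realization a u X) p.1 :=
    fun p => (s.measurable_departure p.1).comp (measurable_realization a u)
  have hm1 : ∀ p : ℕ × Fin n, Measurable fun X => if s.Completes (realization a u X) p then
        G X (s.start.departure (realization a u X) p.1).toReal else 0 := by
    intro p
    refine Measurable.ite ?_ (hG.comp (measurable_id.prodMk (hde p).ennreal_toReal))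
      measurable_const
    exact (measurableSet_eq_fun (hfi p) (hde p)).inter (measurableSet_lt (hde p) measurable_const)
  have hm2 : ∀ p : ℕ × Fin n, Measurable fun z : (ℕ × Fin n → ℝ≥0) × ℝ =>
      if s.start (realization a u z.1) p.1 p.2 < ENNReal.ofReal z.2 ∧
          ENNReal.ofReal z.2 ≤ s.start.departure (realization a u z.1) p.1
      then G z.1 z.2 else 0 := by
    intro p
    refine Measurable.ite ?_ hG measurable_const
    exact (measurableSet_lt ((hst p).comp measurable_fst) measurable_snd.ennreal_ofReal).inter
      (measurableSet_le measurable_snd.ennreal_ofReal ((hde p).comp measurable_fst))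
  rw [lintegral_tsum fun p => (hm1 p).aemeasurable]
  have hR : ∀ X : ℕ × Fin n → ℝ≥0, (∫⁻ r : ℝ, ∑' p : ℕ × Fin n,
        if s.start (realization a u X) p.1 p.2 < ENNReal.ofReal r ∧
          ENNReal.ofReal r ≤ s.start.departure (realization a u X) p.1 then G X r else 0) =
      ∑' p : ℕ × Fin n, ∫⁻ r : ℝ,
        if s.start (realization a u X) p.1 p.2 < ENNReal.ofReal r ∧
          ENNReal.ofReal r ≤ s.start.departure (realization a u X) p.1 then G X r else 0 :=
    fun X => lintegral_tsum fun p => ((hm2 p).comp measurable_prodMk_left).aemeasurable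
  simp only [hR]
  rw [lintegral_tsum fun p => (hm2 p).lintegral_prod_right'.aemeasurable, ← ENNReal.tsum_mul_left]
  refine tsum_congr fun p => ?_
  have h := s.lintegral_completion_eq ha ha' u hmu p
    (H := fun X r => if ENNReal.ofReal r ≤ s.start.departure (realization a u X) p.1
      then G X r else 0) ?_ ?_
  · convert h using 2
    · ext X
      rcases eq_top_or_lt_top (s.start (realization a u X) p.1 p.2) with htop | hfin
      · have : s.start.finish (realization a u X) p.1 p.2 = ⊤ :=
          top_le_iff.1 (htop ▸ s.start.start_le_finish _ _ _)
        rw [if_neg, if_neg htop.not_lt]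
        rintro ⟨h1, h2⟩
        rw [← h1, this] at h2
        exact lt_irrefl _ h2
      · have hf : s.start.finish (realization a u X) p.1 p.2 < ⊤ :=
          ENNReal.add_lt_top.2 ⟨hfin, ENNReal.coe_lt_top⟩
        rw [if_pos hfin, ENNReal.ofReal_toReal hf.ne]
        by_cases hc : s.Completes (realization a u X) p
        · rw [if_pos hc, if_pos hc.1.le, hc.1]
        · rw [if_neg hc, if_neg]
          intro hle
          have heq := le_antisymm hle (s.start.departure_le_finish _ _ _)
          exact hc ⟨heq, heq ▸ hf⟩
    · refine lintegral_congr fun X => lintegral_congr fun r => ?_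
      have := s.start.departure_le_finish (realization a u X) p.1 p.2
      by_cases h1 : s.start (realization a u X) p.1 p.2 < ENNReal.ofReal r
      · by_cases h2 : ENNReal.ofReal r ≤ s.start.departure (realization a u X) p.1
        · simp [h1, h2, h2.trans this]
        · simp [h2]
      · simp [h1]
  · exact Measurable.ite (measurableSet_le measurable_snd.ennreal_ofReal
      ((hde p).comp measurable_fst)) hG measurable_const
  · intro X X' hX hX' hXX r h1 h2
    have hd := departure_lt_iff_of_agree (regular_realization ha ha' u hX)
      (regular_realization ha ha' u hX') rfl rfl (fun q hq => hXX q hq) h1 h2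
    have := hd p.1
    rw [← not_iff_not, not_lt, not_lt] at this
    simp only [this, hGp X X' hX hX' r hd]

omit ha ha' hmu in
/-- At almost all times the downloads in progress are counted by `activeAt`. -/
lemma ae_tsum_active_eq (X : ℕ × Fin n → ℝ≥0) (x : ℝ → ℝ≥0∞) :
    ∀ᵐ r : ℝ, ((∑' p : ℕ × Fin n, open Classical in
        if s.start (realization a u X) p.1 p.2 < ENNReal.ofReal r ∧
          ENNReal.ofReal r ≤ s.start.departure (realization a u X) p.1 then x r else 0) =
        if 0 < r then ((s.start.activeAt (realization a u X) r.toNNReal).encard : ℝ≥0∞) * x r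
        else 0) ∧
      ∀ i, ENNReal.ofReal r ≤ s.start.departure (realization a u X) i →
        ENNReal.ofReal r < s.start.departure (realization a u X) i ∨ r ≤ 0 := by
  classical
  have hc1 : (Set.range fun q : ℕ × Fin n =>
      (s.start (realization a u X) q.1 q.2).toReal).Countable := Set.countable_range _
  have hc2 : (Set.range fun i : ℕ =>
      (s.start.departure (realization a u X) i).toReal).Countable := Set.countable_range _
  filter_upwards [hc1.ae_notMem volume, hc2.ae_notMem volume] with r hr1 hr2
  have hd : ∀ i, ENNReal.ofReal r ≤ s.start.departure (realization a u X) i →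
      ENNReal.ofReal r < s.start.departure (realization a u X) i ∨ r ≤ 0 := by
    intro i hi
    rcases hi.lt_or_eq with h | h
    · exact Or.inl h
    · right
      by_contra hpos
      refine hr2 ⟨i, ?_⟩
      simp only [← h]
      exact ENNReal.toReal_ofReal (not_le.1 hpos).le
  refine ⟨?_, hd⟩
  by_cases hr : 0 < r
  · rw [if_pos hr]
    have hset : ∀ p : ℕ × Fin n, (s.start (realization a u X) p.1 p.2 < ENNReal.ofReal r ∧
          ENNReal.ofReal r ≤ s.start.departure (realization a u X) p.1) ↔
        p ∈ s.start.activeAt (realization a u X) r.toNNReal := by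
      intro p
      constructor
      · rintro ⟨h1, h2⟩
        exact ⟨h1.le, (hd p.1 h2).resolve_right (not_le.2 hr)⟩
      · rintro ⟨h1, h2⟩
        refine ⟨lt_of_le_of_ne h1 fun h => hr1 ⟨p, ?_⟩, h2.le⟩
        simp only [h]
        exact ENNReal.toReal_ofReal hr.le
    simp only [hset]
    rw [← ENNReal.tsum_set_one, tsum_subtype _ (fun _ => (1 : ℝ≥0∞)), ← ENNReal.tsum_mul_right]
    refine tsum_congr fun p => ?_
    by_cases hp : p ∈ s.start.activeAt (realization a u X) r.toNNReal <;> simp [hp]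
  · rw [if_neg hr]
    simp [ENNReal.ofReal_of_nonpos (not_lt.1 hr)]

open Classical in
/-- The departures of any scheme have intensity at most `L * mu`, and they have no intensity while
the system is empty. -/
lemma lintegral_departures_le {G : (ℕ × Fin n → ℝ≥0) → ℝ → ℝ≥0∞}
    (hG : Measurable fun z : (ℕ × Fin n → ℝ≥0) × ℝ => G z.1 z.2)
    (hGp : ∀ X X' : ℕ × Fin n → ℝ≥0, (∀ q, 0 < X q) → (∀ q, 0 < X' q) → ∀ r : ℝ,
      (∀ i, s.start.departure (realization a u X) i < ENNReal.ofReal r ↔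
        s.start.departure (realization a u X') i < ENNReal.ofReal r) → G X r = G X' r) :
    ∫⁻ X, (∑' p, if s.Completes (realization a u X) p then
        G X (s.start.departure (realization a u X) p.1).toReal else 0) ∂(downloadLaw _ mu) ≤
      ENNReal.ofReal (L * mu) * ∫⁻ X, (∫⁻ r : ℝ,
        if ∃ i, (a i : ℝ≥0∞) < ENNReal.ofReal r ∧
          ENNReal.ofReal r ≤ s.start.departure (realization a u X) i then G X r else 0)
        ∂(downloadLaw _ mu) := by
  rw [s.lintegral_departures_eq ha ha' u hmu hG hGp, mul_comm (L : ℝ),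
    ENNReal.ofReal_mul hmu.le, ENNReal.ofReal_natCast, mul_assoc]
  gcongr
  rw [← lintegral_const_mul' _ _ (ENNReal.natCast_ne_top L)]
  refine lintegral_mono_ae ?_
  filter_upwards [ae_pos_downloadLaw hmu] with X hX
  rw [← lintegral_const_mul' _ _ (ENNReal.natCast_ne_top L)]
  refine lintegral_mono_ae ?_
  have hω := regular_realization ha ha' u hX
  filter_upwards [s.ae_tsum_active_eq u X (G X)] with r hr
  by_cases hex : ∃ i, (a i : ℝ≥0∞) < ENNReal.ofReal r ∧
          ENNReal.ofReal r ≤ s.start.departure (realization a u X) i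
  · rw [hr.1, if_pos hex]
    split_ifs with h0
    · gcongr
      have := s.capacity (realization a u X) hω r.toNNReal
      exact_mod_cast this
    · exact zero_le
  · rw [if_neg hex, mul_zero, nonpos_iff_eq_zero, ENNReal.tsum_eq_zero]
    intro p
    rw [if_neg]
    rintro ⟨h1, h2⟩
    exact hex ⟨p.1, (s.arrival_le_start _ hω p.1 p.2).trans_lt h1, h2⟩

open Classical in
/-- The departures of a work-conserving scheme have intensity `L * mu` while there is a request in
the system. -/
lemma WorkConserving.le_lintegral_departures {s : Scheme L n} (hs : s.WorkConserving)
    {G : (ℕ × Fin n → ℝ≥0) → ℝ → ℝ≥0∞}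
    (hG : Measurable fun z : (ℕ × Fin n → ℝ≥0) × ℝ => G z.1 z.2)
    (hGp : ∀ X X' : ℕ × Fin n → ℝ≥0, (∀ q, 0 < X q) → (∀ q, 0 < X' q) → ∀ r : ℝ,
      (∀ i, s.start.departure (realization a u X) i < ENNReal.ofReal r ↔
        s.start.departure (realization a u X') i < ENNReal.ofReal r) → G X r = G X' r) :
    ENNReal.ofReal (L * mu) * ∫⁻ X, (∫⁻ r : ℝ,
        if ∃ i, (a i : ℝ≥0∞) < ENNReal.ofReal r ∧
          ENNReal.ofReal r ≤ s.start.departure (realization a u X) i then G X r else 0)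
        ∂(downloadLaw _ mu) ≤
    ∫⁻ X, (∑' p, if s.Completes (realization a u X) p then
        G X (s.start.departure (realization a u X) p.1).toReal else 0) ∂(downloadLaw _ mu) := by
  rw [s.lintegral_departures_eq ha ha' u hmu hG hGp, mul_comm (L : ℝ),
    ENNReal.ofReal_mul hmu.le, ENNReal.ofReal_natCast, mul_assoc]
  gcongr
  rw [← lintegral_const_mul' _ _ (ENNReal.natCast_ne_top L)]
  refine lintegral_mono_ae ?_
  filter_upwards [ae_pos_downloadLaw hmu] with X hX
  rw [← lintegral_const_mul' _ _ (ENNReal.natCast_ne_top L)]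
  refine lintegral_mono_ae ?_
  have hω := regular_realization ha ha' u hX
  filter_upwards [s.ae_tsum_active_eq u X (G X)] with r hr
  split_ifs with hex
  · obtain ⟨i, h1, h2⟩ := hex
    have hpos : 0 < r := by
      by_contra hneg
      rw [ENNReal.ofReal_of_nonpos (not_lt.1 hneg)] at h1
      exact not_lt_zero h1
    rw [hr.1, if_pos hpos, hs (realization a u X) hω r.toNNReal ⟨i, ?_, ?_⟩]
    · simp
    · exact (ENNReal.coe_lt_coe.1 h1).le
    · exact (hr.2 i h2).resolve_right (not_le.2 hpos)
  · simp

end Compensator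

end Scheme

/-! ### The epochs of departure -/

namespace Scheme

variable {L n : ℕ} (s : Scheme L n)

/-- The time `T_(d)` of the `d`-th departure: the first time by which `d` requests have departed.
In particular `T_(0) = 0`. -/
noncomputable def epoch (ω : Sample n) (d : ℕ) : ℝ≥0∞ :=
  ⨅ (I : Finset ℕ) (_ : I.card = d), I.sup (s.start.departure ω)

lemma measurable_epoch (d : ℕ) : Measurable fun ω => s.epoch ω d := by
  unfold epoch
  refine Measurable.iInf fun I => Measurable.iInf fun _ => ?_
  simp only [Finset.sup_eq_iSup]
  exact Measurable.iSup fun i => Measurable.iSup fun _ => s.measurable_departure i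

lemma epoch_lt_iff {ω : Sample n} {d : ℕ} {r : ℝ≥0∞} (hr : 0 < r) :
    s.epoch ω d < r ↔ ∃ I : Finset ℕ, I.card = d ∧ ∀ i ∈ I, s.start.departure ω i < r := by
  simp only [epoch, iInf_lt_iff, exists_prop]
  refine exists_congr fun I => and_congr_right fun _ => ?_
  rw [Finset.sup_lt_iff (by simpa using hr)]

lemma epoch_le_of_forall {ω : Sample n} {I : Finset ℕ} {t : ℝ≥0∞}
    (h : ∀ i ∈ I, s.start.departure ω i ≤ t) : s.epoch ω I.card ≤ t :=
  iInf₂_le_of_le I rfl (Finset.sup_le h)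

lemma epoch_zero (ω : Sample n) : s.epoch ω 0 = 0 := by
  have := s.epoch_le_of_forall (ω := ω) (I := ∅) (t := 0) (by simp)
  simpa using this

lemma epoch_le_succ (ω : Sample n) (d : ℕ) : s.epoch ω d ≤ s.epoch ω (d + 1) := by
  refine le_iInf₂ fun I hI => ?_
  obtain ⟨J, hJI, hJ⟩ := Finset.exists_subset_card_eq (s := I) (n := d) (by omega)
  rw [← hJ]
  exact s.epoch_le_of_forall fun i hi => Finset.le_sup (f := s.start.departure ω) (hJI hi)

lemma exists_le_of_card {I : Finset ℕ} {d : ℕ} (hI : I.card = d + 1) : ∃ i ∈ I, d ≤ i := by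
  by_contra! h
  have : I ⊆ Finset.range d := fun i hi => Finset.mem_range.2 (h i hi)
  have := Finset.card_le_card this
  rw [Finset.card_range] at this
  omega

lemma arrival_le_epoch_succ {ω : Sample n} (hω : ω.Regular) (d : ℕ) :
    (ω.arrival d : ℝ≥0∞) ≤ s.epoch ω (d + 1) := by
  refine le_iInf₂ fun I hI => ?_
  obtain ⟨i, hi, hdi⟩ := exists_le_of_card hI
  refine le_trans ?_ ((s.arrival_le_departure hω i).trans (Finset.le_sup hi))
  exact ENNReal.coe_le_coe.2 (hω.arrival_mono hdi)

/-- If a request is in the system after `d` departures, then more than `d` have arrived. -/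
lemma arrival_lt_of_epoch_lt {ω : Sample n} (hω : ω.Regular) {d : ℕ} {r : ℝ≥0∞}
    (hd : s.epoch ω d < r) {i : ℕ} (hi : (ω.arrival i : ℝ≥0∞) < r)
    (hir : r ≤ s.start.departure ω i) : (ω.arrival d : ℝ≥0∞) < r := by
  obtain ⟨I, hI, h⟩ := (s.epoch_lt_iff (pos_of_gt hd)).1 hd
  have hiI : i ∉ I := fun hmem => absurd (h i hmem) (not_lt.2 hir)
  obtain ⟨k, hk, hdk⟩ := exists_le_of_card (I := insert i I) (d := d)
    (by rw [Finset.card_insert_of_notMem hiI, hI])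
  refine lt_of_le_of_lt (ENNReal.coe_le_coe.2 (hω.arrival_mono hdk)) ?_
  rcases Finset.mem_insert.1 hk with rfl | hk
  · exact hi
  · exact (s.arrival_lt_departure hω k).trans (h k hk)

/-- Before the departure number `d + 1`, one of the first `d + 1` requests is still present. -/
lemma exists_le_departure_of_le_epoch {ω : Sample n} {d : ℕ} {r : ℝ≥0∞} (hr : 0 < r)
    (h : r ≤ s.epoch ω (d + 1)) : ∃ i ≤ d, r ≤ s.start.departure ω i := by
  by_contra! hcon
  refine absurd ((s.epoch_lt_iff (d := d + 1) hr).2 ⟨Finset.range (d + 1), by simp, ?_⟩)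
    (not_lt.2 h)
  intro i hi
  exact hcon i (Nat.lt_succ_iff.1 (Finset.mem_range.1 hi))

lemma exists_completes {ω : Sample n} {i : ℕ} (h : s.start.departure ω i < ⊤) :
    ∃ j, s.Completes ω (i, j) := by
  obtain ⟨j, hj⟩ := s.start.exists_finish_eq_departure h
  exact ⟨j, hj, h⟩

lemma departure_le_epoch_succ {ω : Sample n} {d i : ℕ}
    (h : s.epoch ω d < s.start.departure ω i) :
    s.epoch ω (d + 1) ≤ s.start.departure ω i := by
  obtain ⟨I, hI, hlt⟩ := (s.epoch_lt_iff (pos_of_gt h)).1 h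
  have hiI : i ∉ I := fun hmem => lt_irrefl _ (hlt i hmem)
  have := s.epoch_le_of_forall (ω := ω) (I := insert i I) (t := s.start.departure ω i) ?_
  · rwa [Finset.card_insert_of_notMem hiI, hI] at this
  · intro k hk
    rcases Finset.mem_insert.1 hk with rfl | hk
    · exact le_rfl
    · exact (hlt k hk).le

/-- When departures are never simultaneous, the `d`-th departures are distinct and each of them
is the departure of some request. -/
lemma exists_completes_epoch {ω : Sample n} (hω : ω.Regular) (hties : s.NoTies ω) {d : ℕ}
    (h : s.epoch ω (d + 1) < ⊤) :
    s.epoch ω d < s.epoch ω (d + 1) ∧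
      ∃ p, s.Completes ω p ∧ s.start.departure ω p.1 = s.epoch ω (d + 1) := by
  obtain ⟨t, ht⟩ : ∃ t : ℝ≥0, (t : ℝ≥0∞) = s.epoch ω (d + 1) := ⟨_, ENNReal.coe_toNNReal h.ne⟩
  -- after `t`, and before the next departure, at least `d + 1` requests have departed until `t`
  obtain ⟨I, hI, hIt⟩ : ∃ I : Finset ℕ, I.card = d + 1 ∧
      ∀ i ∈ I, s.start.departure ω i ≤ t := by
    set F := (hω.finite_arrival_le (t + 1)).toFinset with hF
    have hev : ∀ᶠ r in 𝓝[>] (t : ℝ≥0∞), ∀ i ∈ F, s.start.departure ω i < r →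
        s.start.departure ω i ≤ t := by
      rw [Filter.eventually_all_finset]
      intro i _
      by_cases hi : s.start.departure ω i ≤ t
      · exact Eventually.of_forall fun r _ => hi
      · filter_upwards [Ioo_mem_nhdsGT (not_le.1 hi)] with r hr hlt
        exact absurd hlt (not_lt.2 hr.2.le)
    have hlt : (t : ℝ≥0∞) < (t + 1 : ℝ≥0) := by
      exact_mod_cast lt_add_one t
    have : (𝓝[>] (t : ℝ≥0∞)).NeBot := nhdsGT_neBot_of_exists_gt ⟨_, hlt⟩
    obtain ⟨r, hr, hrt⟩ := (hev.and (Ioo_mem_nhdsGT hlt)).exists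
    obtain ⟨I, hI, hIr⟩ := (s.epoch_lt_iff (d := d + 1) (pos_of_gt hrt.1)).1 (ht ▸ hrt.1)
    refine ⟨I, hI, fun i hi => hr i ?_ (hIr i hi)⟩
    simp only [hF, Set.Finite.mem_toFinset, Set.mem_ofPred_eq]
    exact ENNReal.coe_le_coe.1
      ((s.arrival_lt_departure hω i).trans ((hIr i hi).trans hrt.2)).le
  have htpos : (0 : ℝ≥0∞) < t := by
    obtain ⟨i, hi⟩ := Finset.card_pos.1 (by rw [hI]; exact Nat.succ_pos d : 0 < I.card)
    exact (pos_of_gt (s.arrival_lt_departure hω i)).trans_le (hIt i hi)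
  obtain ⟨i, hi, hit⟩ : ∃ i ∈ I, s.start.departure ω i = t := by
    by_contra! hne
    refine lt_irrefl (t : ℝ≥0∞) ?_
    conv_lhs => rw [ht]
    exact (s.epoch_lt_iff htpos).2 ⟨I, hI, fun i hi => lt_of_le_of_ne (hIt i hi) (hne i hi)⟩
  obtain ⟨j, hj⟩ := s.exists_completes (ω := ω) (i := i) (hit ▸ ENNReal.coe_lt_top)
  refine ⟨?_, (i, j), hj, hit.trans ht⟩
  rw [← ht, s.epoch_lt_iff htpos]
  refine ⟨I.erase i, by rw [Finset.card_erase_of_mem hi, hI]; simp, fun k hk => ?_⟩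
  refine lt_of_le_of_ne (hIt k (Finset.mem_of_mem_erase hk)) fun hkt => ?_
  obtain ⟨j', hj'⟩ := s.exists_completes (ω := ω) (i := k) (hkt ▸ ENNReal.coe_lt_top)
  have := hties _ _ hj' hj (hkt.trans hit.symm)
  exact Finset.ne_of_mem_erase hk (Prod.ext_iff.1 this).1

end Scheme

/-! ### The canonical departure times -/

/-- The law of the `d`-th departure time of a queue with a single exponential server of rate `c`,
to which customers come at times `α 0, α 1, …`. It is given by Lindley's recursion: customer `d`
is served from the time `max τ (α d)`, where `τ` is the `d`-th departure time. -/
noncomputable def canonicalLaw (c : ℝ) (α : ℕ → ℝ≥0) : ℕ → Measure ℝ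
  | 0 => Measure.dirac 0
  | d + 1 => ((canonicalLaw c α d).prod (expMeasure c)).map
      fun p : ℝ × ℝ => max p.1 (α d : ℝ) + p.2

lemma isProbabilityMeasure_canonicalLaw {c : ℝ} (hc : 0 < c) (α : ℕ → ℝ≥0) (d : ℕ) :
    IsProbabilityMeasure (canonicalLaw c α d) := by
  induction d with
  | zero => unfold canonicalLaw; infer_instance
  | succ d ih =>
    have := isProbabilityMeasure_expMeasure hc
    exact Measure.isProbabilityMeasure_map (by fun_prop)

lemma canonicalLaw_succ_Ioi {c : ℝ} (hc : 0 < c) (α : ℕ → ℝ≥0) (d : ℕ) (t : ℝ) :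
    canonicalLaw c α (d + 1) (Set.Ioi t) =
      ∫⁻ e, canonicalLaw c α d {x | t < max x (α d) + e} ∂(expMeasure c) := by
  have := isProbabilityMeasure_expMeasure hc
  have := isProbabilityMeasure_canonicalLaw hc α d
  rw [canonicalLaw, Measure.map_apply (by fun_prop) measurableSet_Ioi,
    Measure.prod_apply_symm (measurableSet_Ioi.preimage (by fun_prop))]
  rfl

/-- The probability that `m + E > t`, when `E` is exponential with rate `c`. -/
lemma expMeasure_add_gt {c : ℝ} (hc : 0 < c) (m : ℝ≥0∞) {t : ℝ} (ht : 0 ≤ t) :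
    expMeasure c {e | ENNReal.ofReal t < m + ENNReal.ofReal e} =
      (if ENNReal.ofReal t < m then 1 else 0) +
        (if m ≤ ENNReal.ofReal t then ENNReal.ofReal (Real.exp (-(c * (t - m.toReal)))) else 0) := by
  have := isProbabilityMeasure_expMeasure hc
  rcases lt_or_ge (ENNReal.ofReal t) m with h | h
  · have : {e : ℝ | ENNReal.ofReal t < m + ENNReal.ofReal e} = Set.univ :=
      Set.eq_univ_of_forall fun e => h.trans_le le_self_add
    simp [this, h, not_le.2 h]
  · rw [if_neg (not_lt.2 h), if_pos h, zero_add]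
    obtain ⟨x, rfl⟩ : ∃ x : ℝ≥0, (x : ℝ≥0∞) = m :=
      ⟨_, ENNReal.coe_toNNReal (h.trans_lt ENNReal.ofReal_lt_top).ne⟩
    rw [← ENNReal.ofReal_coe_nnreal, ENNReal.ofReal_le_ofReal_iff ht] at h
    have hx : 0 ≤ t - x := sub_nonneg.2 h
    rw [ENNReal.coe_toReal, ← expMeasure_Ioi hc hx]
    refine measure_congr ?_
    filter_upwards [ae_pos_expMeasure hc] with e he
    refine propext ?_
    change ENNReal.ofReal t < x + ENNReal.ofReal e ↔ t - x < e
    rw [← ENNReal.ofReal_coe_nnreal, ← ENNReal.ofReal_add x.coe_nonneg he.le,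
      ENNReal.ofReal_lt_ofReal_iff (by positivity)]
    constructor <;> intro h <;> linarith

lemma lintegral_Ioc_exp {c : ℝ} (hc : 0 < c) {x y : ℝ} (hxy : x ≤ y) (t : ℝ) :
    ENNReal.ofReal c * ∫⁻ r in Set.Ioc x y, ENNReal.ofReal (Real.exp (-(c * (t - r)))) =
      ENNReal.ofReal (Real.exp (-(c * (t - y))) - Real.exp (-(c * (t - x)))) := by
  rw [← lintegral_const_mul' _ _ ENNReal.ofReal_ne_top]
  simp only [← ENNReal.ofReal_mul hc.le]
  have hcont : Continuous fun r : ℝ => c * Real.exp (-(c * (t - r))) := by fun_prop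
  rw [← ofReal_integral_eq_lintegral_ofReal, ← intervalIntegral.integral_of_le hxy]
  · congr 1
    refine intervalIntegral.integral_eq_sub_of_hasDerivAt (f := fun r => Real.exp (-(c * (t - r))))
      (fun r _ => ?_) (hcont.intervalIntegrable _ _)
    have h1 : HasDerivAt (fun r : ℝ => -(c * (t - r))) c r := by
      have h2 := ((hasDerivAt_id r).const_sub t).const_mul (-c)
      simpa [Function.id_def] using h2
    simpa [mul_comm] using h1.exp
  · exact (hcont.integrableOn_Icc).mono_set Set.Ioc_subset_Icc_self
  · exact Eventually.of_forall fun r => by positivity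

open Classical in
/-- Integration of a hazard of rate `c` with weight `exp (-c (t - r))` from `m` to `ρ`, within
`[0, t]`. The weight is chosen so that the result compares the events `ρ > t` and `m + E > t` with
an exponential `E`. -/
lemma hazard_identity {c : ℝ} (hc : 0 < c) {m ρ : ℝ≥0∞} (h : m ≤ ρ) {t : ℝ} (ht : 0 ≤ t) :
    (ENNReal.ofReal c * ∫⁻ r : ℝ, if m < ENNReal.ofReal r ∧ ENNReal.ofReal r ≤ ρ ∧ r ≤ t then
        ENNReal.ofReal (Real.exp (-(c * (t - r)))) else 0) +
      (if m ≤ ENNReal.ofReal t then ENNReal.ofReal (Real.exp (-(c * (t - m.toReal)))) else 0) =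
    (if ρ ≤ ENNReal.ofReal t then ENNReal.ofReal (Real.exp (-(c * (t - ρ.toReal)))) else 0) +
      (if m ≤ ENNReal.ofReal t ∧ ENNReal.ofReal t < ρ then 1 else 0) := by
  rcases lt_or_ge (ENNReal.ofReal t) m with hm | hm
  · have h1 : ∀ r : ℝ, ¬ (m < ENNReal.ofReal r ∧ ENNReal.ofReal r ≤ ρ ∧ r ≤ t) := by
      rintro r ⟨h1, -, h2⟩
      exact absurd (hm.trans h1) (not_lt.2 (ENNReal.ofReal_le_ofReal h2))
    simp [h1, not_le.2 hm, not_le.2 (hm.trans_le h)]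
  obtain ⟨x, rfl⟩ : ∃ x : ℝ≥0, (x : ℝ≥0∞) = m :=
    ⟨_, ENNReal.coe_toNNReal (hm.trans_lt ENNReal.ofReal_lt_top).ne⟩
  have hxt : (x : ℝ) ≤ t := by
    rwa [← ENNReal.ofReal_coe_nnreal, ENNReal.ofReal_le_ofReal_iff ht] at hm
  -- the integral extends from `x` to `y`, the minimum of `ρ` and `t`
  have main : ∀ y : ℝ, (x : ℝ) ≤ y → (∀ r : ℝ, 0 < r → (ENNReal.ofReal r ≤ ρ ∧ r ≤ t ↔ r ≤ y)) →
      (ENNReal.ofReal c * ∫⁻ r : ℝ, if (x : ℝ≥0∞) < ENNReal.ofReal r ∧ ENNReal.ofReal r ≤ ρ ∧ r ≤ t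
        then ENNReal.ofReal (Real.exp (-(c * (t - r)))) else 0) +
        ENNReal.ofReal (Real.exp (-(c * (t - x)))) = ENNReal.ofReal (Real.exp (-(c * (t - y)))) := by
    intro y hxy hy
    have : (fun r : ℝ => if (x : ℝ≥0∞) < ENNReal.ofReal r ∧ ENNReal.ofReal r ≤ ρ ∧ r ≤ t then
        ENNReal.ofReal (Real.exp (-(c * (t - r)))) else 0) =
        (Set.Ioc (x : ℝ) y).indicator fun r => ENNReal.ofReal (Real.exp (-(c * (t - r)))) := by
      ext r
      have e1 : ((x : ℝ≥0∞) < ENNReal.ofReal r) ↔ (x : ℝ) < r := by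
        rw [ENNReal.ofReal, ENNReal.coe_lt_coe, Real.lt_toNNReal_iff_coe_lt]
      by_cases hr : (x : ℝ) < r
      · have := hy r (x.coe_nonneg.trans_lt hr)
        simp only [e1, hr, true_and, Set.indicator, Set.mem_Ioc, this]
      · simp [e1, hr]
    rw [this, lintegral_indicator measurableSet_Ioc, lintegral_Ioc_exp hc hxy,
      ← ENNReal.ofReal_add _ (by positivity), sub_add_cancel]
    rw [sub_nonneg, Real.exp_le_exp]
    nlinarith
  rw [if_pos hm, ENNReal.coe_toReal]
  rcases lt_or_ge (ENNReal.ofReal t) ρ with hρ | hρ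
  · rw [if_neg (not_le.2 hρ), if_pos ⟨hm, hρ⟩, main t hxt]
    · simp
    · intro r _
      refine ⟨fun h => h.2, fun h => ⟨(ENNReal.ofReal_le_ofReal h).trans hρ.le, h⟩⟩
  · rw [if_pos hρ, if_neg (fun h => absurd h.2 (not_lt.2 hρ)), add_zero]
    obtain ⟨y, rfl⟩ : ∃ y : ℝ≥0, (y : ℝ≥0∞) = ρ :=
      ⟨_, ENNReal.coe_toNNReal (hρ.trans_lt ENNReal.ofReal_lt_top).ne⟩
    rw [← ENNReal.ofReal_coe_nnreal, ENNReal.ofReal_le_ofReal_iff ht] at hρ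
    rw [ENNReal.coe_toReal, main y (by exact_mod_cast h)]
    intro r _
    rw [← ENNReal.ofReal_coe_nnreal, ENNReal.ofReal_le_ofReal_iff y.coe_nonneg]
    exact ⟨fun h => h.1, fun h => ⟨h, h.trans hρ⟩⟩

section Compare

variable {Ω : Type*} [MeasurableSpace Ω] {P : Measure Ω} [IsProbabilityMeasure P] {c : ℝ}
  (hc : 0 < c) {α : ℕ → ℝ≥0} {d : ℕ} {ρ : Ω → ℝ≥0∞}
include hc

omit hc [IsProbabilityMeasure P] in
lemma ofReal_lt_max_add_iff {m : ℝ≥0∞} {x : ℝ≥0} {t e : ℝ} (he : 0 < e) (hx : (x : ℝ) ≤ t - e) :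
    ENNReal.ofReal t < max m x + ENNReal.ofReal e ↔ ENNReal.ofReal (t - e) < m := by
  rw [ENNReal.ofReal_sub t he.le, ENNReal.sub_lt_iff_lt_right ENNReal.ofReal_ne_top]
  · rcases le_total m x with h | h
    · rw [max_eq_right h]
      have h1 : ENNReal.ofReal t ≥ x + ENNReal.ofReal e := by
        rw [← ENNReal.ofReal_coe_nnreal, ← ENNReal.ofReal_add x.coe_nonneg he.le]
        exact ENNReal.ofReal_le_ofReal (by linarith)
      constructor
      · intro h2; exact absurd h2 (not_lt.2 h1)
      · intro h2; exact absurd (h2.trans_le (by gcongr)) (not_lt.2 h1)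
    · rw [max_eq_left h]
  · exact ENNReal.ofReal_le_ofReal (by have := x.coe_nonneg; linarith)

lemma le_canonicalLaw_succ
    (ih : ∀ t : ℝ, 0 ≤ t → P {X | ENNReal.ofReal t < ρ X} ≤ canonicalLaw c α d (Set.Ioi t))
    (t : ℝ) :
    ∫⁻ e, P {X | ENNReal.ofReal t < max (ρ X) (α d) + ENNReal.ofReal e} ∂(expMeasure c) ≤
      canonicalLaw c α (d + 1) (Set.Ioi t) := by
  have := isProbabilityMeasure_canonicalLaw hc α d
  rw [canonicalLaw_succ_Ioi hc]
  refine lintegral_mono_ae ?_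
  filter_upwards [ae_pos_expMeasure hc] with e he
  rcases lt_or_ge (t - e) (α d) with h | h
  · have : {x : ℝ | t < max x (α d) + e} = Set.univ :=
      Set.eq_univ_of_forall fun x => by
        have := le_max_right x (α d : ℝ)
        change t < max x (α d) + e
        linarith
    rw [this, measure_univ]
    exact prob_le_one
  · simp only [ofReal_lt_max_add_iff he h]
    refine (ih (t - e) ((α d).coe_nonneg.trans h)).trans (measure_mono fun x hx => ?_)
    have := le_max_left x (α d : ℝ)
    have hx : t - e < x := hx
    change t < max x (α d) + e
    linarith

lemma canonicalLaw_succ_le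
    (ih : ∀ t : ℝ, 0 ≤ t → canonicalLaw c α d (Set.Ioi t) ≤ P {X | ENNReal.ofReal t < ρ X})
    (t : ℝ) :
    canonicalLaw c α (d + 1) (Set.Ioi t) ≤
      ∫⁻ e, P {X | ENNReal.ofReal t < max (ρ X) (α d) + ENNReal.ofReal e} ∂(expMeasure c) := by
  have := isProbabilityMeasure_canonicalLaw hc α d
  rw [canonicalLaw_succ_Ioi hc]
  refine lintegral_mono_ae ?_
  filter_upwards [ae_pos_expMeasure hc] with e he
  rcases lt_or_ge (t - e) (α d) with h | h
  · have : {X | ENNReal.ofReal t < max (ρ X) (α d) + ENNReal.ofReal e} = Set.univ := by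
      refine Set.eq_univ_of_forall fun X => ?_
      refine lt_of_lt_of_le ?_ (add_le_add_left (le_max_right (ρ X) (α d : ℝ≥0∞)) _)
      rw [← ENNReal.ofReal_coe_nnreal, ← ENNReal.ofReal_add (α d).coe_nonneg he.le]
      exact (ENNReal.ofReal_lt_ofReal_iff (by have := (α d).coe_nonneg; positivity)).2 (by linarith)
    rw [this, measure_univ]
    exact prob_le_one
  · simp only [ofReal_lt_max_add_iff he h]
    refine le_trans (measure_mono fun x hx => ?_) (ih (t - e) ((α d).coe_nonneg.trans h))
    have hx : t < max x (α d) + e := hx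
    change t - e < x
    rcases max_cases x (α d : ℝ) with h1 | h1 <;> linarith

lemma lintegral_expMeasure_add_gt {m : Ω → ℝ≥0∞} (hm : Measurable m) {t : ℝ} (ht : 0 ≤ t) :
    ∫⁻ e, P {X | ENNReal.ofReal t < m X + ENNReal.ofReal e} ∂(expMeasure c) =
      P {X | ENNReal.ofReal t < m X} + ∫⁻ X, (if m X ≤ ENNReal.ofReal t then
        ENNReal.ofReal (Real.exp (-(c * (t - (m X).toReal)))) else 0) ∂P := by
  have := isProbabilityMeasure_expMeasure hc
  have hS : MeasurableSet {z : Ω × ℝ | ENNReal.ofReal t < m z.1 + ENNReal.ofReal z.2} :=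
    measurableSet_lt measurable_const ((hm.comp measurable_fst).add measurable_snd.ennreal_ofReal)
  have h1 := Measure.prod_apply_symm (μ := P) (ν := expMeasure c) hS
  have h2 := Measure.prod_apply (μ := P) (ν := expMeasure c) hS
  have h3 : MeasurableSet {X | ENNReal.ofReal t < m X} := measurableSet_lt measurable_const hm
  have h4 : P {X | ENNReal.ofReal t < m X} =
      ∫⁻ X, (if ENNReal.ofReal t < m X then 1 else 0) ∂P := by
    rw [← lintegral_indicator_one h3]
    refine lintegral_congr fun X => ?_
    simp [Set.indicator]
  rw [h4, ← lintegral_add_left (Measurable.ite h3 measurable_const measurable_const)]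
  simp only [← expMeasure_add_gt hc _ ht]
  exact h1.symm.trans h2

end Compare

/-! ### Stochastic comparison of the departures with the canonical queue -/

namespace Scheme

variable {L n : ℕ} (s : Scheme L n)

section Compare

variable {a : ℕ → ℝ≥0} (ha : Monotone a) (ha' : Tendsto a atTop atTop) (u : unitInterval)
  {mu : ℝ} (hmu : 0 < mu)

lemma epoch_lt_iff_of_departure_lt_iff {ω ω' : Sample n} {r : ℝ≥0∞}
    (h : ∀ i, s.start.departure ω i < r ↔ s.start.departure ω' i < r) (d : ℕ) :
    s.epoch ω d < r ↔ s.epoch ω' d < r := by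
  rcases eq_or_ne r 0 with rfl | hr
  · simp
  · rw [s.epoch_lt_iff (pos_iff_ne_zero.2 hr), s.epoch_lt_iff (pos_iff_ne_zero.2 hr)]
    simp only [h]

open Classical in
/-- The weight of hazard at time `r` that contributes to the event that the departure number
`d + 1` takes place at time `t` at the latest, and not after `Z`. -/
noncomputable def hazardWeight (c t : ℝ) (d : ℕ) (Z : (ℕ × Fin n → ℝ≥0) → ℝ≥0∞)
    (X : ℕ × Fin n → ℝ≥0) (r : ℝ) : ℝ≥0∞ :=
  if s.epoch (realization a u X) d < ENNReal.ofReal r ∧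
      ENNReal.ofReal r ≤ s.epoch (realization a u X) (d + 1) ∧ ENNReal.ofReal r ≤ Z X ∧ r ≤ t then
    ENNReal.ofReal (Real.exp (-(c * (t - r)))) else 0

lemma measurable_epoch_realization (d : ℕ) :
    Measurable fun X => s.epoch (realization a u X) d :=
  (s.measurable_epoch d).comp (measurable_realization a u)

lemma measurable_hazardWeight (c t : ℝ) (d : ℕ) {Z : (ℕ × Fin n → ℝ≥0) → ℝ≥0∞}
    (hZ : Measurable Z) : Measurable fun z : (ℕ × Fin n → ℝ≥0) × ℝ =>
      s.hazardWeight (a := a) u c t d Z z.1 z.2 := by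
  unfold hazardWeight
  have h1 : ∀ d, Measurable fun z : (ℕ × Fin n → ℝ≥0) × ℝ => s.epoch (realization a u z.1) d :=
    fun d => (s.measurable_epoch_realization u d).comp measurable_fst
  refine Measurable.ite ?_ ?_ measurable_const
  · exact (measurableSet_lt (h1 d) measurable_snd.ennreal_ofReal).inter
      ((measurableSet_le measurable_snd.ennreal_ofReal (h1 (d + 1))).inter
      ((measurableSet_le measurable_snd.ennreal_ofReal (hZ.comp measurable_fst)).inter
        (measurableSet_le measurable_snd measurable_const)))
  · fun_prop

lemma hazardWeight_eq_of_departure_lt_iff (c t : ℝ) (d : ℕ) {Z : (ℕ × Fin n → ℝ≥0) → ℝ≥0∞}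
    {X X' : ℕ × Fin n → ℝ≥0} {r : ℝ}
    (h : ∀ i, s.start.departure (realization a u X) i < ENNReal.ofReal r ↔
      s.start.departure (realization a u X') i < ENNReal.ofReal r)
    (hZ : Z X < ENNReal.ofReal r ↔ Z X' < ENNReal.ofReal r) :
    s.hazardWeight (a := a) u c t d Z X r = s.hazardWeight (a := a) u c t d Z X' r := by
  have h1 := not_congr hZ
  have h2 := not_congr (s.epoch_lt_iff_of_departure_lt_iff h (d + 1))
  rw [not_lt, not_lt] at h1 h2
  simp only [hazardWeight, h1, h2, s.epoch_lt_iff_of_departure_lt_iff h d]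

open Classical in
lemma measurable_exp_of_le (c t : ℝ) {ρ : (ℕ × Fin n → ℝ≥0) → ℝ≥0∞} (hρ : Measurable ρ) :
    Measurable fun X => if ρ X ≤ ENNReal.ofReal t then
      ENNReal.ofReal (Real.exp (-(c * (t - (ρ X).toReal)))) else 0 :=
  Measurable.ite (measurableSet_le hρ measurable_const) (by fun_prop) measurable_const

open Classical in
lemma lintegral_exp_of_le_ne_top {c t : ℝ} (hc : 0 < c) (ht : 0 ≤ t)
    {P : Measure (ℕ × Fin n → ℝ≥0)} [IsProbabilityMeasure P] (ρ : (ℕ × Fin n → ℝ≥0) → ℝ≥0∞) :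
    ∫⁻ X, (if ρ X ≤ ENNReal.ofReal t then
      ENNReal.ofReal (Real.exp (-(c * (t - (ρ X).toReal)))) else 0) ∂P ≠ ⊤ := by
  refine ((lintegral_mono (g := fun _ => 1) fun X => ?_).trans_lt ?_).ne
  · split_ifs with h
    · rw [← ENNReal.ofReal_one]
      refine ENNReal.ofReal_le_ofReal (Real.exp_le_one_iff.2 ?_)
      have := ENNReal.toReal_le_of_le_ofReal ht h
      nlinarith
    · exact zero_le
  · simp

open Classical in
/-- The integral of the hazard, for a density `c` on the interval from `m` to `ρ`. -/
lemma lintegral_hazard_identity {c t : ℝ} (hc : 0 < c) (ht : 0 ≤ t)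
    {P : Measure (ℕ × Fin n → ℝ≥0)} [IsProbabilityMeasure P] {m ρ : (ℕ × Fin n → ℝ≥0) → ℝ≥0∞}
    (hm : Measurable m) (hρ : Measurable ρ) (h : ∀ᵐ X ∂P, m X ≤ ρ X) :
    (ENNReal.ofReal c * ∫⁻ X, (∫⁻ r : ℝ, if m X < ENNReal.ofReal r ∧ ENNReal.ofReal r ≤ ρ X ∧ r ≤ t
        then ENNReal.ofReal (Real.exp (-(c * (t - r)))) else 0) ∂P) +
      ∫⁻ e, P {X | ENNReal.ofReal t < m X + ENNReal.ofReal e} ∂(expMeasure c) =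
    ∫⁻ X, (if ρ X ≤ ENNReal.ofReal t then
      ENNReal.ofReal (Real.exp (-(c * (t - (ρ X).toReal)))) else 0) ∂P +
      P {X | ENNReal.ofReal t < ρ X} := by
  rw [lintegral_expMeasure_add_gt hc hm ht, add_left_comm,
    ← lintegral_const_mul' _ _ ENNReal.ofReal_ne_top,
    ← lintegral_add_right _ (measurable_exp_of_le c t hm)]
  have hS : MeasurableSet {X | m X ≤ ENNReal.ofReal t ∧ ENNReal.ofReal t < ρ X} :=
    (measurableSet_le hm measurable_const).inter (measurableSet_lt measurable_const hρ)
  have h1 : P {X | ENNReal.ofReal t < ρ X} = P {X | ENNReal.ofReal t < m X} +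
      P {X | m X ≤ ENNReal.ofReal t ∧ ENNReal.ofReal t < ρ X} := by
    rw [← measure_union _ hS]
    · refine measure_congr ?_
      filter_upwards [h] with X hX
      refine propext ?_
      change ENNReal.ofReal t < ρ X ↔ ENNReal.ofReal t < m X ∨
        (m X ≤ ENNReal.ofReal t ∧ ENNReal.ofReal t < ρ X)
      constructor
      · intro h
        rcases lt_or_ge (ENNReal.ofReal t) (m X) with h' | h'
        · exact Or.inl h'
        · exact Or.inr ⟨h', h⟩
      · rintro (h | h)
        · exact h.trans_le hX
        · exact h.2
    · rw [Set.disjoint_left]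
      rintro X h1 ⟨h2, -⟩
      exact absurd h1 (not_lt.2 h2)
  have h2 : P {X | m X ≤ ENNReal.ofReal t ∧ ENNReal.ofReal t < ρ X} =
      ∫⁻ X, (if m X ≤ ENNReal.ofReal t ∧ ENNReal.ofReal t < ρ X then 1 else 0) ∂P := by
    rw [← lintegral_indicator_one hS]
    refine lintegral_congr fun X => ?_
    simp [Set.indicator]
  rw [h1, h2, add_left_comm, ← lintegral_add_left (measurable_exp_of_le c t hρ)]
  congr 1
  refine lintegral_congr_ae ?_
  filter_upwards [h] with X hX
  exact hazard_identity hc hX ht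

include ha ha' hmu

/-- Under any scheme the departure times are, one by one, stochastically larger than those of a
single exponential server of rate `L * mu`. -/
theorem canonicalLaw_le_epoch (hL : 1 ≤ L) (d : ℕ) (t : ℝ) (ht : 0 ≤ t) :
    canonicalLaw (L * mu) a d (Set.Ioi t) ≤
      downloadLaw _ mu {X | ENNReal.ofReal t < s.epoch (realization a u X) d} := by
  classical
  have hc : 0 < (L : ℝ) * mu := by positivity
  have := isProbabilityMeasure_downloadLaw (ι := ℕ × Fin n) hmu
  induction d generalizing t with
  | zero =>
    rw [canonicalLaw, Measure.dirac_apply' _ measurableSet_Ioi, Set.indicator_of_notMem]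
    · exact zero_le
    · simpa using ht
  | succ d ih =>
    refine (canonicalLaw_succ_le hc ih t).trans ?_
    have hmeas := s.measurable_epoch_realization (a := a) u
    have hid := lintegral_hazard_identity hc ht (P := downloadLaw _ mu)
      ((hmeas d).max (measurable_const (a := (a d : ℝ≥0∞)))) (hmeas (d + 1)) (by
        filter_upwards [ae_pos_downloadLaw hmu] with X hX
        exact max_le (s.epoch_le_succ _ d)
          (s.arrival_le_epoch_succ (regular_realization ha ha' u hX) d))
    have hdep := s.lintegral_departures_le ha ha' u hmu
      (s.measurable_hazardWeight (a := a) u (L * mu) t d (Z := fun _ => ⊤) measurable_const)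
      (fun X X' _ _ r h => s.hazardWeight_eq_of_departure_lt_iff u _ _ _ h (by simp))
    have hleft : ∫⁻ X, (if s.epoch (realization a u X) (d + 1) ≤ ENNReal.ofReal t then
        ENNReal.ofReal (Real.exp (-(L * mu * (t - (s.epoch (realization a u X) (d + 1)).toReal))))
          else 0) ∂(downloadLaw _ mu) ≤
        ∫⁻ X, (∑' p, if s.Completes (realization a u X) p then
          s.hazardWeight (a := a) u (L * mu) t d (fun _ => ⊤) X
            (s.start.departure (realization a u X) p.1).toReal else 0) ∂(downloadLaw _ mu) := by
      refine lintegral_mono_ae ?_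
      filter_upwards [ae_pos_downloadLaw hmu, s.ae_noTies ha ha' u hmu] with X hX hties
      split_ifs with hle
      · have htop := hle.trans_lt ENNReal.ofReal_lt_top
        obtain ⟨hlt, p, hp, hpe⟩ :=
          s.exists_completes_epoch (regular_realization ha ha' u hX) hties htop
        refine le_trans ?_ (ENNReal.le_tsum p)
        rw [if_pos hp, hpe, hazardWeight, if_pos]
        rw [ENNReal.ofReal_toReal htop.ne]
        exact ⟨hlt, le_rfl, le_top, ENNReal.toReal_le_of_le_ofReal ht hle⟩
      · exact zero_le
    have hright : ∫⁻ X, (∫⁻ r : ℝ, if ∃ i, (a i : ℝ≥0∞) < ENNReal.ofReal r ∧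
          ENNReal.ofReal r ≤ s.start.departure (realization a u X) i then
          s.hazardWeight (a := a) u (L * mu) t d (fun _ => ⊤) X r else 0) ∂(downloadLaw _ mu) ≤
        ∫⁻ X, (∫⁻ r : ℝ, if max (s.epoch (realization a u X) d) (a d) < ENNReal.ofReal r ∧
          ENNReal.ofReal r ≤ s.epoch (realization a u X) (d + 1) ∧ r ≤ t then
          ENNReal.ofReal (Real.exp (-(L * mu * (t - r)))) else 0) ∂(downloadLaw _ mu) := by
      refine lintegral_mono_ae ?_
      filter_upwards [ae_pos_downloadLaw hmu] with X hX
      refine lintegral_mono fun r => ?_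
      dsimp only [hazardWeight]
      split_ifs with h1 h2 h3 h3
      · exact le_rfl
      · obtain ⟨i, hi1, hi2⟩ := h1
        exact absurd ⟨max_lt h2.1 (s.arrival_lt_of_epoch_lt
          (regular_realization ha ha' u hX) h2.1 hi1 hi2), h2.2.1, h2.2.2.2⟩ h3
      all_goals exact zero_le
    refine (ENNReal.add_le_add_iff_left (lintegral_exp_of_le_ne_top hc ht
      (P := downloadLaw _ mu) fun X => s.epoch (realization a u X) (d + 1))).1 ?_
    rw [← hid]
    gcongr
    refine (hleft.trans hdep).trans ?_
    gcongr

/-- Under a work-conserving scheme, the departure times, up to an observable time `Z`, are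
stochastically smaller than those of a single exponential server of rate `L * mu`, provided that
there is a request in the system between the time `α d` and the time, until `Z`, of the departure
number `d + 1`. -/
theorem WorkConserving.epoch_le_canonicalLaw {s : Scheme L n} (hs : s.WorkConserving) (hL : 1 ≤ L)
    {Z : (ℕ × Fin n → ℝ≥0) → ℝ≥0∞} (hZ : Measurable Z)
    (hZp : ∀ X X' : ℕ × Fin n → ℝ≥0, ∀ r : ℝ,
      (∀ i, s.start.departure (realization a u X) i < ENNReal.ofReal r ↔
        s.start.departure (realization a u X') i < ENNReal.ofReal r) →
      (Z X < ENNReal.ofReal r ↔ Z X' < ENNReal.ofReal r))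
    {α : ℕ → ℝ≥0}
    (hα : ∀ X : ℕ × Fin n → ℝ≥0, (∀ p, 0 < X p) → ∀ d,
      (α d : ℝ≥0∞) ≤ min (s.epoch (realization a u X) (d + 1)) (Z X))
    (hbusy : ∀ X : ℕ × Fin n → ℝ≥0, (∀ p, 0 < X p) → ∀ d, ∀ r : ℝ≥0∞, (α d : ℝ≥0∞) < r →
      r ≤ s.epoch (realization a u X) (d + 1) → r ≤ Z X →
      ∃ i, (a i : ℝ≥0∞) < r ∧ r ≤ s.start.departure (realization a u X) i)
    (d : ℕ) (t : ℝ) (ht : 0 ≤ t) :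
    downloadLaw _ mu {X | ENNReal.ofReal t < min (s.epoch (realization a u X) d) (Z X)} ≤
      canonicalLaw (L * mu) α d (Set.Ioi t) := by
  classical
  have hc : 0 < (L : ℝ) * mu := by positivity
  have := isProbabilityMeasure_downloadLaw (ι := ℕ × Fin n) hmu
  induction d generalizing t with
  | zero => simp [s.epoch_zero]
  | succ d ih =>
    refine le_trans ?_ (le_canonicalLaw_succ hc ih t)
    have hmeas : ∀ d, Measurable fun X => min (s.epoch (realization a u X) d) (Z X) :=
      fun d => (s.measurable_epoch_realization u d).min hZ
    have hid := lintegral_hazard_identity hc ht (P := downloadLaw _ mu)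
      ((hmeas d).max (measurable_const (a := (α d : ℝ≥0∞)))) (hmeas (d + 1)) (by
        filter_upwards [ae_pos_downloadLaw hmu] with X hX
        exact max_le (min_le_min_right _ (s.epoch_le_succ _ d)) (hα X hX d))
    have hdep := hs.le_lintegral_departures ha ha' u hmu
      (s.measurable_hazardWeight (a := a) u (L * mu) t d hZ)
      (fun X X' _ _ r h => s.hazardWeight_eq_of_departure_lt_iff u _ _ _ h (hZp X X' r h))
    have hleft : ∫⁻ X, (∑' p, if s.Completes (realization a u X) p then
          s.hazardWeight (a := a) u (L * mu) t d Z X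
            (s.start.departure (realization a u X) p.1).toReal else 0) ∂(downloadLaw _ mu) ≤
        ∫⁻ X, (if min (s.epoch (realization a u X) (d + 1)) (Z X) ≤ ENNReal.ofReal t then
          ENNReal.ofReal (Real.exp (-(L * mu *
            (t - (min (s.epoch (realization a u X) (d + 1)) (Z X)).toReal))))
          else 0) ∂(downloadLaw _ mu) := by
      refine lintegral_mono_ae ?_
      filter_upwards [s.ae_noTies ha ha' u hmu] with X hties
      -- a download that contributes is completed at the departure number `d + 1`
      have hcontr : ∀ p, (s.Completes (realization a u X) p ∧
          s.hazardWeight (a := a) u (L * mu) t d Z X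
            (s.start.departure (realization a u X) p.1).toReal ≠ 0) →
          s.start.departure (realization a u X) p.1 = s.epoch (realization a u X) (d + 1) ∧
          s.epoch (realization a u X) (d + 1) ≤ Z X ∧
          (s.epoch (realization a u X) (d + 1)).toReal ≤ t := by
        rintro p ⟨hp, hne⟩
        unfold hazardWeight at hne
        rw [ENNReal.ofReal_toReal hp.2.ne] at hne
        split_ifs at hne with hcond
        · have heq := le_antisymm hcond.2.1 (s.departure_le_epoch_succ hcond.1)
          rw [heq] at hcond
          exact ⟨heq, hcond.2.2⟩
        · exact absurd rfl hne
      by_cases hex : ∃ p, s.Completes (realization a u X) p ∧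
          s.hazardWeight (a := a) u (L * mu) t d Z X
            (s.start.departure (realization a u X) p.1).toReal ≠ 0
      · obtain ⟨p, hp, hne⟩ := hex
        obtain ⟨h1, h2, h3⟩ := hcontr p ⟨hp, hne⟩
        have htop : s.epoch (realization a u X) (d + 1) < ⊤ := h1 ▸ hp.2
        rw [tsum_eq_single p, if_pos hp, min_eq_left h2, if_pos]
        · unfold hazardWeight
          rw [h1]
          split_ifs
          · exact le_rfl
          · exact zero_le
        · rw [← ENNReal.ofReal_toReal htop.ne]
          exact ENNReal.ofReal_le_ofReal h3
        · intro q hq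
          by_contra hcon
          have hq' : s.Completes (realization a u X) q ∧
              s.hazardWeight (a := a) u (L * mu) t d Z X
                (s.start.departure (realization a u X) q.1).toReal ≠ 0 := by
            split_ifs at hcon with h
            · exact ⟨h, hcon⟩
            · exact absurd rfl hcon
          exact hq (hties q p hq'.1 hp ((hcontr q hq').1.trans h1.symm))
      · rw [ENNReal.tsum_eq_zero.2]
        · exact zero_le
        · intro p
          split_ifs with h
          · by_contra hne
            exact hex ⟨p, h, hne⟩
          · rfl
    have hright : ∫⁻ X, (∫⁻ r : ℝ, if
          max (min (s.epoch (realization a u X) d) (Z X)) (α d) < ENNReal.ofReal r ∧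
          ENNReal.ofReal r ≤ min (s.epoch (realization a u X) (d + 1)) (Z X) ∧ r ≤ t then
          ENNReal.ofReal (Real.exp (-(L * mu * (t - r)))) else 0) ∂(downloadLaw _ mu) ≤
        ∫⁻ X, (∫⁻ r : ℝ, if ∃ i, (a i : ℝ≥0∞) < ENNReal.ofReal r ∧
          ENNReal.ofReal r ≤ s.start.departure (realization a u X) i then
          s.hazardWeight (a := a) u (L * mu) t d Z X r else 0) ∂(downloadLaw _ mu) := by
      refine lintegral_mono_ae ?_
      filter_upwards [ae_pos_downloadLaw hmu] with X hX
      refine lintegral_mono fun r => ?_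
      split_ifs with h1 h2
      · unfold hazardWeight
        have h3 := le_min_iff.1 h1.2.1
        rw [if_pos]
        refine ⟨?_, h3.1, h3.2, h1.2.2⟩
        rcases min_lt_iff.1 ((le_max_left _ _).trans_lt h1.1) with h | h
        · exact h
        · exact absurd h (not_lt.2 h3.2)
      · have h3 := le_min_iff.1 h1.2.1
        exact absurd (hbusy X hX d _ ((le_max_right _ _).trans_lt h1.1) h3.1 h3.2) h2
      all_goals exact zero_le
    refine (ENNReal.add_le_add_iff_left (lintegral_exp_of_le_ne_top hc ht
      (P := downloadLaw _ mu)
      fun X => min (s.epoch (realization a u X) (d + 1)) (Z X))).1 ?_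
    rw [← hid]
    gcongr
    refine le_trans ?_ (hdep.trans hleft)
    gcongr

/-- Under a work-conserving scheme the `d`-th departure time is stochastically smaller than that
of the canonical queue. -/
theorem WorkConserving.epoch_le {s : Scheme L n} (hs : s.WorkConserving) (hL : 1 ≤ L)
    (d : ℕ) (t : ℝ) (ht : 0 ≤ t) :
    downloadLaw _ mu {X | ENNReal.ofReal t < s.epoch (realization a u X) d} ≤
      canonicalLaw (L * mu) a d (Set.Ioi t) := by
  have := hs.epoch_le_canonicalLaw ha ha' u hmu hL (Z := fun _ => ⊤) measurable_const
    (fun _ _ _ _ => by simp) (α := a)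
    (fun X hX d => le_min
      (s.arrival_le_epoch_succ (regular_realization ha ha' u hX) d) le_top)
    (fun X hX d r hr h1 _ => by
      obtain ⟨i, hid, hi⟩ := s.exists_le_departure_of_le_epoch (pos_of_gt hr) h1
      exact ⟨i, lt_of_le_of_lt (ENNReal.coe_le_coe.2 (ha hid)) hr, hi⟩) d t ht
  simpa using this

/-- As long as request `i` is in the system, a work-conserving scheme keeps all threads active.
Hence, until request `i` departs, the departure times are stochastically smaller than those of a
canonical queue whose customers come at the time of arrival of request `i` at the latest. -/
theorem WorkConserving.min_epoch_departure_le {s : Scheme L n} (hs : s.WorkConserving)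
    (hL : 1 ≤ L) (i d : ℕ) (t : ℝ) (ht : 0 ≤ t) :
    downloadLaw _ mu {X | ENNReal.ofReal t < min (s.epoch (realization a u X) d)
      (s.start.departure (realization a u X) i)} ≤
      canonicalLaw (L * mu) (fun j => min (a j) (a i)) d (Set.Ioi t) := by
  refine hs.epoch_le_canonicalLaw ha ha' u hmu hL
    ((s.measurable_departure i).comp (measurable_realization a u)) (fun X X' r h => h i)
    (fun X hX d => ?_) (fun X hX d r hr h1 h2 => ?_) d t ht
  · have hω := regular_realization ha ha' u hX
    rw [ENNReal.coe_min]
    exact min_le_min (s.arrival_le_epoch_succ hω d) (s.arrival_le_departure hω i)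
  · rw [ENNReal.coe_min] at hr
    rcases min_lt_iff.1 hr with h | h
    · obtain ⟨k, hkd, hk⟩ := s.exists_le_departure_of_le_epoch (pos_of_gt hr) h1
      exact ⟨k, lt_of_le_of_lt (ENNReal.coe_le_coe.2 (ha hkd)) h, hk⟩
    · exact ⟨i, h, h2⟩

end Compare

end Scheme

/-! ### Estimates for the canonical queue -/

lemma setOf_lt_max_add_of_lt {t x e : ℝ} (h : t - e < x) : {y : ℝ | t < max y x + e} = Set.univ :=
  Set.eq_univ_of_forall fun y => by
    have := le_max_right y x
    change t < max y x + e
    linarith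

lemma setOf_lt_max_add_of_le {t x e : ℝ} (h : x ≤ t - e) :
    {y : ℝ | t < max y x + e} = Set.Ioi (t - e) := by
  ext y
  change t < max y x + e ↔ t - e < y
  rcases max_cases y x with h1 | h1
  · rw [h1.1]; constructor <;> intro _ <;> linarith
  · rw [h1.1]; constructor <;> intro _ <;> linarith

/-- Speeding up the arrivals by a factor `k⁻¹ ≥ 1`, with the same server, makes the departure times
stochastically larger, up to the change of time scale. -/
lemma canonicalLaw_Ioi_le_of_scale {c : ℝ} (hc : 0 < c) {α α' : ℕ → ℝ≥0} {k : ℝ} (hk : 0 < k)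
    (hk1 : k ≤ 1) (hα : ∀ j, k * α j ≤ α' j) (d : ℕ) (t : ℝ) :
    canonicalLaw c α d (Set.Ioi t) ≤ canonicalLaw c α' d (Set.Ioi (k * t)) := by
  induction d generalizing t with
  | zero =>
    rw [canonicalLaw, canonicalLaw, Measure.dirac_apply' _ measurableSet_Ioi,
      Measure.dirac_apply' _ measurableSet_Ioi]
    rcases lt_or_ge t 0 with h | h
    · rw [Set.indicator_of_mem (Set.mem_Ioi.2 h),
        Set.indicator_of_mem (Set.mem_Ioi.2 (mul_neg_of_pos_of_neg hk h))]
    · rw [Set.indicator_of_notMem (fun hm => absurd (Set.mem_Ioi.1 hm) (not_lt.2 h))]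
      exact zero_le
  | succ d ih =>
    have := isProbabilityMeasure_canonicalLaw hc α d
    have := isProbabilityMeasure_canonicalLaw hc α' d
    rw [canonicalLaw_succ_Ioi hc, canonicalLaw_succ_Ioi hc]
    refine lintegral_mono_ae ?_
    filter_upwards [ae_pos_expMeasure hc] with e he
    have hke : k * e ≤ e := by nlinarith
    rcases lt_or_ge (t - e) (α d) with h | h
    · rw [setOf_lt_max_add_of_lt (t := k * t), measure_univ]
      · exact prob_le_one
      · have := hα d
        nlinarith
    · rw [setOf_lt_max_add_of_le h]
      refine (ih (t - e)).trans (measure_mono fun x hx => ?_)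
      have hx : k * (t - e) < x := hx
      have := le_max_left x (α' d : ℝ)
      change k * t < max x (α' d) + e
      linarith

lemma lintegral_ofReal_expMeasure {c : ℝ} (hc : 0 < c) :
    ENNReal.ofReal c * ∫⁻ e, ENNReal.ofReal e ∂(expMeasure c) = 1 := by
  have := isProbabilityMeasure_expMeasure hc
  have h := lintegral_expMeasure_eq_hazard hc (K := fun _ => 1) measurable_const
  simp only [lintegral_const, measure_univ, mul_one] at h
  rw [h]
  congr 2
  ext e
  rw [lintegral_indicator measurableSet_Ioc]
  simp

/-- The mean of the `d`-th departure time is at least the mean of `d` services. -/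
lemma le_lintegral_canonicalLaw {c : ℝ} (hc : 0 < c) (α : ℕ → ℝ≥0) (d : ℕ) :
    (d : ℝ≥0∞) / ENNReal.ofReal c ≤ ∫⁻ t in Set.Ioi (0 : ℝ), canonicalLaw c α d (Set.Ioi t) := by
  have hexp := isProbabilityMeasure_expMeasure hc
  have h1 : (d : ℝ≥0∞) / ENNReal.ofReal c ≤ ∫⁻ x, ENNReal.ofReal x ∂(canonicalLaw c α d) := by
    induction d with
    | zero => simp
    | succ d ih =>
      have := isProbabilityMeasure_canonicalLaw hc α d
      have hmean : ∫⁻ e, ENNReal.ofReal e ∂(expMeasure c) = (ENNReal.ofReal c)⁻¹ :=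
        ENNReal.eq_inv_of_mul_eq_one_left (by rw [mul_comm]; exact lintegral_ofReal_expMeasure hc)
      rw [canonicalLaw, lintegral_map ENNReal.measurable_ofReal (by fun_prop),
        lintegral_prod _ (by fun_prop)]
      calc ((d + 1 : ℕ) : ℝ≥0∞) / ENNReal.ofReal c
          = (d : ℝ≥0∞) / ENNReal.ofReal c + (ENNReal.ofReal c)⁻¹ := by
            rw [Nat.cast_add, ENNReal.add_div, Nat.cast_one, one_div]
        _ ≤ ∫⁻ x, ENNReal.ofReal x ∂(canonicalLaw c α d) +
            ∫⁻ _, (ENNReal.ofReal c)⁻¹ ∂(canonicalLaw c α d) := by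
            rw [lintegral_const, measure_univ, mul_one]
            gcongr
        _ = ∫⁻ x, (ENNReal.ofReal x + ∫⁻ e, ENNReal.ofReal e ∂(expMeasure c))
            ∂(canonicalLaw c α d) := by
            rw [hmean, lintegral_add_right _ measurable_const]
        _ ≤ _ := by
            refine lintegral_mono fun x => ?_
            calc ENNReal.ofReal x + ∫⁻ e, ENNReal.ofReal e ∂(expMeasure c)
                = ∫⁻ e, (ENNReal.ofReal x + ENNReal.ofReal e) ∂(expMeasure c) := by
                  rw [lintegral_add_left measurable_const, lintegral_const, measure_univ, mul_one]
              _ ≤ _ := by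
                  refine lintegral_mono_ae ?_
                  filter_upwards [ae_pos_expMeasure hc] with e he
                  rw [ENNReal.ofReal_add (le_max_of_le_right (α d).coe_nonneg) he.le]
                  gcongr
                  exact le_max_left _ _
  refine h1.trans (le_of_eq ?_)
  have h2 := lintegral_eq_lintegral_meas_lt (canonicalLaw c α d) (f := fun x : ℝ => max x 0)
    (Eventually.of_forall fun x => le_max_right _ _) (by fun_prop)
  have h3 : ∀ x : ℝ, ENNReal.ofReal (max x 0) = ENNReal.ofReal x := fun x => by
    rcases le_total x 0 with h | h <;> simp [h, ENNReal.ofReal_of_nonpos]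
  simp only [h3] at h2
  rw [h2]
  refine setLIntegral_congr_fun measurableSet_Ioi fun t ht => ?_
  have ht : 0 < t := ht
  congr 1
  ext x
  change t < max x 0 ↔ t < x
  simp [ht.not_gt]

lemma lintegral_exp_expMeasure {c θ : ℝ} (hc : 0 < c) (hθ : θ < c) :
    ∫⁻ e, ENNReal.ofReal (Real.exp (θ * e)) ∂(expMeasure c) = ENNReal.ofReal (c / (c - θ)) := by
  have hpos : 0 < c - θ := sub_pos.2 hθ
  have := isProbabilityMeasure_expMeasure hpos
  have h := lintegral_expMeasure (c := c - θ) (fun _ => 1) measurable_const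
  simp only [lintegral_const, measure_univ, mul_one] at h
  rw [lintegral_expMeasure _ (by fun_prop)]
  calc ∫⁻ x in Set.Ioi (0 : ℝ), ENNReal.ofReal (c * Real.exp (-(c * x))) *
        ENNReal.ofReal (Real.exp (θ * x))
      = ∫⁻ x in Set.Ioi (0 : ℝ), ENNReal.ofReal (c / (c - θ)) *
        ENNReal.ofReal ((c - θ) * Real.exp (-((c - θ) * x))) := by
        refine lintegral_congr fun x => ?_
        rw [← ENNReal.ofReal_mul (by positivity), ← ENNReal.ofReal_mul (by positivity)]
        congr 1
        rw [mul_assoc, ← Real.exp_add, ← mul_assoc, div_mul_cancel₀ _ hpos.ne']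
        congr 2
        ring
    _ = _ := by rw [lintegral_const_mul' _ _ ENNReal.ofReal_ne_top, ← h, mul_one]

/-- Chernoff bound for the canonical departure times, when the arrival times are controlled by
those of a queue with deterministic services of length `1 / (c - θ)`. -/
lemma canonicalLaw_Ioi_le_exp {c θ A : ℝ} (hc : 0 < c) (hθ : 0 < θ) (hθc : θ < c) (hA : 0 ≤ A)
    {α : ℕ → ℝ≥0} (hα : ∀ j : ℕ, α j ≤ A + j / (c - θ)) (d : ℕ) (t : ℝ) :
    canonicalLaw c α d (Set.Ioi t) ≤
      ENNReal.ofReal ((d + 1) * Real.exp (θ * (A + d / (c - θ) - t))) := by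
  have hexp := isProbabilityMeasure_expMeasure hc
  have hpos : 0 < c - θ := sub_pos.2 hθc
  have hγ : c / (c - θ) ≤ Real.exp (θ * (1 / (c - θ))) := by
    have := Real.add_one_le_exp (θ * (1 / (c - θ)))
    refine le_trans (le_of_eq ?_) this
    field_simp
    ring
  have hmgf : ∀ d : ℕ, ∫⁻ x, ENNReal.ofReal (Real.exp (θ * x)) ∂(canonicalLaw c α d) ≤
      ENNReal.ofReal ((d + 1) * Real.exp (θ * (A + d / (c - θ)))) := by
    intro d
    induction d with
    | zero =>
      rw [canonicalLaw, lintegral_dirac' _ (by fun_prop)]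
      refine ENNReal.ofReal_le_ofReal ?_
      simp only [mul_zero, Real.exp_zero, Nat.cast_zero, zero_add, zero_div, add_zero, one_mul]
      exact Real.one_le_exp (by positivity)
    | succ d ih =>
      have := isProbabilityMeasure_canonicalLaw hc α d
      rw [canonicalLaw, lintegral_map (by fun_prop) (by fun_prop), lintegral_prod _ (by fun_prop)]
      calc ∫⁻ x, ∫⁻ e, ENNReal.ofReal (Real.exp (θ * (max x (α d : ℝ) + e))) ∂(expMeasure c)
            ∂(canonicalLaw c α d)
          = ∫⁻ x, ENNReal.ofReal (Real.exp (θ * max x (α d : ℝ))) * ENNReal.ofReal (c / (c - θ))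
            ∂(canonicalLaw c α d) := by
            refine lintegral_congr fun x => ?_
            rw [← lintegral_exp_expMeasure hc hθc, ← lintegral_const_mul' _ _ ENNReal.ofReal_ne_top]
            refine lintegral_congr fun e => ?_
            rw [← ENNReal.ofReal_mul (Real.exp_nonneg _), ← Real.exp_add, mul_add]
        _ = (∫⁻ x, ENNReal.ofReal (Real.exp (θ * max x (α d : ℝ))) ∂(canonicalLaw c α d)) *
            ENNReal.ofReal (c / (c - θ)) := lintegral_mul_const' _ _ ENNReal.ofReal_ne_top
        _ ≤ (∫⁻ x, (ENNReal.ofReal (Real.exp (θ * x)) +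
              ENNReal.ofReal (Real.exp (θ * (A + d / (c - θ))))) ∂(canonicalLaw c α d)) *
            ENNReal.ofReal (Real.exp (θ * (1 / (c - θ)))) := by
            gcongr with x
            rcases max_cases x (α d : ℝ) with h | h
            · rw [h.1]; exact le_self_add
            · rw [h.1]
              refine le_trans (ENNReal.ofReal_le_ofReal (Real.exp_le_exp.2 ?_)) le_add_self
              exact mul_le_mul_of_nonneg_left (hα d) hθ.le
        _ ≤ (ENNReal.ofReal ((d + 1) * Real.exp (θ * (A + d / (c - θ)))) +
              ENNReal.ofReal (Real.exp (θ * (A + d / (c - θ))))) *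
            ENNReal.ofReal (Real.exp (θ * (1 / (c - θ)))) := by
            rw [lintegral_add_right _ measurable_const, lintegral_const, measure_univ, mul_one]
            gcongr
        _ = _ := by
            rw [← ENNReal.ofReal_add (by positivity) (by positivity),
              ← ENNReal.ofReal_mul (by positivity), ← add_one_mul, mul_assoc, ← Real.exp_add]
            congr 3
            · push_cast; ring
            · push_cast; ring
  have hmarkov := mul_meas_ge_le_lintegral (μ := canonicalLaw c α d)
    (f := fun x => ENNReal.ofReal (Real.exp (θ * x))) (by fun_prop)
    (ENNReal.ofReal (Real.exp (θ * t)))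
  have hsub : canonicalLaw c α d (Set.Ioi t) ≤ canonicalLaw c α d
      {x | ENNReal.ofReal (Real.exp (θ * t)) ≤ ENNReal.ofReal (Real.exp (θ * x))} := by
    refine measure_mono fun x hx => ENNReal.ofReal_le_ofReal (Real.exp_le_exp.2 ?_)
    have hx : t < x := hx
    nlinarith
  calc canonicalLaw c α d (Set.Ioi t)
      = ENNReal.ofReal (Real.exp (-(θ * t))) *
        (ENNReal.ofReal (Real.exp (θ * t)) * canonicalLaw c α d (Set.Ioi t)) := by
        rw [← mul_assoc, ← ENNReal.ofReal_mul (Real.exp_nonneg _), ← Real.exp_add]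
        simp
    _ ≤ ENNReal.ofReal (Real.exp (-(θ * t))) *
        ENNReal.ofReal ((d + 1) * Real.exp (θ * (A + d / (c - θ)))) := by
        gcongr
        exact (mul_le_mul_right hsub _).trans (hmarkov.trans (hmgf d))
    _ = _ := by
        rw [← ENNReal.ofReal_mul (Real.exp_nonneg _), mul_left_comm, ← Real.exp_add]
        congr 3
        ring

/-! ### Delays for fixed arrivals -/

/-- The mean delay of customer `d` in the canonical queue, which is the mean of the `(d+1)`-st
departure time minus the `(d+1)`-st arrival time, written as an integral of tail probabilities. -/
noncomputable def canonicalDelay (c : ℝ) (a : ℕ → ℝ≥0) (d : ℕ) : ℝ≥0∞ :=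
  ∫⁻ t in Set.Ioi (a d : ℝ), canonicalLaw c a (d + 1) (Set.Ioi t)

lemma volume_between (x : ℝ≥0) (y : ℝ≥0∞) :
    volume {t : ℝ | (x : ℝ) < t ∧ ENNReal.ofReal t < y} = y - x := by
  rcases eq_or_ne y ⊤ with rfl | hy
  · have : {t : ℝ | (x : ℝ) < t ∧ ENNReal.ofReal t < ⊤} = Set.Ioi (x : ℝ) := by
      ext t; simp
    rw [this, Real.volume_Ioi, ENNReal.top_sub_coe]
  · lift y to ℝ≥0 using hy
    have : {t : ℝ | (x : ℝ) < t ∧ ENNReal.ofReal t < y} = Set.Ioo (x : ℝ) y := by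
      ext t
      change (x : ℝ) < t ∧ ENNReal.ofReal t < y ↔ (x : ℝ) < t ∧ t < y
      refine and_congr_right fun h => ?_
      rw [← ENNReal.ofReal_coe_nnreal, ENNReal.ofReal_lt_ofReal_iff_of_nonneg
        (x.coe_nonneg.trans h.le)]
    rw [this, Real.volume_Ioo, ← ENNReal.ofReal_coe_nnreal, ← ENNReal.ofReal_coe_nnreal (p := x),
      ENNReal.ofReal_sub _ x.coe_nonneg]

lemma measurableSet_between (x : ℝ≥0) (y : ℝ≥0∞) :
    MeasurableSet {t : ℝ | (x : ℝ) < t ∧ ENNReal.ofReal t < y} :=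
  measurableSet_Ioi.inter (measurableSet_lt ENNReal.measurable_ofReal measurable_const)

open Classical in
lemma tsub_eq_lintegral (x : ℝ≥0) (y : ℝ≥0∞) :
    y - x = ∫⁻ t : ℝ, if (x : ℝ) < t ∧ ENNReal.ofReal t < y then 1 else 0 := by
  rw [← volume_between, ← lintegral_indicator_one (measurableSet_between x y)]
  refine lintegral_congr fun t => ?_
  simp [Set.indicator]

open Classical in
lemma sum_tsub_eq_lintegral (K : ℕ) (x : ℕ → ℝ≥0) (y : ℕ → ℝ≥0∞) :
    ∑ i ∈ Finset.range K, (y i - x i) =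
      ∫⁻ t : ℝ, (((Finset.range K).filter fun i => (x i : ℝ) < t ∧ ENNReal.ofReal t < y i).card :
        ℝ≥0∞) := by
  simp only [Finset.card_filter, Nat.cast_sum, Nat.cast_ite, Nat.cast_one, Nat.cast_zero]
  rw [lintegral_finsetSum]
  · exact Finset.sum_congr rfl fun i _ => tsub_eq_lintegral _ _
  · intro i _
    exact Measurable.ite (measurableSet_between _ _) measurable_const measurable_const

/-- The expectation of the time from `x` until `Y`, from the tails of `Y`. -/
lemma lintegral_tsub_eq {Ω : Type*} [MeasurableSpace Ω] {P : Measure Ω} [SFinite P] (x : ℝ≥0)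
    {Y : Ω → ℝ≥0∞} (hY : Measurable Y) :
    ∫⁻ ω, (Y ω - x) ∂P = ∫⁻ t in Set.Ioi (x : ℝ), P {ω | ENNReal.ofReal t < Y ω} := by
  classical
  simp only [tsub_eq_lintegral]
  rw [lintegral_lintegral_swap, ← lintegral_indicator measurableSet_Ioi]
  · refine lintegral_congr fun t => ?_
    by_cases ht : (x : ℝ) < t
    · rw [Set.indicator_of_mem (Set.mem_Ioi.2 ht),
        ← lintegral_indicator_one (measurableSet_lt measurable_const hY)]
      refine lintegral_congr fun ω => ?_
      simp [Set.indicator, ht]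
    · rw [Set.indicator_of_notMem (by simpa using ht)]
      simp [ht]
  · refine (Measurable.ite ?_ measurable_const measurable_const).aemeasurable
    exact (measurableSet_lt measurable_const measurable_snd).inter
      (measurableSet_lt measurable_snd.ennreal_ofReal (hY.comp measurable_fst))

namespace Scheme

variable {L n : ℕ} (s : Scheme L n)

lemma epoch_mono (ω : Sample n) : Monotone (s.epoch ω) :=
  monotone_nat_of_le_succ (s.epoch_le_succ ω)

/-- The total delay of the first `K` requests is at least the sum of the first `K` departure times
minus the sum of the first `K` arrival times. -/
lemma sum_epoch_sub_le_sum_delay {ω : Sample n} (hω : ω.Regular) (K : ℕ) :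
    ∑ d ∈ Finset.range K, (s.epoch ω (d + 1) - ω.arrival d) ≤
      ∑ i ∈ Finset.range K, s.start.delay ω i := by
  classical
  unfold StartRule.delay
  rw [sum_tsub_eq_lintegral, sum_tsub_eq_lintegral]
  refine lintegral_mono fun t => ?_
  refine Nat.cast_le.2 ?_
  -- the requests among the first `K` which have departed by time `t`
  set I := (Finset.range K).filter
    (fun i => (ω.arrival i : ℝ) < t ∧ ¬ ENNReal.ofReal t < s.start.departure ω i) with hI
  have hepoch : s.epoch ω I.card ≤ ENNReal.ofReal t :=
    s.epoch_le_of_forall fun i hi => not_lt.1 (Finset.mem_filter.1 hi).2.2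
  set A := (Finset.range K).filter (fun i => (ω.arrival i : ℝ) < t) with hA
  have h1 : (A.filter fun i => ENNReal.ofReal t < s.start.departure ω i).card + I.card =
      A.card := by
    rw [← Finset.card_filter_add_card_filter_not (s := A)
      (p := fun i => ENNReal.ofReal t < s.start.departure ω i), hI, hA, Finset.filter_filter,
      Finset.filter_filter]
  have h2 : (A.filter fun d => ENNReal.ofReal t < s.epoch ω (d + 1)).card ≤
      A.card - I.card := by
    obtain ⟨k, hk⟩ : ∃ k, A = Finset.range k := by
      refine ⟨A.card, ?_⟩
      have hlow : ∀ i ∈ A, ∀ j ≤ i, j ∈ A := by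
        intro i hi j hj
        simp only [hA, Finset.mem_filter, Finset.mem_range] at hi ⊢
        exact ⟨by omega, lt_of_le_of_lt (NNReal.coe_le_coe.2 (hω.arrival_mono hj)) hi.2⟩
      ext i
      rw [Finset.mem_range]
      constructor
      · intro hi
        have : Finset.range (i + 1) ⊆ A := fun j hj =>
          hlow i hi j (Nat.lt_succ_iff.1 (Finset.mem_range.1 hj))
        simpa using Finset.card_le_card this
      · intro hi
        by_contra hiA
        have : A ⊆ Finset.range i := by
          intro j hj
          rw [Finset.mem_range]
          by_contra hji
          exact hiA (hlow j hj i (not_lt.1 hji))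
        have := Finset.card_le_card this
        rw [Finset.card_range] at this
        omega
    have h3 : (A.filter fun d => ENNReal.ofReal t < s.epoch ω (d + 1)) ⊆
        A \ Finset.range I.card := by
      intro d hd
      rw [Finset.mem_filter] at hd
      rw [Finset.mem_sdiff, Finset.mem_range, not_lt]
      refine ⟨hd.1, ?_⟩
      by_contra hlt
      exact absurd ((s.epoch_mono ω (not_le.1 hlt)).trans hepoch) (not_le.2 hd.2)
    refine (Finset.card_le_card h3).trans (le_of_eq ?_)
    have hIA : I.card ≤ A.card := by omega
    rw [Finset.card_sdiff_of_subset, Finset.card_range]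
    rw [hk] at hIA ⊢
    rw [Finset.card_range] at hIA
    exact Finset.range_subset_range.2 hIA
  rw [hA, Finset.filter_filter] at h2 h1
  omega

/-- If request number `K'` arrives after time `T`, then up to time `T` the first `K` requests wait
no longer, in total, than the first `K'` departures lag behind the first `K'` arrivals. -/
lemma sum_delay_le {ω : Sample n} (hω : ω.Regular) {K K' : ℕ} {T : ℝ≥0} (hT : T < ω.arrival K') :
    ∑ i ∈ Finset.range K, s.start.delay ω i ≤
      ∑ d ∈ Finset.range K', (s.epoch ω (d + 1) - ω.arrival d) +
      ∑ i ∈ Finset.range K, (s.start.departure ω i - T) := by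
  classical
  unfold StartRule.delay
  rw [sum_tsub_eq_lintegral, sum_tsub_eq_lintegral, sum_tsub_eq_lintegral, ← lintegral_add_right]
  swap
  · simp only [Finset.card_filter, Nat.cast_sum, Nat.cast_ite, Nat.cast_one, Nat.cast_zero]
    refine Finset.measurable_sum _ fun i _ => ?_
    exact Measurable.ite (measurableSet_between _ _) measurable_const measurable_const
  refine lintegral_mono_ae ?_
  have hcount : (Set.range fun d => (s.epoch ω (d + 1)).toReal).Countable := Set.countable_range _
  filter_upwards [hcount.ae_notMem volume] with t ht
  rw [← Nat.cast_add]
  refine Nat.cast_le.2 ?_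
  rcases lt_or_ge (T : ℝ) t with hTt | hTt
  · refine le_add_left (Finset.card_le_card fun i hi => ?_)
    simp only [Finset.mem_filter] at hi ⊢
    exact ⟨hi.1, hTt, hi.2.2⟩
  refine le_add_right ?_
  set A := (Finset.range K').filter (fun i => (ω.arrival i : ℝ) < t) with hA
  set D := A.filter (fun i => s.start.departure ω i < ENNReal.ofReal t) with hD
  have hlow : ∀ i, (ω.arrival i : ℝ) < t → i ∈ A := by
    intro i hi
    rw [hA, Finset.mem_filter, Finset.mem_range]
    refine ⟨?_, hi⟩
    by_contra hle
    have h1 : ω.arrival K' ≤ ω.arrival i := hω.arrival_mono (not_lt.1 hle)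
    have h2 : (ω.arrival K' : ℝ) ≤ ω.arrival i := by exact_mod_cast h1
    have h3 : (T : ℝ) < ω.arrival K' := by exact_mod_cast hT
    linarith
  have h1 : ((Finset.range K).filter fun i => (ω.arrival i : ℝ) < t ∧
      ENNReal.ofReal t < s.start.departure ω i) ⊆ A \ D := by
    intro i hi
    rw [Finset.mem_filter] at hi
    rw [Finset.mem_sdiff]
    exact ⟨hlow i hi.2.1, fun h => absurd hi.2.2 (not_lt.2 (Finset.mem_filter.1 h).2.le)⟩
  have h2 : A \ Finset.range D.card ⊆ (Finset.range K').filter fun d =>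
      (ω.arrival d : ℝ) < t ∧ ENNReal.ofReal t < s.epoch ω (d + 1) := by
    intro d hd
    rw [Finset.mem_sdiff, Finset.mem_range, not_lt] at hd
    have hdA := Finset.mem_filter.1 hd.1
    have htpos : 0 < t := (ω.arrival d).coe_nonneg.trans_lt hdA.2
    refine Finset.mem_filter.2 ⟨hdA.1, hdA.2, ?_⟩
    by_contra hle
    rcases (not_lt.1 hle).lt_or_eq with h | h
    · obtain ⟨I, hI, hlt⟩ := (s.epoch_lt_iff (pos_of_gt h)).1 h
      have hID : I ⊆ D := by
        intro i hi
        have h3 := (s.arrival_lt_departure hω i).trans (hlt i hi)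
        rw [ENNReal.ofReal, ENNReal.coe_lt_coe, Real.lt_toNNReal_iff_coe_lt] at h3
        exact Finset.mem_filter.2 ⟨hlow i h3, hlt i hi⟩
      have := Finset.card_le_card hID
      omega
    · refine ht ⟨d, ?_⟩
      simp only [h]
      exact ENNReal.toReal_ofReal htpos.le
  refine (Finset.card_le_card h1).trans (le_trans ?_ (Finset.card_le_card h2))
  have hDA : D ⊆ A := Finset.filter_subset _ _
  rw [Finset.card_sdiff_of_subset hDA]
  have := Finset.le_card_sdiff (Finset.range D.card) A
  rwa [Finset.card_range] at this

/-- If request `i` is still in the system when request number `N` has not arrived yet, then fewer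
than `N` requests have departed. -/
lemma lt_min_epoch_departure {ω : Sample n} (hω : ω.Regular) {i N : ℕ} {t : ℝ≥0∞}
    (hiN : i < N) (ht : t < s.start.departure ω i) (hN : t < ω.arrival N) :
    t < min (s.epoch ω N) (s.start.departure ω i) := by
  refine lt_min ?_ ht
  refine lt_of_lt_of_le (lt_min ht hN) ?_
  by_contra hlt
  rw [not_le] at hlt
  obtain ⟨I, hI, h⟩ := (s.epoch_lt_iff (pos_of_gt hlt)).1 hlt
  have hsub : I ⊆ (Finset.range N).erase i := by
    intro k hk
    have hk' := lt_min_iff.1 (h k hk)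
    refine Finset.mem_erase.2 ⟨?_, Finset.mem_range.2 ?_⟩
    · rintro rfl; exact lt_irrefl _ hk'.1
    · by_contra hle
      refine absurd ((s.arrival_lt_departure hω k).trans hk'.2) (not_lt.2 ?_)
      exact ENNReal.coe_le_coe.2 (hω.arrival_mono (not_lt.1 hle))
  have := Finset.card_le_card hsub
  rw [Finset.card_erase_of_mem (Finset.mem_range.2 hiN), Finset.card_range] at this
  omega

section FixedArrivals

variable {a : ℕ → ℝ≥0} (ha : Monotone a) (ha' : Tendsto a atTop atTop) (u : unitInterval)
  {mu : ℝ} (hmu : 0 < mu)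
include ha ha' hmu

/-- The total delay of the first `K` requests, under any scheme. -/
theorem sum_canonicalDelay_le (hL : 1 ≤ L) (K : ℕ) :
    ∑ d ∈ Finset.range K, canonicalDelay (L * mu) a d ≤
      ∫⁻ X, ∑ i ∈ Finset.range K, s.start.delay (realization a u X) i ∂(downloadLaw _ mu) := by
  have := isProbabilityMeasure_downloadLaw (ι := ℕ × Fin n) hmu
  have hmeas := s.measurable_epoch_realization (a := a) u
  calc ∑ d ∈ Finset.range K, canonicalDelay (L * mu) a d
      ≤ ∑ d ∈ Finset.range K, ∫⁻ X, (s.epoch (realization a u X) (d + 1) - a d)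
        ∂(downloadLaw _ mu) := by
        refine Finset.sum_le_sum fun d _ => ?_
        rw [lintegral_tsub_eq _ (hmeas (d + 1))]
        refine setLIntegral_mono' measurableSet_Ioi fun t ht => ?_
        exact s.canonicalLaw_le_epoch ha ha' u hmu hL (d + 1) t ((a d).coe_nonneg.trans ht.le)
    _ = ∫⁻ X, ∑ d ∈ Finset.range K, (s.epoch (realization a u X) (d + 1) - a d)
        ∂(downloadLaw _ mu) := by
        rw [lintegral_finsetSum]
        exact fun d _ => (hmeas (d + 1)).sub measurable_const
    _ ≤ _ := by
        refine lintegral_mono_ae ?_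
        filter_upwards [ae_pos_downloadLaw hmu] with X hX
        exact s.sum_epoch_sub_le_sum_delay (regular_realization ha ha' u hX) K

/-- The total delay of the first `K` requests, under a work-conserving scheme, when request number
`K'` arrives after time `T`. -/
theorem WorkConserving.lintegral_sum_delay_le {s : Scheme L n} (hs : s.WorkConserving)
    (hL : 1 ≤ L) {K K' : ℕ} {T : ℝ≥0} (hT : T < a K') :
    ∫⁻ X, ∑ i ∈ Finset.range K, s.start.delay (realization a u X) i ∂(downloadLaw _ mu) ≤
      ∑ d ∈ Finset.range K', canonicalDelay (L * mu) a d +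
      ∑ i ∈ Finset.range K, ∫⁻ t in Set.Ioi (T : ℝ), downloadLaw _ mu
        {X | ENNReal.ofReal t < s.start.departure (realization a u X) i} := by
  have := isProbabilityMeasure_downloadLaw (ι := ℕ × Fin n) hmu
  have hmeas := s.measurable_epoch_realization (a := a) u
  have hdep : ∀ i, Measurable fun X => s.start.departure (realization a u X) i :=
    fun i => (s.measurable_departure i).comp (measurable_realization a u)
  calc ∫⁻ X, ∑ i ∈ Finset.range K, s.start.delay (realization a u X) i ∂(downloadLaw _ mu)
      ≤ ∫⁻ X, (∑ d ∈ Finset.range K', (s.epoch (realization a u X) (d + 1) - a d) +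
          ∑ i ∈ Finset.range K, (s.start.departure (realization a u X) i - T))
          ∂(downloadLaw _ mu) := by
        refine lintegral_mono_ae ?_
        filter_upwards [ae_pos_downloadLaw hmu] with X hX
        exact s.sum_delay_le (regular_realization ha ha' u hX) hT
    _ = ∑ d ∈ Finset.range K', ∫⁻ X, (s.epoch (realization a u X) (d + 1) - a d)
          ∂(downloadLaw _ mu) +
        ∑ i ∈ Finset.range K, ∫⁻ X, (s.start.departure (realization a u X) i - T)
          ∂(downloadLaw _ mu) := by
        rw [lintegral_add_right, lintegral_finsetSum, lintegral_finsetSum]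
        · exact fun i _ => (hdep i).sub measurable_const
        · exact fun d _ => (hmeas (d + 1)).sub measurable_const
        · exact Finset.measurable_sum _ fun i _ => (hdep i).sub measurable_const
    _ ≤ _ := by
        gcongr with d hd i hi
        · rw [lintegral_tsub_eq _ (hmeas (d + 1))]
          refine setLIntegral_mono' measurableSet_Ioi fun t ht => ?_
          exact hs.epoch_le ha ha' u hmu hL (d + 1) t ((a d).coe_nonneg.trans ht.le)
        · rw [lintegral_tsub_eq _ (hdep i)]

omit ha ha' in
/-- A crude bound on the total delay: requests depart by time `R`, except for the tails of the
departure times beyond `R`. -/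
lemma lintegral_sum_delay_le_mul (K : ℕ) (R : ℝ≥0) :
    ∫⁻ X, ∑ i ∈ Finset.range K, s.start.delay (realization a u X) i ∂(downloadLaw _ mu) ≤
      K * R + ∑ i ∈ Finset.range K, ∫⁻ t in Set.Ioi (R : ℝ), downloadLaw _ mu
        {X | ENNReal.ofReal t < s.start.departure (realization a u X) i} := by
  have := isProbabilityMeasure_downloadLaw (ι := ℕ × Fin n) hmu
  have hdep : ∀ i, Measurable fun X => s.start.departure (realization a u X) i :=
    fun i => (s.measurable_departure i).comp (measurable_realization a u)
  rw [lintegral_finsetSum]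
  · calc ∑ i ∈ Finset.range K, ∫⁻ X, s.start.delay (realization a u X) i ∂(downloadLaw _ mu)
        ≤ ∑ i ∈ Finset.range K, ∫⁻ X, (R + (s.start.departure (realization a u X) i - R))
          ∂(downloadLaw _ mu) := by
          gcongr with i hi X
          exact tsub_le_self.trans le_add_tsub
      _ = _ := by
          simp only [lintegral_add_left measurable_const, lintegral_const, measure_univ, mul_one,
            Finset.sum_add_distrib, Finset.sum_const, Finset.card_range, nsmul_eq_mul]
          congr 1
          exact Finset.sum_congr rfl fun i _ => lintegral_tsub_eq _ (hdep i)
  · exact fun i _ => (hdep i).sub (measurable_const (a := (a i : ℝ≥0∞)))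

/-- The tails of the departure times of a work-conserving scheme: at time `t`, before the arrival
of request number `N`, a request that came until time `T ≤ t` is likely to have departed. -/
theorem WorkConserving.departure_tail_le {s : Scheme L n} (hs : s.WorkConserving)
    (hL : 1 ≤ L) {i N : ℕ} {T : ℝ≥0} (hi : a i ≤ T) {t : ℝ} (ht : (T : ℝ) ≤ t)
    (hN : t < a N) :
    downloadLaw _ mu {X | ENNReal.ofReal t < s.start.departure (realization a u X) i} ≤
      canonicalLaw (L * mu) (fun j => min (a j) T) N (Set.Ioi t) := by
  have hc : 0 < (L : ℝ) * mu := by positivity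
  have ht0 : 0 ≤ t := T.coe_nonneg.trans ht
  have hiN : i < N := by
    by_contra h
    have h1 : (a N : ℝ) ≤ a i := by exact_mod_cast ha (not_lt.1 h)
    have h2 : (a i : ℝ) ≤ T := by exact_mod_cast hi
    linarith
  calc downloadLaw _ mu {X | ENNReal.ofReal t < s.start.departure (realization a u X) i}
      ≤ downloadLaw _ mu {X | ENNReal.ofReal t < min (s.epoch (realization a u X) N)
        (s.start.departure (realization a u X) i)} := by
        refine measure_mono_ae ?_
        filter_upwards [ae_pos_downloadLaw hmu] with X hX hXt
        refine s.lt_min_epoch_departure (regular_realization ha ha' u hX) hiN hXt ?_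
        change ENNReal.ofReal t < (a N : ℝ≥0∞)
        rw [← ENNReal.ofReal_coe_nnreal, ENNReal.ofReal_lt_ofReal_iff_of_nonneg ht0]
        exact hN
    _ ≤ canonicalLaw (L * mu) (fun j => min (a j) (a i)) N (Set.Ioi t) :=
        hs.min_epoch_departure_le ha ha' u hmu hL i N t ht0
    _ ≤ canonicalLaw (L * mu) (fun j => min (a j) T) N (Set.Ioi (1 * t)) := by
        refine canonicalLaw_Ioi_le_of_scale hc one_pos le_rfl (fun j => ?_) N t
        rw [one_mul]
        exact_mod_cast min_le_min_left (a j) hi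
    _ = _ := by rw [one_mul]

end FixedArrivals

end Scheme

/-! ### Average delays -/

/-- The number of the arrival times `a i` which are at most `T`: this is `Sample.numArrivals`, as a
function of the arrival times only. -/
noncomputable def arrivalCount (a : ℕ → ℝ≥0) (T : ℝ≥0) : ℕ := {i | a i ≤ T}.ncard

lemma lt_arrivalCount_iff {a : ℕ → ℝ≥0} (ha : Monotone a) (ha' : Tendsto a atTop atTop)
    {T : ℝ≥0} {i : ℕ} : i < arrivalCount a T ↔ a i ≤ T := by
  have hfin : {i | a i ≤ T}.Finite := by
    obtain ⟨N, hN⟩ := (ha'.eventually (eventually_gt_atTop T)).exists_forall_of_atTop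
    refine (Set.finite_lt_nat N).subset fun i hi => ?_
    by_contra h
    exact absurd (hN i (not_lt.1 h)) (not_lt.2 hi)
  have hnc := Set.ncard_eq_toFinset_card _ hfin
  unfold arrivalCount
  constructor
  · intro h
    by_contra hlt
    have hsub : hfin.toFinset ⊆ Finset.range i := by
      intro j hj
      rw [Set.Finite.mem_toFinset] at hj
      rw [Finset.mem_range]
      by_contra hji
      exact hlt ((ha (not_lt.1 hji)).trans hj)
    have := Finset.card_le_card hsub
    rw [Finset.card_range] at this
    omega
  · intro h
    have hsub : Finset.range (i + 1) ⊆ hfin.toFinset := by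
      intro j hj
      rw [Set.Finite.mem_toFinset]
      exact (ha (Nat.lt_succ_iff.1 (Finset.mem_range.1 hj))).trans h
    have := Finset.card_le_card hsub
    rw [Finset.card_range] at this
    omega

lemma measurable_arrivalCount (T : ℝ≥0) : Measurable fun a => arrivalCount a T := by
  have hpos : ∀ k : ℕ, k ≠ 0 → MeasurableSet {a : ℕ → ℝ≥0 | arrivalCount a T = k} := by
    intro k hk
    have : {a : ℕ → ℝ≥0 | arrivalCount a T = k} =
        ⋃ I ∈ {I : Finset ℕ | I.card = k}, ⋂ i : ℕ, {a | a i ≤ T ↔ i ∈ I} := by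
      ext a
      simp only [Set.mem_ofPred_eq, Set.mem_iUnion, Set.mem_iInter, arrivalCount, exists_prop]
      constructor
      · intro h
        have hfin : {i | a i ≤ T}.Finite := Set.finite_of_ncard_ne_zero (h ▸ hk)
        exact ⟨hfin.toFinset, by rw [← h, Set.ncard_eq_toFinset_card _ hfin], fun i => by simp⟩
      · rintro ⟨I, hI, h⟩
        have : {i | a i ≤ T} = (I : Set ℕ) := by ext i; simpa using h i
        rw [this, Set.ncard_coe_finset, hI]
    rw [this]
    refine MeasurableSet.biUnion (Set.to_countable _) fun I _ => MeasurableSet.iInter fun i => ?_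
    have hm : MeasurableSet {a : ℕ → ℝ≥0 | a i ≤ T} :=
      measurableSet_le (measurable_pi_apply i) measurable_const
    by_cases hi : i ∈ I
    · simpa [hi] using hm
    · have : {a : ℕ → ℝ≥0 | a i ≤ T ↔ i ∈ I} = {a : ℕ → ℝ≥0 | a i ≤ T}ᶜ := by
        ext a; simp [hi]
      rw [this]
      exact hm.compl
  refine measurable_to_countable' fun k => ?_
  by_cases hk : k = 0
  · have : (fun a => arrivalCount a T) ⁻¹' {k} =
        (⋃ j ∈ {j : ℕ | j ≠ 0}, {a : ℕ → ℝ≥0 | arrivalCount a T = j})ᶜ := by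
      ext a
      simp only [hk, Set.mem_preimage, Set.mem_singleton_iff, Set.mem_compl_iff, Set.mem_iUnion,
        Set.mem_ofPred_eq, not_exists]
      exact ⟨fun h i hi h' => hi (h'.symm.trans h), fun h => by_contra fun hne => h _ hne rfl⟩
    rw [this]
    exact (MeasurableSet.biUnion (Set.to_countable _) fun j hj => hpos j hj).compl
  · exact hpos k hk

lemma measurable_div_rate (lam : ℝ≥0) : Measurable fun (a : ℕ → ℝ≥0) i => a i / lam := by
  rw [measurable_pi_iff]
  intro i
  have h : Measurable fun a : ℕ → ℝ≥0 => a i := measurable_pi_apply i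
  exact h.div_const lam

lemma measurable_div_sum_range {Ω : Type*} [MeasurableSpace Ω] {N : Ω → ℕ} {f : Ω → ℕ → ℝ≥0∞}
    (hN : Measurable N) (hf : ∀ i, Measurable fun ω => f ω i) :
    Measurable fun ω => (∑ i ∈ Finset.range (N ω), f ω i) / (N ω : ℝ≥0∞) := by
  have h1 : Measurable fun z : ℕ × Ω =>
      (∑ i ∈ Finset.range z.1, f z.2 i) / (z.1 : ℝ≥0∞) := by
    refine measurable_from_prod_countable_right fun k => ?_
    have h : Measurable fun ω => ∑ i ∈ Finset.range k, f ω i :=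
      Finset.measurable_sum _ fun i _ => hf i
    exact h.div_const (k : ℝ≥0∞)
  exact h1.comp (hN.prodMk measurable_id)

namespace Scheme

variable {L n : ℕ} (s : Scheme L n)

lemma measurable_delay (i : ℕ) : Measurable fun ω => s.start.delay ω i := by
  unfold StartRule.delay
  refine (s.measurable_departure i).sub (measurable_coe_nnreal_ennreal.comp ?_)
  exact (measurable_pi_apply i).comp measurable_fst

lemma measurable_average_delay (T : ℝ≥0) : Measurable fun ω : Sample n =>
    (∑ i ∈ Finset.range (ω.numArrivals T), s.start.delay ω i) / (ω.numArrivals T : ℝ≥0∞) := by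
  have h2 : Measurable fun ω : Sample n => ω.numArrivals T :=
    (measurable_arrivalCount T).comp measurable_fst
  exact measurable_div_sum_range h2 fun i => s.measurable_delay i

/-- The mean, for the fixed arrival times `a`, of the average delay of the requests that arrive
until time `T`. -/
noncomputable def meanDelay (mu : ℝ) (a : ℕ → ℝ≥0) (T : ℝ≥0) : ℝ≥0∞ :=
  ∫⁻ z, (∑ i ∈ Finset.range (arrivalCount a T), s.start.delay ((a, z) : Sample n) i) /
    (arrivalCount a T : ℝ≥0∞) ∂((downloadLaw (ℕ × Fin n) mu).prod (volume : Measure unitInterval))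

variable {mu : ℝ} (hmu : 0 < mu)
include hmu

lemma measurable_meanDelay (T : ℝ≥0) : Measurable fun a => s.meanDelay mu a T := by
  have := isProbabilityMeasure_downloadLaw (ι := ℕ × Fin n) hmu
  exact (s.measurable_average_delay T).lintegral_prod_right'

lemma expectedDelay_atRate (lam : ℝ≥0) (ν : Measure (ℕ → ℝ≥0)) [SFinite ν] :
    expectedDelay mu (atRate lam ν) s =
      limsup (fun T : ℝ≥0 => ∫⁻ a, s.meanDelay mu (fun i => a i / lam) T ∂ν) atTop := by
  have := isProbabilityMeasure_downloadLaw (ι := ℕ × Fin n) hmu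
  unfold expectedDelay
  congr 1
  ext T
  have hlaw : sampleLaw n mu (atRate lam ν) = (atRate lam ν).prod
    ((downloadLaw (ℕ × Fin n) mu).prod (volume : Measure unitInterval)) := rfl
  have : SFinite (atRate lam ν) := by unfold atRate; infer_instance
  rw [hlaw, lintegral_prod _ (s.measurable_average_delay T).aemeasurable, atRate,
    lintegral_map _ (measurable_div_rate lam)]
  · rfl
  · exact (s.measurable_average_delay T).lintegral_prod_right'

lemma meanDelay_eq (a : ℕ → ℝ≥0) (T : ℝ≥0) :
    s.meanDelay mu a T = ∫⁻ u : unitInterval, (∫⁻ X, ∑ i ∈ Finset.range (arrivalCount a T),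
      s.start.delay (realization a u X) i ∂(downloadLaw _ mu)) / (arrivalCount a T : ℝ≥0∞) := by
  have := isProbabilityMeasure_downloadLaw (ι := ℕ × Fin n) hmu
  have hm : Measurable fun z : (ℕ × Fin n → ℝ≥0) × unitInterval =>
      ∑ i ∈ Finset.range (arrivalCount a T), s.start.delay ((a, z) : Sample n) i :=
    Finset.measurable_sum _ fun i _ => (s.measurable_delay i).comp measurable_prodMk_left
  unfold meanDelay
  rw [lintegral_prod_symm' _ (hm.div_const _)]
  refine lintegral_congr fun u => ?_
  simp only [div_eq_mul_inv]
  exact lintegral_mul_const _ (hm.comp measurable_prodMk_right)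

lemma meanDelay_le {a : ℕ → ℝ≥0} {T : ℝ≥0} {B : ℝ≥0∞}
    (h : ∀ u, (∫⁻ X, ∑ i ∈ Finset.range (arrivalCount a T),
      s.start.delay (realization a u X) i ∂(downloadLaw _ mu)) / (arrivalCount a T : ℝ≥0∞) ≤ B) :
    s.meanDelay mu a T ≤ B := by
  rw [s.meanDelay_eq hmu]
  refine (lintegral_mono h).trans ?_
  simp

lemma le_meanDelay {a : ℕ → ℝ≥0} {T : ℝ≥0} {B : ℝ≥0∞}
    (h : ∀ u, B ≤ (∫⁻ X, ∑ i ∈ Finset.range (arrivalCount a T),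
      s.start.delay (realization a u X) i ∂(downloadLaw _ mu)) / (arrivalCount a T : ℝ≥0∞)) :
    B ≤ s.meanDelay mu a T := by
  rw [s.meanDelay_eq hmu]
  refine le_trans ?_ (lintegral_mono h)
  simp

end Scheme

/-- The average of the first `K` canonical delays. -/
noncomputable def meanCanonicalDelay (c : ℝ) (a : ℕ → ℝ≥0) (K : ℕ) : ℝ≥0∞ :=
  (∑ d ∈ Finset.range K, canonicalDelay c a d) / (K : ℝ≥0∞)

/-- The average canonical delay bounds the average delay of any scheme from below. -/
theorem Scheme.meanCanonicalDelay_le {L n : ℕ} (s : Scheme L n) (hL : 1 ≤ L) {mu : ℝ}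
    (hmu : 0 < mu) {a : ℕ → ℝ≥0} (ha : Monotone a) (ha' : Tendsto a atTop atTop) (T : ℝ≥0) :
    meanCanonicalDelay (L * mu) a (arrivalCount a T) ≤ s.meanDelay mu a T := by
  refine s.le_meanDelay hmu fun u => ?_
  unfold meanCanonicalDelay
  gcongr
  exact s.sum_canonicalDelay_le ha ha' u hmu hL _

lemma canonicalDelay_le_of_scale {c : ℝ} (hc : 0 < c) {a a' : ℕ → ℝ≥0} {k : ℝ≥0} (hk : 0 < k)
    (hk1 : k ≤ 1) (h : ∀ i, a' i = k * a i) (d : ℕ) :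
    canonicalDelay c a d ≤ (k : ℝ≥0∞)⁻¹ * canonicalDelay c a' d := by
  have hk' : (0 : ℝ) < k := hk
  unfold canonicalDelay
  calc ∫⁻ t in Set.Ioi (a d : ℝ), canonicalLaw c a (d + 1) (Set.Ioi t)
      ≤ ∫⁻ t in Set.Ioi (a d : ℝ), canonicalLaw c a' (d + 1) (Set.Ioi (k * t)) := by
        refine lintegral_mono fun t => ?_
        refine canonicalLaw_Ioi_le_of_scale hc hk' (by exact_mod_cast hk1) (fun j => ?_) _ _
        rw [h]; push_cast; exact le_rfl
    _ = ∫⁻ t : ℝ, (Set.Ioi (a' d : ℝ)).indicator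
          (fun t => canonicalLaw c a' (d + 1) (Set.Ioi t)) (k * t) := by
        rw [← lintegral_indicator measurableSet_Ioi]
        refine lintegral_congr fun t => ?_
        have : (a' d : ℝ) < k * t ↔ (a d : ℝ) < t := by
          rw [h]; push_cast
          exact mul_lt_mul_iff_right₀ hk'
        simp only [Set.indicator, Set.mem_Ioi, this]
    _ = (k : ℝ≥0∞)⁻¹ * ∫⁻ t : ℝ, (Set.Ioi (a' d : ℝ)).indicator
          (fun t => canonicalLaw c a' (d + 1) (Set.Ioi t)) t := by
        have hm : Measurable ((Set.Ioi (a' d : ℝ)).indicator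
            (fun t => canonicalLaw c a' (d + 1) (Set.Ioi t))) := by
          refine Measurable.indicator ?_ measurableSet_Ioi
          have : Antitone fun t : ℝ => canonicalLaw c a' (d + 1) (Set.Ioi t) :=
            fun x y hxy => measure_mono (Set.Ioi_subset_Ioi hxy)
          exact this.measurable
        rw [← lintegral_map hm (measurable_const_mul (k : ℝ)), Real.map_volume_mul_left hk'.ne',
          lintegral_smul_measure, abs_of_pos (inv_pos.2 hk'), ENNReal.ofReal_inv_of_pos hk',
          ENNReal.ofReal_coe_nnreal, smul_eq_mul]
    _ = _ := by rw [lintegral_indicator measurableSet_Ioi]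

lemma meanCanonicalDelay_le_of_scale {c : ℝ} (hc : 0 < c) {a a' : ℕ → ℝ≥0} {k : ℝ≥0} (hk : 0 < k)
    (hk1 : k ≤ 1) (h : ∀ i, a' i = k * a i) (K : ℕ) :
    meanCanonicalDelay c a K ≤ (k : ℝ≥0∞)⁻¹ * meanCanonicalDelay c a' K := by
  unfold meanCanonicalDelay
  rw [← mul_div_assoc, Finset.mul_sum]
  gcongr with d hd
  exact canonicalDelay_le_of_scale hc hk hk1 h d

/-- Beyond the service rate the average canonical delay is unbounded. -/
lemma tendsto_meanCanonicalDelay_atTop {c : ℝ} (hc : 0 < c) {a : ℕ → ℝ≥0} {x : ℝ}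
    (hx : x < 1 / c) (ha : ∀ᶠ d : ℕ in atTop, (a d : ℝ) ≤ x * d) :
    Tendsto (meanCanonicalDelay c a) atTop (𝓝 ⊤) := by
  have h1 : ∀ d : ℕ, ENNReal.ofReal (d / c) ≤ a d + canonicalDelay c a d := by
    intro d
    have hsplit : Set.Ioi (0 : ℝ) = Set.Ioc 0 (a d : ℝ) ∪ Set.Ioi (a d : ℝ) :=
      (Set.Ioc_union_Ioi_eq_Ioi (a d).coe_nonneg).symm
    have := isProbabilityMeasure_canonicalLaw hc a (d + 1)
    calc ENNReal.ofReal (d / c) ≤ ((d + 1 : ℕ) : ℝ≥0∞) / ENNReal.ofReal c := by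
          rw [ENNReal.ofReal_div_of_pos hc, ENNReal.ofReal_natCast]
          gcongr
          simp
      _ ≤ ∫⁻ t in Set.Ioi (0 : ℝ), canonicalLaw c a (d + 1) (Set.Ioi t) :=
          le_lintegral_canonicalLaw hc a (d + 1)
      _ ≤ (∫⁻ t in Set.Ioc 0 (a d : ℝ), canonicalLaw c a (d + 1) (Set.Ioi t)) +
          canonicalDelay c a d := by
          rw [hsplit, canonicalDelay]
          exact lintegral_union_le _ _ _
      _ ≤ _ := by
          refine add_le_add ?_ le_rfl
          refine (lintegral_mono (g := fun _ => 1) fun t => prob_le_one).trans ?_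
          simp
  have h2 : ∀ᶠ d : ℕ in atTop, ENNReal.ofReal ((1 / c - x) * d) ≤ canonicalDelay c a d := by
    filter_upwards [ha] with d hd
    refine (ENNReal.add_le_add_iff_left (a := (a d : ℝ≥0∞)) ENNReal.coe_ne_top).1 ?_
    refine le_trans ?_ (h1 d)
    rw [← ENNReal.ofReal_coe_nnreal, ← ENNReal.ofReal_add (a d).coe_nonneg
      (mul_nonneg (sub_nonneg.2 hx.le) (Nat.cast_nonneg d))]
    refine ENNReal.ofReal_le_ofReal ?_
    have : (d : ℝ) / c = 1 / c * d := by ring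
    rw [this]; nlinarith
  have h3 : Tendsto (fun d : ℕ => ENNReal.ofReal ((1 / c - x) * d)) atTop (𝓝 ⊤) := by
    refine ENNReal.tendsto_ofReal_atTop.comp ?_
    exact (tendsto_natCast_atTop_atTop).const_mul_atTop (sub_pos.2 hx)
  rw [ENNReal.tendsto_nhds_top_iff_nat]
  intro B
  have h4 := (ENNReal.tendsto_nhds_top_iff_nat.1 h3 (2 * (B + 1)))
  obtain ⟨D, hD⟩ := (h2.and h4).exists_forall_of_atTop
  filter_upwards [eventually_ge_atTop (2 * D + 1)] with K hK
  have hK0 : (K : ℝ≥0∞) ≠ 0 := by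
    rw [Nat.cast_ne_zero]; omega
  have hsum : ((K - D : ℕ) : ℝ≥0∞) * ((2 * (B + 1) : ℕ) : ℝ≥0∞) ≤
      ∑ d ∈ Finset.range K, canonicalDelay c a d := by
    calc ((K - D : ℕ) : ℝ≥0∞) * ((2 * (B + 1) : ℕ) : ℝ≥0∞)
        = ∑ d ∈ Finset.Ico D K, ((2 * (B + 1) : ℕ) : ℝ≥0∞) := by simp
      _ ≤ ∑ d ∈ Finset.Ico D K, canonicalDelay c a d := by
          refine Finset.sum_le_sum fun d hd => ?_
          have := hD d (Finset.mem_Ico.1 hd).1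
          have h5 := this.2.le.trans this.1
          exact_mod_cast h5
      _ ≤ _ := Finset.sum_le_sum_of_subset fun d hd => by
          rw [Finset.mem_Ico] at hd
          exact Finset.mem_range.2 hd.2
  unfold meanCanonicalDelay
  rw [ENNReal.lt_div_iff_mul_lt (Or.inl hK0) (Or.inl (ENNReal.natCast_ne_top K))]
  refine lt_of_lt_of_le ?_ hsum
  rw [← Nat.cast_mul, ← Nat.cast_mul, Nat.cast_lt]
  have : K + 1 ≤ 2 * (K - D) := by omega
  nlinarith

/-! ### Arrivals close to their rate -/

lemma tendsto_atTop_of_rate_one {a : ℕ → ℝ≥0}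
    (h : Tendsto (fun i : ℕ => (a i : ℝ) / i) atTop (𝓝 1)) {lam : ℝ≥0} (hlam : 0 < lam) :
    Tendsto (fun i => a i / lam) atTop atTop := by
  have h1 : Tendsto (fun i : ℕ => (a i : ℝ) / i * i) atTop atTop :=
    h.pos_mul_atTop one_pos tendsto_natCast_atTop_atTop
  have h2 : Tendsto (fun i : ℕ => (a i : ℝ)) atTop atTop := by
    refine h1.congr' ?_
    filter_upwards [eventually_gt_atTop 0] with i hi
    have : (i : ℝ) ≠ 0 := by positivity
    field_simp
  have h3 : Tendsto (fun i => (a i : ℝ) / lam) atTop atTop :=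
    h2.atTop_div_const (by exact_mod_cast hlam)
  rw [← NNReal.tendsto_coe_atTop]
  simpa using h3

lemma monotone_div {a : ℕ → ℝ≥0} (ha : Monotone a) (lam : ℝ≥0) :
    Monotone fun i => a i / lam := fun _ _ hij => div_le_div_of_nonneg_right (ha hij) (zero_le)

/-- A choice of the precision `η` of the arrival rate and of a margin `ζ`. The number
`2 * lam / (c + lam) < 1` is the load of a server with the intermediate rate `(c + lam) / 2`. By the
second inequality such a server clears the arrivals before `T` by the time `(1 + δ) * T`, with the
margin `ζ` per unit of time; by the third one the number of the arrivals until `(1 + δ) * T` is at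
most `1 + 2 * δ` times that until `T`. -/
lemma exists_precision {c lam δ : ℝ} (hlam : 0 < lam) (hc : lam < c) (hδ : 0 < δ) :
    ∃ ζ > 0, ∃ η > 0, η < 1 / 2 ∧
      (1 - 2 / (c + lam) * lam / (1 + η)) / (1 + δ) + 2 / (c + lam) * lam / (1 - η) - 1 ≤ -ζ ∧
      (1 + η) * (η / lam + (1 + δ) / (1 - η)) ≤ 1 + 2 * δ ∧
      6 * (2 / (c + lam)) / ζ * η ≤ 1 ∧ η * (1 + η) ≤ lam := by
  set q := 2 / (c + lam) with hq
  have hr : q * lam < 1 := by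
    rw [hq, div_mul_eq_mul_div, div_lt_one (by linarith)]; linarith
  -- at `η = 0` the left-hand side of the second inequality equals `-(2 * ζ)`, and the other
  -- inequalities are strict, so all of them hold for small `η`
  set ζ := (1 - q * lam) * δ / (1 + δ) / 2 with hζ
  have hζ0 : 0 < ζ := by
    have : 0 < 1 - q * lam := by linarith
    positivity
  refine ⟨ζ, hζ0, ?_⟩
  have key : ∀ (f : ℝ → ℝ) (y : ℝ), ContinuousAt f 0 → f 0 < y → ∀ᶠ η in 𝓝[>] (0 : ℝ), f η ≤ y :=
    fun f y hf hy => ((hf.tendsto.eventually (gt_mem_nhds hy)).filter_mono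
      nhdsWithin_le_nhds).mono fun _ h => le_of_lt h
  have e1 := key (fun η => (1 - q * lam / (1 + η)) / (1 + δ) + q * lam / (1 - η) - 1) (-ζ)
    (by
      refine ContinuousAt.sub (ContinuousAt.add ?_ ?_) continuousAt_const
      · refine ContinuousAt.div_const (ContinuousAt.sub continuousAt_const ?_) _
        exact ContinuousAt.div continuousAt_const (by fun_prop) (by norm_num)
      · exact ContinuousAt.div continuousAt_const (by fun_prop) (by norm_num))
    (by
      have : (1 - q * lam / (1 + 0)) / (1 + δ) + q * lam / (1 - 0) - 1 = -(2 * ζ) := by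
        rw [hζ]; field_simp; ring
      rw [this]; linarith)
  have e2 := key (fun η => (1 + η) * (η / lam + (1 + δ) / (1 - η))) (1 + 2 * δ)
    (by
      refine ContinuousAt.mul (by fun_prop) (ContinuousAt.add (by fun_prop) ?_)
      exact ContinuousAt.div continuousAt_const (by fun_prop) (by norm_num))
    (by norm_num; linarith)
  have e3 := key (fun η => 6 * q / ζ * η) 1 (by fun_prop) (by norm_num)
  have e4 := key (fun η => η * (1 + η)) lam (by fun_prop) (by simpa using hlam)
  have e5 : ∀ᶠ η in 𝓝[>] (0 : ℝ), η < 1 / 2 :=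
    (gt_mem_nhds (by norm_num : (0 : ℝ) < 1 / 2)).filter_mono nhdsWithin_le_nhds
  obtain ⟨η, ⟨⟨⟨⟨⟨h1, h2⟩, h3⟩, h4⟩, h5⟩, h6⟩⟩ :=
    (((((e1.and e2).and e3).and e4).and e5).and self_mem_nhdsWithin).exists
  exact ⟨η, h6, h5, h1, h2, h3, h4⟩

section Precision

variable {a : ℕ → ℝ≥0} {η : ℝ} {M : ℕ} (ha : Monotone a)
  (hM : ∀ i : ℕ, M < i → |(a i : ℝ) - i| ≤ η * i)
include hM

lemma le_of_precision {i : ℕ} (hi : M < i) : (a i : ℝ) ≤ (1 + η) * i := by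
  have := (abs_le.1 (hM i hi)).2; linarith

lemma ge_of_precision {i : ℕ} (hi : M < i) : (1 - η) * i ≤ (a i : ℝ) := by
  have := (abs_le.1 (hM i hi)).1; linarith

include ha in
/-- The arrivals until time `T` and those until time `(1 + δ) * T` are of about the same number. -/
lemma arrivalCount_le_mul {lam : ℝ≥0} {δ : ℝ≥0} (hlam : 0 < lam)
    (htop : Tendsto (fun i => a i / lam) atTop atTop)
    (hη : 0 < η) (hη1 : η < 1 / 2) (hηlam : η * (1 + η) ≤ lam)
    (hratio : (1 + η) * (η / lam + (1 + δ) / (1 - η)) ≤ 1 + 2 * δ) {T : ℝ≥0}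
    (hT : M + 1 ≤ η * T) :
    (arrivalCount (fun i => a i / lam) ((1 + δ) * T) : ℝ) ≤
      (1 + 2 * δ) * arrivalCount (fun i => a i / lam) T := by
  have hlam' : (0 : ℝ) < lam := hlam
  have hmono := monotone_div ha lam
  have hiff : ∀ {S : ℝ≥0} {i : ℕ}, i < arrivalCount (fun i => a i / lam) S ↔ (a i : ℝ) ≤ lam * S := by
    intro S i
    rw [lt_arrivalCount_iff hmono htop, div_le_iff₀ hlam, mul_comm]
    exact_mod_cast Iff.rfl
  set K := arrivalCount (fun i => a i / lam) T
  set K' := arrivalCount (fun i => a i / lam) ((1 + δ) * T)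
  have hK : (lam : ℝ) * T < (1 + η) * K := by
    have h1 : (lam : ℝ) * T < a K := by
      rw [← not_le]; exact fun h => lt_irrefl _ (hiff.2 h)
    by_cases hMK : M < K
    · exact h1.trans_le (le_of_precision hM hMK)
    · exfalso
      have h2 : (a K : ℝ) ≤ a (M + 1) := by exact_mod_cast ha (by omega)
      have h3 := le_of_precision hM (Nat.lt_succ_self M)
      push_cast at h3
      have h4 : (1 + η) * (M + 1) ≤ (1 + η) * (η * T) := by gcongr
      have h5 : η * (1 + η) * T ≤ lam * T := by gcongr
      nlinarith
  have hK' : (K' : ℝ) ≤ M + 1 + lam * ((1 + δ) * T) / (1 - η) := by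
    have hpos : 0 ≤ lam * ((1 + δ) * T) / (1 - η) := by
      have : 0 < 1 - η := by linarith
      positivity
    by_cases hMK : K' ≤ M + 1
    · have : (K' : ℝ) ≤ M + 1 := by exact_mod_cast hMK
      linarith
    · obtain ⟨j, hj⟩ : ∃ j, K' = j + 1 := ⟨K' - 1, by omega⟩
      have h1 : (a j : ℝ) ≤ lam * (((1 + δ) * T : ℝ≥0) : ℝ) := hiff.1 (by omega)
      push_cast at h1
      have h2 := ge_of_precision hM (show M < j by omega)
      have h3 : (j : ℝ) ≤ lam * ((1 + δ) * T) / (1 - η) := by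
        rw [le_div_iff₀ (by linarith)]; linarith
      rw [hj]; push_cast
      have := Nat.cast_nonneg (α := ℝ) M
      linarith
  calc (K' : ℝ) ≤ η * T + lam * ((1 + δ) * T) / (1 - η) := by linarith
    _ = lam * T * (η / lam + (1 + δ) / (1 - η)) := by field_simp
    _ ≤ (1 + η) * K * (η / lam + (1 + δ) / (1 - η)) := by
        have : 0 < 1 - η := by linarith
        gcongr
    _ = (1 + η) * (η / lam + (1 + δ) / (1 - η)) * K := by ring
    _ ≤ _ := by gcongr

include ha in
/-- When the arrivals stop at time `T`, the queue is empty at the times `t ≥ (1 + δ) * T` up to an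
exponentially small probability. The arrivals before time `T` are compared with arrivals at the
intermediate rate `(c + lam) / 2`, that begin after an initial delay. -/
lemma canonicalLaw_min_le {c : ℝ} {lam : ℝ≥0} {δ ζ : ℝ} (hlam : 0 < lam) (hc : lam < c)
    (hδ : 0 < δ) (hζ : 0 < ζ) (hη : 0 < η) (hη1 : η < 1 / 2)
    (hload : (1 - 2 / (c + lam) * lam / (1 + η)) / (1 + δ) + 2 / (c + lam) * lam / (1 - η) - 1
      ≤ -ζ) {T : ℝ≥0} {t : ℝ} (hT : (1 + δ) * T ≤ t)
    (ht : 6 * (2 / (c + lam)) / ζ * (M + 1) ≤ t) :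
    ∃ N : ℕ, t < ((a N / lam : ℝ≥0) : ℝ) ∧
      canonicalLaw c (fun j => min (a j / lam) T) N (Set.Ioi t) ≤
        ENNReal.ofReal ((ζ * (c + lam) / 4 + 2 * lam) / ((c - lam) * ζ / 8) *
          Real.exp (-((c - lam) * ζ / 8) * t)) := by
  have hlam' : (0 : ℝ) < lam := hlam
  have hc0 : 0 < c := hlam'.trans hc
  have hMn := Nat.cast_nonneg (α := ℝ) M
  set q := 2 / (c + lam) with hq
  have hq0 : 0 < q := by positivity
  have hr1 : q * lam < 1 := by
    rw [hq, div_mul_eq_mul_div, div_lt_one (by linarith)]; linarith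
  have ht0 : 0 < t := lt_of_lt_of_le (by positivity) ht
  have h1η : 0 < 1 - η := by linarith
  -- request number `N` arrives after time `t`, by the lower bound on the arrival times
  set N := M + 2 + ⌊lam * t / (1 - η)⌋₊ with hN
  -- the minimum of `a j / lam` and `T` is at most their mean with the weights `w` and `1 - w`
  set w := q * lam / (1 + η) with hw
  have hw0 : 0 ≤ w := by positivity
  have hw1 : w ≤ 1 := by
    rw [hw, div_le_one (by linarith)]; linarith
  set A := (1 - w) * T + q * (M + 1) with hA
  have hNlow : lam * t / (1 - η) < N := by
    have := Nat.lt_floor_add_one (lam * t / (1 - η))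
    rw [hN]; push_cast; linarith
  have hNup : (N : ℝ) ≤ M + 2 + lam * t / (1 - η) := by
    have := Nat.floor_le (show 0 ≤ lam * t / (1 - η) by positivity)
    rw [hN]; push_cast; linarith
  refine ⟨N, ?_, ?_⟩
  · have h1 := ge_of_precision hM (show M < N by omega)
    rw [div_lt_iff₀ h1η] at hNlow
    push_cast
    rw [lt_div_iff₀ hlam']
    linarith
  have hq' : c - (c - lam) / 2 = 1 / q := by rw [hq]; field_simp; ring
  have hA0 : 0 ≤ A := by
    have : 0 ≤ 1 - w := by linarith
    positivity
  have hwa : ∀ x : ℝ, w * ((1 + η) * x / lam) = q * x := by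
    intro x; rw [hw]; field_simp
  have hbound : ∀ j : ℕ, ((min (a j / lam) T : ℝ≥0) : ℝ) ≤ A + j / (c - (c - lam) / 2) := by
    intro j
    have hjn := Nat.cast_nonneg (α := ℝ) j
    rw [hq', div_div_eq_mul_div, div_one]
    set x : ℝ := a j / lam with hx
    have hmin : ((min (a j / lam) T : ℝ≥0) : ℝ) ≤ (1 - w) * T + w * x := by
      push_cast
      rcases le_total x T with h | h
      · rw [min_eq_left h]; nlinarith
      · rw [min_eq_right h]; nlinarith
    have hwx : w * x ≤ q * (M + 1) + j * q := by
      by_cases hj : M < j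
      · have h1 : x ≤ (1 + η) * j / lam := by
          rw [hx]; gcongr; exact le_of_precision hM hj
        have h2 := mul_le_mul_of_nonneg_left h1 hw0
        rw [hwa] at h2
        have := mul_nonneg hq0.le (add_nonneg hMn zero_le_one)
        linarith
      · have h1 : x ≤ (1 + η) * (M + 1) / lam := by
          have h3 := le_of_precision hM (Nat.lt_succ_self M)
          have h4 : (a j : ℝ) ≤ a (M + 1) := by exact_mod_cast ha (by omega)
          push_cast at h3
          rw [hx]; gcongr; linarith
        have h2 := mul_le_mul_of_nonneg_left h1 hw0
        rw [hwa] at h2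
        have := mul_nonneg hjn hq0.le
        linarith
    rw [hA]; linarith
  refine (canonicalLaw_Ioi_le_exp hc0 (show 0 < (c - lam) / 2 by linarith)
    (by linarith) hA0 hbound N t).trans (ENNReal.ofReal_le_ofReal ?_)
  rw [hq', div_div_eq_mul_div, div_one]
  have hC1 : 3 * q * (M + 1) ≤ ζ / 2 * t := by
    rw [div_mul_eq_mul_div, div_le_iff₀ hζ] at ht
    linarith
  have hexp : A + N * q - t ≤ -(ζ / 2) * t := by
    have h1 : (1 - w) * T ≤ (1 - w) / (1 + δ) * t := by
      rw [div_mul_eq_mul_div, le_div_iff₀ (by linarith)]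
      have := mul_le_mul_of_nonneg_left hT (sub_nonneg.2 hw1)
      linarith
    have h2 : N * q ≤ q * (M + 2) + q * lam / (1 - η) * t := by
      calc N * q ≤ (M + 2 + lam * t / (1 - η)) * q := by gcongr
        _ = _ := by ring
    have h3 := mul_le_mul_of_nonneg_right hload ht0.le
    have h4 : q * (M + 1) + q * (M + 2) ≤ 3 * q * (M + 1) := by
      have := mul_nonneg hq0.le hMn
      linarith
    have h5 : ((1 - w) / (1 + δ) + q * lam / (1 - η) - 1) * t =
      (1 - w) / (1 + δ) * t + q * lam / (1 - η) * t - t := by ring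
    rw [hA]
    linarith
  have hN1 : (N : ℝ) + 1 ≤ (ζ * (c + lam) / 4 + 2 * lam) * t := by
    have h1 : lam * t / (1 - η) ≤ 2 * lam * t := by
      rw [div_le_iff₀ h1η]
      have := mul_le_mul_of_nonneg_left hη1.le (mul_pos hlam' ht0).le
      linarith
    have h2 : 3 * ((M : ℝ) + 1) ≤ ζ * (c + lam) / 4 * t := by
      have h3 : ζ / 2 * t / q = ζ * (c + lam) / 4 * t := by rw [hq]; field_simp; norm_num
      rw [← h3, le_div_iff₀ hq0]; linarith
    linarith
  set β := (c - lam) * ζ / 8 with hβ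
  have hβ0 : 0 < β := by
    have : 0 < c - lam := by linarith
    positivity
  set D := ζ * (c + lam) / 4 + 2 * lam with hD
  have hD0 : 0 < D := by positivity
  have hexp' : (c - lam) / 2 * (A + N * q - t) ≤ -β * t + -β * t := by
    have : 0 < (c - lam) / 2 := by linarith
    have := mul_le_mul_of_nonneg_left hexp this.le
    rw [hβ]; linarith
  have hlin : t * Real.exp (-β * t) ≤ 1 / β := by
    have h1 := Real.add_one_le_exp (β * t)
    have h2 : Real.exp (β * t) * Real.exp (-β * t) = 1 := by
      rw [← Real.exp_add]; simp
    have h3 := Real.exp_pos (-β * t)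
    rw [le_div_iff₀ hβ0]
    nlinarith
  calc ((N : ℝ) + 1) * Real.exp ((c - lam) / 2 * (A + N * q - t))
      ≤ D * t * Real.exp (-β * t + -β * t) := by gcongr
    _ = D * (t * Real.exp (-β * t)) * Real.exp (-β * t) := by rw [Real.exp_add]; ring
    _ ≤ D * (1 / β) * Real.exp (-β * t) := by gcongr
    _ = _ := by ring

end Precision

/-! ### Work-conserving schemes attain the bound -/

lemma tendsto_lintegral_Ioi_zero {f : ℝ → ℝ≥0∞} (hf : ∫⁻ t in Set.Ioi (0 : ℝ), f t ≠ ⊤) :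
    Tendsto (fun T : ℝ≥0 => ∫⁻ t in Set.Ioi (T : ℝ), f t) atTop (𝓝 0) := by
  have h : Tendsto (fun T : ℝ≥0 => (volume.restrict (Set.Ioi (0 : ℝ))).withDensity f
      (Set.Ioi (T : ℝ))) atTop
      (𝓝 ((volume.restrict (Set.Ioi (0 : ℝ))).withDensity f (⋂ T : ℝ≥0, Set.Ioi (T : ℝ)))) := by
    refine tendsto_measure_iInter_atTop (fun _ => measurableSet_Ioi.nullMeasurableSet)
      (fun x y hxy => Set.Ioi_subset_Ioi (by exact_mod_cast hxy)) ⟨0, ?_⟩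
    rw [withDensity_apply _ measurableSet_Ioi]
    exact ne_top_of_le_ne_top hf (lintegral_mono' Measure.restrict_le_self le_rfl)
  have hempty : (⋂ T : ℝ≥0, Set.Ioi (T : ℝ)) = ∅ := by
    refine Set.eq_empty_of_forall_notMem fun x hx => ?_
    have := Set.mem_iInter.1 hx x.toNNReal
    exact absurd (Real.le_coe_toNNReal x) (not_le.2 this)
  rw [hempty, measure_empty] at h
  refine h.congr fun T => ?_
  rw [withDensity_apply _ measurableSet_Ioi, Measure.restrict_restrict measurableSet_Ioi,
    Set.inter_eq_left.2 (Set.Ioi_subset_Ioi T.coe_nonneg)]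

lemma lintegral_exp_ne_top (C : ℝ) {b : ℝ} (hb : 0 < b) :
    ∫⁻ t in Set.Ioi (0 : ℝ), ENNReal.ofReal (C * Real.exp (-b * t)) ≠ ⊤ := by
  have h := (exp_neg_integrableOn_Ioi 0 hb).const_mul C
  exact (h.lintegral_lt_top).ne

/-- For a fixed realization of the arrivals, at a rate below the service rate, a work-conserving
scheme is as good as the canonical delays, up to a factor close to one and up to vanishing terms.
The numbers `M` and `η` tell how fast the arrivals settle at their rate. -/
theorem Scheme.WorkConserving.meanDelay_le {L n : ℕ} {s : Scheme L n} (hs : s.WorkConserving)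
    (hL : 1 ≤ L) {mu : ℝ} (hmu : 0 < mu) {lam : ℝ≥0} (hlam : 0 < lam) (hlt : (lam : ℝ) < L * mu)
    {δ : ℝ≥0} (hδ : 0 < δ) :
    ∃ η : ℝ, 0 < η ∧ ∃ C : ℝ≥0, ∃ Ψ : ℝ≥0 → ℝ≥0∞, Tendsto Ψ atTop (𝓝 0) ∧
      ∀ (a : ℕ → ℝ≥0) (M : ℕ), Monotone a → Tendsto (fun i => a i / lam) atTop atTop →
        (∀ i : ℕ, M < i → |(a i : ℝ) - i| ≤ η * i) → ∀ T : ℝ≥0,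
        s.meanDelay mu (fun i => a i / lam) T ≤
          (1 + 2 * δ : ℝ≥0) * meanCanonicalDelay (L * mu) (fun i => a i / lam)
            (arrivalCount (fun i => a i / lam) ((1 + δ) * T)) +
          (Ψ T + if η * T < M + 1 then (C : ℝ≥0∞) * (M + 1) else 0) := by
  have hlam' : (0 : ℝ) < lam := hlam
  have hδ' : (0 : ℝ) < δ := hδ
  set c : ℝ := L * mu with hc
  obtain ⟨ζ, hζ, η, hη, hη1, hload, hratio, hC1, hηlam⟩ := exists_precision hlam' hlt hδ'
  set C₁ := 6 * (2 / (c + lam)) / ζ with hC₁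
  have hC₁0 : 0 < C₁ := by positivity
  set β := (c - lam) * ζ / 8
  have hβ : 0 < β := by
    have : 0 < c - lam := by linarith
    positivity
  set C₂ := (ζ * (c + lam) / 4 + 2 * lam) / β
  set ψ : ℝ → ℝ≥0∞ := fun t => ENNReal.ofReal (C₂ * Real.exp (-β * t))
  refine ⟨η, hη, ((1 + δ) / η + C₁).toNNReal, fun T => ∫⁻ t in Set.Ioi (T : ℝ), ψ t,
    tendsto_lintegral_Ioi_zero (lintegral_exp_ne_top C₂ hβ), fun a M ha htop hM T => ?_⟩
  set b : ℕ → ℝ≥0 := fun i => a i / lam with hb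
  have hbm : Monotone b := monotone_div ha lam
  refine s.meanDelay_le hmu fun u => ?_
  set K := arrivalCount b T with hK
  -- the tails of the departure times beyond a late time
  have htail : ∀ R : ℝ≥0, (1 + δ) * T ≤ R → C₁ * (M + 1) ≤ R →
      ∑ i ∈ Finset.range K, ∫⁻ t in Set.Ioi (R : ℝ), downloadLaw (ℕ × Fin n) mu
        {X | ENNReal.ofReal t < s.start.departure (realization b u X) i} ≤
      K * ∫⁻ t in Set.Ioi (T : ℝ), ψ t := by
    intro R hR1 hR2
    have hTR : T ≤ R := le_trans (by rw [add_mul, one_mul]; exact le_self_add) hR1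
    have hR1' : (1 + δ) * (T : ℝ) ≤ R := by exact_mod_cast hR1
    have hTR' : (T : ℝ) ≤ R := by exact_mod_cast hTR
    calc _ ≤ ∑ i ∈ Finset.range K, ∫⁻ t in Set.Ioi (T : ℝ), ψ t := by
          refine Finset.sum_le_sum fun i hi => ?_
          have hiT : b i ≤ T := (lt_arrivalCount_iff hbm htop).1 (Finset.mem_range.1 hi)
          refine le_trans (setLIntegral_mono' measurableSet_Ioi fun t ht => ?_)
            (lintegral_mono_set (Set.Ioi_subset_Ioi hTR'))
          have ht' : (R : ℝ) ≤ t := le_of_lt ht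
          obtain ⟨N, hN, hle⟩ := canonicalLaw_min_le ha hM hlam hlt hδ' hζ hη hη1 hload
            (hR1'.trans ht') (hR2.trans ht')
          exact (hs.departure_tail_le hbm htop u hmu hL hiT (hTR'.trans ht') hN).trans hle
      _ = _ := by simp
  by_cases hgood : M + 1 ≤ η * T
  · rw [if_neg (not_lt.2 hgood), add_zero]
    set K' := arrivalCount b ((1 + δ) * T)
    have hKK : (K' : ℝ≥0∞) ≤ (1 + 2 * δ : ℝ≥0) * K := by
      have h := arrivalCount_le_mul ha hM hlam htop hη hη1 hηlam hratio hgood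
      have h' : (K' : ℝ≥0) ≤ (1 + 2 * δ) * K := by exact_mod_cast h
      have h'' : ((K' : ℝ≥0) : ℝ≥0∞) ≤ (((1 + 2 * δ) * K : ℝ≥0) : ℝ≥0∞) :=
        ENNReal.coe_le_coe.2 h'
      simpa using h''
    have hT' : (1 + δ) * T < b K' := by
      rw [← not_le]; exact fun h => lt_irrefl _ ((lt_arrivalCount_iff hbm htop).2 h)
    have hlate : C₁ * (M + 1) ≤ ((1 + δ) * T : ℝ≥0) := by
      have h1 : C₁ * (M + 1) ≤ C₁ * (η * T) := by gcongr
      have h2 : C₁ * η * T ≤ 1 * T := by gcongr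
      have h3 : 0 ≤ (δ : ℝ) * T := by positivity
      push_cast
      linarith
    refine (ENNReal.div_le_div_right
      ((hs.lintegral_sum_delay_le hbm htop u hmu hL hT').trans
        (add_le_add le_rfl (htail _ le_rfl hlate))) _).trans ?_
    rw [ENNReal.add_div]
    refine add_le_add ?_ ?_
    · unfold meanCanonicalDelay
      by_cases hK' : K' = 0
      · simp [hK']
      rw [← mul_div_assoc]
      refine ENNReal.div_le_of_le_mul ?_
      have hK'0 : (K' : ℝ≥0∞) ≠ 0 := Nat.cast_ne_zero.2 hK'
      set Sm := ∑ d ∈ Finset.range K', canonicalDelay c b d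
      calc Sm = K' * (Sm / K') := by
            rw [ENNReal.mul_div_cancel hK'0 (ENNReal.natCast_ne_top K')]
        _ ≤ (1 + 2 * δ : ℝ≥0) * K * (Sm / K') := by gcongr
        _ = _ := by simp only [div_eq_mul_inv]; ring
    · refine ENNReal.div_le_of_le_mul ?_
      rw [mul_comm]
  · rw [if_pos (not_le.1 hgood)]
    refine le_trans ?_ le_add_self
    -- here `T` is bounded by a multiple of `M + 1`, and so is the time `R`, after which the tails
    -- are small
    set R : ℝ≥0 := max ((1 + δ) * T) (C₁ * (M + 1)).toNNReal with hR
    have hR2 : C₁ * (M + 1) ≤ R := by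
      rw [hR]; push_cast
      exact (Real.le_coe_toNNReal _).trans (le_max_right _ _)
    have hRle : (R : ℝ≥0∞) ≤ (((1 + δ) / η + C₁).toNNReal : ℝ≥0∞) * (M + 1) := by
      have h : R ≤ ((1 + δ) / η + C₁).toNNReal * (M + 1) := by
        have h0 : 0 ≤ (1 + δ) / η := by positivity
        rw [← NNReal.coe_le_coe, hR]
        push_cast
        rw [Real.coe_toNNReal _ (by positivity), Real.coe_toNNReal _ (by positivity),
          add_mul _ C₁]
        refine max_le ?_ ?_
        · have h1 : (1 + δ) / η * (η * T) ≤ (1 + δ) / η * (M + 1) :=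
            mul_le_mul_of_nonneg_left (not_le.1 hgood).le h0
          have h2 : (1 + δ) / η * (η * T) = (1 + δ) * T := by field_simp
          rw [h2] at h1
          exact h1.trans (le_add_of_nonneg_right (by positivity))
        · exact le_add_of_nonneg_left (by positivity)
      have h' := ENNReal.coe_le_coe.2 h
      simpa using h'
    refine (ENNReal.div_le_div_right ((s.lintegral_sum_delay_le_mul (a := b) u hmu K R).trans
        (add_le_add le_rfl (htail R (le_max_left _ _) hR2))) _).trans ?_
    rw [← mul_add]
    refine ENNReal.div_le_of_le_mul ?_
    rw [mul_comm, add_comm]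
    gcongr

/-- The last index at which `a i / i` is not within `η` of its limit `1`. -/
noncomputable def lastDeviation (η : ℝ) (a : ℕ → ℝ≥0) : ℝ≥0∞ :=
  ⨆ (i : ℕ) (_ : η * i < |(a i : ℝ) - i|), (i : ℝ≥0∞)

lemma measurable_lastDeviation (η : ℝ) : Measurable (lastDeviation η) := by
  refine Measurable.iSup fun i => ?_
  have h : Measurable fun a : ℕ → ℝ≥0 => |(a i : ℝ) - i| :=
    ((measurable_coe_nnreal_real.comp (measurable_pi_apply i)).sub_const _).abs
  have hset : MeasurableSet {a : ℕ → ℝ≥0 | η * i < |(a i : ℝ) - i|} :=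
    measurableSet_lt measurable_const h
  have : (fun a : ℕ → ℝ≥0 => ⨆ (_ : η * i < |(a i : ℝ) - i|), (i : ℝ≥0∞)) =
      {a : ℕ → ℝ≥0 | η * i < |(a i : ℝ) - i|}.indicator fun _ => (i : ℝ≥0∞) := by
    ext a
    by_cases hi : η * i < |(a i : ℝ) - i| <;> simp [hi]
  rw [this]
  exact measurable_const.indicator hset

/-- The comparison of a work-conserving scheme with the canonical delays, averaged over the
arrivals. -/
theorem Scheme.WorkConserving.limsup_lintegral_meanDelay_le {L n : ℕ} {s : Scheme L n}
    (hs : s.WorkConserving) (hL : 1 ≤ L) {mu : ℝ} (hmu : 0 < mu) {lam : ℝ≥0} (hlam : 0 < lam)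
    (hlt : (lam : ℝ) < L * mu) {ν : Measure (ℕ → ℝ≥0)} (hν : IsArrivalProcess ν)
    (hq : HasQuickRate ν) {y : ℝ≥0∞} (hy : y ≠ ⊤)
    (h : ∀ᶠ T : ℝ≥0 in atTop, ∫⁻ a, meanCanonicalDelay (L * mu) (fun i => a i / lam)
      (arrivalCount (fun i => a i / lam) T) ∂ν ≤ y) :
    limsup (fun T : ℝ≥0 => ∫⁻ a, s.meanDelay mu (fun i => a i / lam) T ∂ν) atTop ≤ y := by
  have := hν.isProbabilityMeasure
  have key : ∀ δ : ℝ≥0, 0 < δ →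
      limsup (fun T : ℝ≥0 => ∫⁻ a, s.meanDelay mu (fun i => a i / lam) T ∂ν) atTop ≤
        (1 + 2 * δ : ℝ≥0) * y := by
    intro δ hδ
    obtain ⟨η, hη, C, Ψ, hΨ, hle⟩ := hs.meanDelay_le hL hmu hlam hlt hδ
    have hB : ∫⁻ a, lastDeviation η a ∂ν < ⊤ := hq η hη
    have hBm := measurable_lastDeviation η
    set E : ℝ≥0 → (ℕ → ℝ≥0) → ℝ≥0∞ := fun T a =>
      {a | ENNReal.ofReal (η * T) < lastDeviation η a + 1}.indicator
        (fun a => (C : ℝ≥0∞) * (lastDeviation η a + 1)) a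
    have hEm : ∀ T, Measurable (E T) := fun T =>
      ((hBm.add_const 1).const_mul _).indicator (measurableSet_lt measurable_const (hBm.add_const 1))
    have hbound : ∀ T : ℝ≥0, ∫⁻ a, s.meanDelay mu (fun i => a i / lam) T ∂ν ≤
        (1 + 2 * δ : ℝ≥0) * (∫⁻ a, meanCanonicalDelay (L * mu) (fun i => a i / lam)
          (arrivalCount (fun i => a i / lam) ((1 + δ) * T)) ∂ν) + (Ψ T + ∫⁻ a, E T a ∂ν) := by
      intro T
      rw [← lintegral_const_mul' _ _ ENNReal.coe_ne_top]
      have hconst : Ψ T = ∫⁻ _, Ψ T ∂ν := by simp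
      rw [hconst, ← lintegral_add_left measurable_const,
        ← lintegral_add_right _ (show Measurable fun a => Ψ T + E T a from
          measurable_const.add (hEm T))]
      refine lintegral_mono_ae ?_
      filter_upwards [hν.monotone, hν.rate_one, ae_lt_top hBm hB.ne] with a ha hrate hBa
      have hMB : ((⌊(lastDeviation η a).toReal⌋₊ : ℕ) : ℝ≥0∞) ≤ lastDeviation η a := by
        rw [← ENNReal.ofReal_toReal hBa.ne, ← ENNReal.ofReal_natCast,
          ENNReal.toReal_ofReal ENNReal.toReal_nonneg]
        exact ENNReal.ofReal_le_ofReal (Nat.floor_le ENNReal.toReal_nonneg)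
      refine (hle a ⌊(lastDeviation η a).toReal⌋₊ ha (tendsto_atTop_of_rate_one hrate hlam)
        (fun i hi => ?_) T).trans ?_
      · by_contra hlt
        have h1 : (i : ℝ≥0∞) ≤ lastDeviation η a := le_iSup₂_of_le i (not_le.1 hlt) le_rfl
        have h2 : (i : ℝ) ≤ (lastDeviation η a).toReal := by
          have := ENNReal.toReal_mono hBa.ne h1
          simpa using this
        exact absurd (Nat.le_floor h2) (not_le.2 hi)
      · gcongr
        split_ifs with hif
        · have hmem : a ∈ {a | ENNReal.ofReal (η * T) < lastDeviation η a + 1} := by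
            refine lt_of_lt_of_le ?_ (add_le_add hMB le_rfl)
            rw [← ENNReal.ofReal_natCast, ← ENNReal.ofReal_one,
              ← ENNReal.ofReal_add (Nat.cast_nonneg _) zero_le_one,
              ENNReal.ofReal_lt_ofReal_iff (by positivity)]
            exact hif
          refine le_trans ?_ (Set.indicator_of_mem hmem _).ge
          gcongr
        · exact zero_le
    have hE0 : Tendsto (fun T => ∫⁻ a, E T a ∂ν) atTop (𝓝 0) := by
      have hlim := tendsto_lintegral_filter_of_dominated_convergence (μ := ν) (l := atTop)
        (F := E) (f := fun _ => 0) (fun a => (C : ℝ≥0∞) * (lastDeviation η a + 1))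
        (Eventually.of_forall hEm)
        (Eventually.of_forall fun T => Eventually.of_forall fun a => Set.indicator_le_self _ _ a)
        ?_ ?_
      · simpa using hlim
      · rw [lintegral_const_mul _ (hBm.add_const 1), lintegral_add_right _ measurable_const]
        refine ENNReal.mul_ne_top ENNReal.coe_ne_top (ENNReal.add_ne_top.2 ⟨hB.ne, ?_⟩)
        simp
      · filter_upwards [ae_lt_top hBm hB.ne] with a hBa
        refine tendsto_const_nhds.congr' ?_
        have htop : Tendsto (fun T : ℝ≥0 => ENNReal.ofReal (η * T)) atTop (𝓝 ⊤) :=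
          ENNReal.tendsto_ofReal_atTop.comp
            ((NNReal.tendsto_coe_atTop.2 tendsto_id).const_mul_atTop hη)
        have hfin : lastDeviation η a + 1 < ⊤ := ENNReal.add_lt_top.2 ⟨hBa, ENNReal.one_lt_top⟩
        filter_upwards [htop.eventually (lt_mem_nhds hfin)] with T hT
        exact (Set.indicator_of_notMem (not_lt.2 hT.le) _).symm
    have hshift : Tendsto (fun T : ℝ≥0 => (1 + δ) * T) atTop atTop := by
      refine tendsto_atTop_mono (fun T => ?_) tendsto_id
      rw [add_mul, one_mul]
      exact le_self_add
    have hlim : Tendsto (fun T => (1 + 2 * δ : ℝ≥0) * y + (Ψ T + ∫⁻ a, E T a ∂ν)) atTop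
        (𝓝 ((1 + 2 * δ : ℝ≥0) * y)) := by
      simpa using (hΨ.add hE0).const_add ((1 + 2 * δ : ℝ≥0) * y)
    rw [← hlim.limsup_eq]
    refine limsup_le_limsup ?_
    filter_upwards [hshift.eventually h] with T hT
    refine (hbound T).trans ?_
    gcongr
  have hlim : Tendsto (fun δ : ℝ≥0 => ((1 + 2 * δ : ℝ≥0) : ℝ≥0∞) * y) (𝓝[>] 0) (𝓝 y) := by
    have h1 : Tendsto (fun δ : ℝ≥0 => ((1 + 2 * δ : ℝ≥0) : ℝ≥0∞) * y) (𝓝 0)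
        (𝓝 (((1 + 2 * 0 : ℝ≥0) : ℝ≥0∞) * y)) := by
      refine ENNReal.Tendsto.mul_const ?_ (Or.inr hy)
      have : Continuous fun δ : ℝ≥0 => ((1 + 2 * δ : ℝ≥0) : ℝ≥0∞) := by fun_prop
      exact this.tendsto 0
    simp only [mul_zero, add_zero, ENNReal.coe_one, one_mul] at h1
    exact h1.mono_left nhdsWithin_le_nhds
  exact ge_of_tendsto hlim (by filter_upwards [self_mem_nhdsWithin] with δ hδ using key δ hδ)

/-! ### Optimality -/

section

variable {L n : ℕ} {mu : ℝ} (hL : 1 ≤ L) (hmu : 0 < mu) {ν : Measure (ℕ → ℝ≥0)}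
  (hν : IsArrivalProcess ν)
include hL hmu hν

lemma Scheme.lintegral_meanCanonicalDelay_le (s : Scheme L n) {lam : ℝ≥0} (hlam : 0 < lam)
    (T : ℝ≥0) :
    ∫⁻ a, meanCanonicalDelay (L * mu) (fun i => a i / lam)
      (arrivalCount (fun i => a i / lam) T) ∂ν ≤
      ∫⁻ a, s.meanDelay mu (fun i => a i / lam) T ∂ν := by
  refine lintegral_mono_ae ?_
  filter_upwards [hν.monotone, hν.rate_one] with a ha hrate
  exact s.meanCanonicalDelay_le hL hmu (monotone_div ha lam)
    (tendsto_atTop_of_rate_one hrate hlam) T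

/-- No scheme stabilizes the queue at a rate above the total service rate of the threads. -/
theorem le_of_mem_capacityRegion {lam : ℝ≥0} (h : lam ∈ capacityRegion L n mu ν) :
    (lam : ℝ) ≤ L * mu := by
  have := hν.isProbabilityMeasure
  obtain ⟨hlam, s, hs⟩ := h
  have hc : 0 < (L : ℝ) * mu := by positivity
  have hlam' : (0 : ℝ) < lam := hlam
  by_contra! hlt
  have hpath : ∀ᵐ a ∂ν,
      Tendsto (fun N : ℕ => s.meanDelay mu (fun i => a i / lam) N) atTop (𝓝 ⊤) := by
    filter_upwards [hν.monotone, hν.rate_one] with a ha hrate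
    have hm := monotone_div ha lam
    have ht := tendsto_atTop_of_rate_one hrate hlam
    obtain ⟨x, hx1, hx2⟩ := exists_between (one_div_lt_one_div_of_lt hc hlt)
    have hx : 1 < x * lam := by rwa [div_lt_iff₀ hlam'] at hx1
    have hev : ∀ᶠ d : ℕ in atTop, ((a d / lam : ℝ≥0) : ℝ) ≤ x * d := by
      filter_upwards [hrate.eventually (gt_mem_nhds hx), eventually_gt_atTop 0] with d hd hd0
      have : (0 : ℝ) < d := by exact_mod_cast hd0
      rw [div_lt_iff₀ this] at hd
      push_cast
      rw [div_le_iff₀ hlam']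
      linarith
    have hcount : Tendsto (fun N : ℕ => arrivalCount (fun i => a i / lam) N) atTop atTop := by
      refine tendsto_atTop.2 fun k => ?_
      filter_upwards [tendsto_natCast_atTop_atTop.eventually_ge_atTop (a k / lam)] with N hN
      exact ((lt_arrivalCount_iff hm ht).2 hN).le
    exact tendsto_nhds_top_mono ((tendsto_meanCanonicalDelay_atTop hc hx2 hev).comp hcount)
      (Eventually.of_forall fun N => s.meanCanonicalDelay_le hL hmu hm ht N)
  have hfatou : (⊤ : ℝ≥0∞) ≤
      liminf (fun N : ℕ => ∫⁻ a, s.meanDelay mu (fun i => a i / lam) N ∂ν) atTop := by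
    calc (⊤ : ℝ≥0∞) = ∫⁻ _, ⊤ ∂ν := by simp
      _ = ∫⁻ a, liminf (fun N : ℕ => s.meanDelay mu (fun i => a i / lam) N) atTop ∂ν := by
          refine lintegral_congr_ae ?_
          filter_upwards [hpath] with a ha using ha.liminf_eq.symm
      _ ≤ _ := lintegral_liminf_le fun N => (s.measurable_meanDelay hmu N).comp (measurable_div_rate lam)
  unfold Stable at hs
  rw [s.expectedDelay_atRate hmu] at hs
  obtain ⟨y, hy1, hy2⟩ := exists_between hs
  have hev := tendsto_natCast_atTop_atTop.eventually (eventually_lt_of_limsup_lt hy1)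
  have : liminf (fun N : ℕ => ∫⁻ a, s.meanDelay mu (fun i => a i / lam) N ∂ν) atTop ≤ y :=
    liminf_le_of_frequently_le' (hev.mono fun N hN => le_of_lt hN).frequently
  exact absurd (hfatou.trans this) (not_le.2 hy2)

/-- A work-conserving scheme is optimal when the averages are taken over arrivals that settle
quickly at their rate. -/
theorem Scheme.WorkConserving.throughputOptimal_and_delayOptimal {s : Scheme L n}
    (hs : s.WorkConserving) (hq : HasQuickRate ν) :
    ThroughputOptimal mu ν s ∧ DelayOptimal mu ν s := by
  have := hν.isProbabilityMeasure
  have hlt : ∀ {lam ε : ℝ≥0}, 0 < ε → lam + ε ∈ capacityRegion L n mu ν →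
      (lam : ℝ) < L * mu := by
    intro lam ε hε h
    have h1 := le_of_mem_capacityRegion hL hmu hν h
    push_cast at h1
    have : (0 : ℝ) < ε := hε
    linarith
  constructor
  · rintro lam hlam ⟨ε, hε, h⟩
    obtain ⟨hpos, s', hs'⟩ := id h
    unfold Stable at hs' ⊢
    rw [Scheme.expectedDelay_atRate _ hmu] at hs' ⊢
    obtain ⟨y, hy1, hy2⟩ := exists_between hs'
    set k : ℝ≥0 := lam / (lam + ε) with hk
    have hk0 : 0 < k := by positivity
    have hk1 : k ≤ 1 := by
      rw [hk, div_le_one hpos]; exact le_self_add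
    have hkne : (k : ℝ≥0∞) ≠ 0 := by exact_mod_cast hk0.ne'
    have hscale : ∀ (a : ℕ → ℝ≥0) (i : ℕ), a i / (lam + ε) = k * (a i / lam) := by
      intro a i; rw [hk]; field_simp
    have hyk : (k : ℝ≥0∞)⁻¹ * y ≠ ⊤ := ENNReal.mul_ne_top (ENNReal.inv_ne_top.2 hkne) hy2.ne
    refine lt_of_le_of_lt (hs.limsup_lintegral_meanDelay_le hL hmu hlam (hlt hε h) hν hq hyk ?_)
      hyk.lt_top
    have hshift : Tendsto (fun T : ℝ≥0 => k * T) atTop atTop :=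
      tendsto_id.const_mul_atTop hk0
    filter_upwards [hshift.eventually (eventually_lt_of_limsup_lt hy1)] with T hT
    calc ∫⁻ a, meanCanonicalDelay (L * mu) (fun i => a i / lam)
          (arrivalCount (fun i => a i / lam) T) ∂ν
        ≤ ∫⁻ a, (k : ℝ≥0∞)⁻¹ * meanCanonicalDelay (L * mu) (fun i => a i / (lam + ε))
          (arrivalCount (fun i => a i / (lam + ε)) (k * T)) ∂ν := by
          refine lintegral_mono fun a => ?_
          have hcount : arrivalCount (fun i => a i / (lam + ε)) (k * T) =
              arrivalCount (fun i => a i / lam) T := by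
            unfold arrivalCount
            simp only [hscale, mul_le_mul_iff_right₀ hk0]
          rw [hcount]
          exact meanCanonicalDelay_le_of_scale (by positivity) hk0 hk1 (hscale a) _
      _ = (k : ℝ≥0∞)⁻¹ * ∫⁻ a, meanCanonicalDelay (L * mu) (fun i => a i / (lam + ε))
          (arrivalCount (fun i => a i / (lam + ε)) (k * T)) ∂ν :=
          lintegral_const_mul' _ _ (ENNReal.inv_ne_top.2 hkne)
      _ ≤ (k : ℝ≥0∞)⁻¹ * ∫⁻ a, s'.meanDelay mu (fun i => a i / (lam + ε)) (k * T) ∂ν := by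
          exact mul_le_mul' le_rfl (s'.lintegral_meanCanonicalDelay_le hL hmu hν hpos _)
      _ ≤ (k : ℝ≥0∞)⁻¹ * y := by gcongr
  · rintro lam hlam ⟨ε, hε, h⟩ s'
    rw [Scheme.expectedDelay_atRate _ hmu, Scheme.expectedDelay_atRate _ hmu]
    refine le_of_forall_gt_imp_ge_of_dense fun y hy => ?_
    by_cases hytop : y = ⊤
    · rw [hytop]; exact le_top
    refine hs.limsup_lintegral_meanDelay_le hL hmu hlam (hlt hε h) hν hq hytop ?_
    filter_upwards [eventually_lt_of_limsup_lt hy] with T hT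
    exact (s'.lintegral_meanCanonicalDelay_le hL hmu hν hlam T).trans hT.le

end

lemma isArrivalProcess_dirac {a : ℕ → ℝ≥0} (ha : Monotone a)
    (hrate : Tendsto (fun i : ℕ => (a i : ℝ) / i) atTop (𝓝 1)) :
    IsArrivalProcess (Measure.dirac a) where
  isProbabilityMeasure := inferInstance
  monotone := by
    rw [ae_dirac_eq]; exact ha
  rate_one := by
    rw [ae_dirac_eq]; exact hrate

/-- For fixed arrival times the last deviation from the rate is a finite constant. -/
lemma hasQuickRate_dirac {a : ℕ → ℝ≥0}
    (hrate : Tendsto (fun i : ℕ => (a i : ℝ) / i) atTop (𝓝 1)) :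
    HasQuickRate (Measure.dirac a) := by
  intro η hη
  change ∫⁻ a, lastDeviation η a ∂(Measure.dirac a) < ⊤
  rw [lintegral_dirac' _ (measurable_lastDeviation η)]
  have hev := hrate.eventually (Metric.closedBall_mem_nhds (1 : ℝ) hη)
  obtain ⟨N, hN⟩ := hev.exists_forall_of_atTop
  refine lt_of_le_of_lt (iSup₂_le fun i hi => ?_) (ENNReal.natCast_lt_top N)
  rw [Nat.cast_le]
  by_contra! hlt
  have hi0 : (0 : ℝ) < i := by exact_mod_cast Nat.zero_lt_of_lt hlt
  have h1 := hN i hlt.le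
  rw [Real.dist_eq] at h1
  have h2 : |(a i : ℝ) - i| = |(a i : ℝ) / i - 1| * i := by
    rw [← abs_of_pos hi0, ← abs_mul, abs_of_pos hi0, sub_mul, div_mul_cancel₀ _ hi0.ne', one_mul]
  rw [h2] at hi
  exact absurd hi (not_lt.2 (mul_le_mul_of_nonneg_right h1 hi0.le))

end ReplicationQueue

theorem theorem1 (L n : ℕ) (hL : 1 ≤ L) (hn : L ≤ n) (mu : ℝ) (hmu : 0 < mu)
    (s : ReplicationQueue.Scheme L n) (hs : s.WorkConserving)
    (ν : Measure (ℕ → ℝ≥0)) (hν : ReplicationQueue.IsArrivalProcess ν) :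
    (∀ᵐ a ∂ν, ReplicationQueue.ThroughputOptimal mu (Measure.dirac a) s ∧
      ReplicationQueue.DelayOptimal mu (Measure.dirac a) s) ∧
    (ReplicationQueue.HasQuickRate ν →
      ReplicationQueue.ThroughputOptimal mu ν s ∧ ReplicationQueue.DelayOptimal mu ν s) := by
  refine ⟨?_, fun hq => hs.throughputOptimal_and_delayOptimal hL hmu hν hq⟩
  filter_upwards [hν.monotone, hν.rate_one] with a ha hrate
  exact hs.throughputOptimal_and_delayOptimal hL hmu
    (ReplicationQueue.isArrivalProcess_dirac ha hrate) (ReplicationQueue.hasQuickRate_dirac hrate)
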